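/- **Simplicial complexes and isometries.** For a connected simplicial complex $Y$ let $Y^0$ be its set of vertices, with the combinatorial (path) metric of the $1$-skeleton. An *isometry* $f:Y'\to Y$ of connected simplicial complexes is a simplicial map that (i) preserves the combinatorial distance between vertices, (ii) is such that every simplex of $Y$ of positive dimension whose boundary lies in the image of $f$ is itself in the image of $f$, and (iii) has convex image, i.e. every vertex lying on a geodesic of the $1$-skeleton of $Y$ between two vertices of $f(Y'^0)$ belongs to $f(Y'^0)$. If $P$ is a property of finite connected simplicial complexes, a simplicial complex $X$ is called *$P$-symmetric* if for all nonempty finite connected simplicial complexes $Y',Y$ with property $P$ and every isometry $i:Y'\to Y$, the number of isometries $\beta:Y\to X$ with $\beta\circ i=\alpha$ is finite, positive and the same for all isometries $\alpha:Y'\to X$. **Buildings.** Let $\Sigma$ be the tessellation of the Euclidean plane by equilateral triangles. A *building of type $\tilde A_2$* is a $2$-dimensional simplicial complex $X$ with a family of subcomplexes isomorphic to $\Sigma$ (apartments) such that any two simplices of $X$ lie in a common apartment, for any two apartments $A,A'$ there is an isomorphism $A\to A'$ fixing $A\cap A'$ pointwise, and every edge lies in at least $3$ triangles. The number of triangles containing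 an edge does not depend on the edge; assume that it is finite, equal to $q+1$. **The model wall-tree.** Let $T$ be the $(q+1)$-regular tree, with a base vertex $o$. The model wall-tree $\Upsilon$ is the flag complex with vertices the pairs $(z,n)$, $z$ a vertex of $T$ and $n\in\mathbb Z$ with $n\equiv d(o,z) \pmod 2$, in which $(z,n)$ is adjacent to $(z,n\pm 2)$ and to $(z',n\pm1)$ for $z'$ adjacent to $z$ in $T$. (Geometrically $\Upsilon$ is $T\times\mathbb R$ with tree edges of length $\sqrt3/2$ and $(z,n)$ at height $n/2$; over a bi-infinite geodesic of $T$ it is $\Sigma$.) A finite simplicial complex has property $P_\Upsilon$ if it admits an isometry into $\Upsilon$, i.e. if it is isomorphic to a finite convex subcomplex of $\Upsilon$. **Theorem.** Let $X$ be a building of type $\tilde A_2$ in which the (finite) number of triangles containing an edge is $q+1$. Then $X$ is $P_\Upsilon$-symmetric: for every isometry $i:Y'\to Y$ of nonempty finite connected complexes with property $P_\Upsilon$ there is an integer $[Y:Y']_i\ge 1$ such that every isometry $\alpha:Y'\to X$ has exactly $[Y:Y']_i$ extensions to an isometry $\beta:Y\to X$ with $\beta\circ i=\alpha$. -/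

import Mathlib

universe u v w

/-! Abstract simplicial complexes are Mathlib's `AbstractSimplicialComplex V`: families of nonempty
finite subsets of `V`, closed under nonempty subsets and containing all singletons, so that `V` is
exactly the set of vertices. -/

namespace BuildingSymmetry

/-- The `1`-skeleton of a simplicial complex, as a graph. It carries the combinatorial metric. -/
def skeleton {V : Type u} (K : AbstractSimplicialComplex V) : SimpleGraph V :=
  SimpleGraph.fromRel fun a b => ∃ s ∈ K.faces, a ∈ s ∧ b ∈ s

/-- The flag complex of a graph: its simplices are the nonempty finite cliques. -/
def flagComplex {V : Type u} (G : SimpleGraph V) : AbstractSimplicialComplex V where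
  faces := {s | s.Nonempty ∧ G.IsClique (s : Set V)}
  isRelLowerSet_faces := fun {_} hs =>
    ⟨hs.1, fun _ hts ht => ⟨ht, hs.2.subset (Finset.coe_subset.mpr hts)⟩⟩
  singleton_mem := fun x => ⟨Finset.singleton_nonempty x, by simp⟩

/-- A set of vertices of a graph is convex if it contains every vertex of every geodesic of the
graph that joins two of its members. -/
def GeodesicallyConvex {V : Type u} (G : SimpleGraph V) (S : Set V) : Prop :=
  ∀ a ∈ S, ∀ b ∈ S, ∀ p : G.Walk a b, p.length = G.dist a b → ∀ c ∈ p.support, c ∈ S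

open Classical in
/-- The image of a finite set of vertices under a map. -/
noncomputable def faceImage {V : Type u} {W : Type v} (f : V → W) (s : Finset V) : Finset W :=
  s.image f

theorem mem_faceImage {V : Type u} {W : Type v} {f : V → W} {s : Finset V} {y : W} :
    y ∈ faceImage f s ↔ ∃ x ∈ s, f x = y := by
  simp [faceImage]

/-- Isometries (isometric embeddings) of simplicial complexes, given by their action on vertices. -/
structure IsIsometry {V : Type u} {W : Type v} (K : AbstractSimplicialComplex V)
    (L : AbstractSimplicialComplex W) (f : V → W) : Prop where
  /-- the map is simplicial -/
  simplicial : ∀ s ∈ K.faces, faceImage f s ∈ L.faces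
  /-- it preserves the combinatorial distance between vertices -/
  edist_eq : ∀ a b, (skeleton L).edist (f a) (f b) = (skeleton K).edist a b
  /-- a simplex (of positive dimension) of the target whose boundary lies in the image
  is itself in the image -/
  full : ∀ t ∈ L.faces, 2 ≤ t.card →
    (∀ r, r.Nonempty → r ⊂ t → ∃ s ∈ K.faces, faceImage f s = r) → ∃ s ∈ K.faces, faceImage f s = t
  /-- the image is convex in the `1`-skeleton of the target -/
  convex : GeodesicallyConvex (skeleton L) (Set.range f)

/-- `X` is `P`-symmetric: for all nonempty finite connected complexes `Y'`, `Y` with the property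
`P` and every isometry `i : Y' → Y`, the number of isometries `β : Y → X` with `β ∘ i = α` is finite,
positive and the same for all isometries `α : Y' → X`. -/
def IsSymmetricFor {V : Type v} (X : AbstractSimplicialComplex V)
    (P : ∀ {Z : Type u}, AbstractSimplicialComplex Z → Prop) : Prop :=
  ∀ (Z' Z : Type u) [Finite Z'] [Finite Z]
    (Y' : AbstractSimplicialComplex Z') (Y : AbstractSimplicialComplex Z),
    (skeleton Y').Connected → (skeleton Y).Connected → P Y' → P Y →
    ∀ i : Z' → Z, IsIsometry Y' Y i →
      ∃ N : ℕ, 0 < N ∧ ∀ α : Z' → V, IsIsometry Y' X α →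
        {β : Z → V | IsIsometry Y X β ∧ β ∘ i = α}.encard = N

/-- The model apartment: the tessellation of the plane by equilateral triangles. The vertex `(a, b)`
is the point `a e₁ + b e₂` of the lattice spanned by unit vectors at angle `π / 3`, whose shortest
nonzero vectors are `± e₁`, `± e₂` and `± (e₁ - e₂)`. -/
def modelApartment : AbstractSimplicialComplex (ℤ × ℤ) :=
  flagComplex (SimpleGraph.fromRel fun p r => r - p = (1, 0) ∨ r - p = (0, 1) ∨ r - p = (1, -1))

/-- `A` is a subcomplex of `X` that is a copy of the model apartment. -/
def IsApartmentIn {V : Type u} (X : AbstractSimplicialComplex V)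
    (A : PreAbstractSimplicialComplex V) : Prop :=
  A.faces ⊆ X.faces ∧
    ∃ f : ℤ × ℤ ↪ V, A.faces = (fun s => s.map f) '' modelApartment.faces

/-- The set of triangles of `X` that contain the simplex `e`. -/
def trianglesOver {V : Type u} (X : AbstractSimplicialComplex V) (e : Finset V) :
    Set (Finset V) :=
  {t | t ∈ X.faces ∧ t.card = 3 ∧ e ⊆ t}

/-- `φ` restricts to an isomorphism of the subcomplex `A` onto the subcomplex `B`. -/
def IsSubcomplexIso {V : Type u} (A B : PreAbstractSimplicialComplex V) (φ : V → V) : Prop :=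
  Set.InjOn φ {x | {x} ∈ A.faces} ∧ faceImage φ '' A.faces = B.faces

/-- Buildings of type `Ã₂`. -/
structure IsA2TildeBuilding {V : Type u} (X : AbstractSimplicialComplex V) : Prop where
  /-- `X` has dimension two -/
  card_le_three : ∀ s ∈ X.faces, s.card ≤ 3
  exists_triangle : ∃ s ∈ X.faces, s.card = 3
  /-- there is a system of apartments such that any two simplices lie in a common apartment, and
  any two apartments are isomorphic by an isomorphism that fixes their intersection pointwise -/
  exists_apartments : ∃ 𝒜 : Set (PreAbstractSimplicialComplex V),
    (∀ A ∈ 𝒜, IsApartmentIn X A) ∧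
    (∀ s ∈ X.faces, ∀ t ∈ X.faces, ∃ A ∈ 𝒜, s ∈ A.faces ∧ t ∈ A.faces) ∧
    (∀ A ∈ 𝒜, ∀ B ∈ 𝒜, ∃ φ : V → V, IsSubcomplexIso A B φ ∧
      ∀ x, {x} ∈ A.faces → {x} ∈ B.faces → φ x = x)
  /-- every edge lies in at least three triangles -/
  thick : ∀ e ∈ X.faces, e.card = 2 → 3 ≤ (trianglesOver X e).encard

/-- Vertices of the model wall-tree over the tree `T` (with base point `o`): the pair `(z, n)` stands
for the point of `T × ℝ` over the vertex `z` at height `n / 2`; the vertices are those for which `n`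
has the parity of `d(o, z)`. -/
abbrev WallTreeVertex {W : Type w} (T : SimpleGraph W) (o : W) : Type w :=
  {p : W × ℤ // Even (p.2 - (T.dist o p.1 : ℤ))}

/-- The model wall-tree over the tree `T`. With tree edges of length `√3 / 2`, adjacent vertices are
those at distance `1` in `T × ℝ`: consecutive vertices of one fibre, and vertices over
adjacent vertices of `T` whose heights differ by `1 / 2`. The part over a bi-infinite geodesic of `T`
is a model apartment. -/
def modelWallTree {W : Type w} (T : SimpleGraph W) (o : W) :
    AbstractSimplicialComplex (WallTreeVertex T o) :=
  flagComplex (SimpleGraph.fromRel fun p r =>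
    (r.1.1 = p.1.1 ∧ r.1.2 = p.1.2 + 2) ∨ (T.Adj p.1.1 r.1.1 ∧ r.1.2 = p.1.2 + 1))

/-- The property of being a finite complex isometric to a convex subcomplex of the model wall-tree
over `T`. -/
def IsConvexInWallTree {W : Type w} (T : SimpleGraph W) (o : W) {Z : Type u}
    (Y : AbstractSimplicialComplex Z) : Prop :=
  Finite Z ∧ ∃ f : Z → WallTreeVertex T o, IsIsometry Y (modelWallTree T o) f

end BuildingSymmetry

/-! The argument takes place in `1`-skeletons. Buildings of type `Ã₂` and the wall-tree are flag
complexes, and so is any complex with an isometry into one of them, so an isometry is merely a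
distance-preserving map of vertices with convex image (`isIsometry_of_isFlag`).

Charts of apartments and retractions onto them show that the `1`-skeleton of a building satisfies
the few axioms of `IsBuildingGraph`: a proper `3`-colouring, two conditions on balls, and joins in
links. Links are then incidence graphs of projective planes, and all of them have the same order
`q`. The ball conditions make being an isometry a local matter (`isometric_of_local`): a map from a
connected graph that is an embedding with convex image around every vertex preserves distances and
has convex image. For maps defined on a finite convex part of the wall-tree this local condition is
`IsGood`.

Good maps make sense on arbitrary sets of vertices, so extensions can be counted one vertex at a
time, through sets that need not be convex. Four kinds of new vertex occur, according to its
neighbours among the old ones: a single isolated vertex, with `2 * (q ^ 2 + q + 1)` possible images;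
a single vertex with one other neighbour, opposite to the new vertex in the link, with `q ^ 2`
images; an edge, with `q + 1` images minus those already taken; a path of length two, with exactly
one image. No number depends on the map, and none vanishes: an edge of the wall-tree lies in at most
`q + 1` triangles, so an image is left for the new apex.

It remains to order the vertices suitably. A finite convex set of the wall-tree is a double cone:
over a finite subtree, the part between the upper cone of a lowest vertex and the lower cone of a
highest one (`IsWallConvex.exists_eq_doubleCone`). A double cone grows into a larger one by
attaching a fibre over a new leaf of the subtree or by moving its lower vertex one step; reflection
treats the upper vertex. Each such move is a sequence of the four one-vertex extensions, and the
counts multiply along the way (`uniformExtension_doubleCone`). -/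

namespace BuildingSymmetry

/-! ### Apartments as charts, and retractions onto apartments -/

/-- The graph of the triangular lattice. -/
def hexGraph : SimpleGraph (ℤ × ℤ) :=
  SimpleGraph.fromRel fun p r => r - p = (1, 0) ∨ r - p = (0, 1) ∨ r - p = (1, -1)

theorem hexGraph_adj {a b : ℤ × ℤ} : hexGraph.Adj a b ↔
    (b.1 = a.1 + 1 ∧ b.2 = a.2) ∨ (b.1 = a.1 ∧ b.2 = a.2 + 1) ∨ (b.1 = a.1 + 1 ∧ b.2 = a.2 - 1) ∨
    (b.1 = a.1 - 1 ∧ b.2 = a.2) ∨ (b.1 = a.1 ∧ b.2 = a.2 - 1) ∨ (b.1 = a.1 - 1 ∧ b.2 = a.2 + 1) := by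
  simp only [hexGraph, SimpleGraph.fromRel_adj, Prod.ext_iff, Prod.fst_sub, Prod.snd_sub, ne_eq]
  omega

theorem skeleton_adj {V : Type u} {K : AbstractSimplicialComplex V} {a b : V} :
    (skeleton K).Adj a b ↔ a ≠ b ∧ ∃ s ∈ K.faces, a ∈ s ∧ b ∈ s := by
  simp only [skeleton, SimpleGraph.fromRel_adj]
  constructor
  · rintro ⟨h, ⟨s, hs, h1, h2⟩ | ⟨s, hs, h1, h2⟩⟩
    exacts [⟨h, s, hs, h1, h2⟩, ⟨h, s, hs, h2, h1⟩]
  · rintro ⟨h, s, hs, h1, h2⟩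
    exact ⟨h, Or.inl ⟨s, hs, h1, h2⟩⟩

theorem mem_faces_of_subset {V : Type u} {K : AbstractSimplicialComplex V} {s t : Finset V}
    (hs : s ∈ K.faces) (hts : t ⊆ s) (ht : t.Nonempty) : t ∈ K.faces :=
  (K.isRelLowerSet_faces hs).2 hts ht

open Classical in
theorem pair_mem_faces {V : Type u} {K : AbstractSimplicialComplex V} {a b : V}
    (h : (skeleton K).Adj a b) : ({a, b} : Finset V) ∈ K.faces := by
  obtain ⟨_, s, hs, h1, h2⟩ := skeleton_adj.1 h
  exact mem_faces_of_subset hs (by simp [Finset.insert_subset_iff, h1, h2]) (by simp)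

/-- Two injective endomorphisms of the lattice that agree on a triangle agree everywhere. -/
theorem hex_hom_ext {g h : ℤ × ℤ → ℤ × ℤ} (gi : Function.Injective g) (hi : Function.Injective h)
    (gh : ∀ a b, hexGraph.Adj a b → hexGraph.Adj (g a) (g b))
    (hh : ∀ a b, hexGraph.Adj a b → hexGraph.Adj (h a) (h b))
    {t₁ t₂ t₃ : ℤ × ℤ} (h12 : hexGraph.Adj t₁ t₂) (h13 : hexGraph.Adj t₁ t₃)
    (h23 : hexGraph.Adj t₂ t₃) (e1 : g t₁ = h t₁) (e2 : g t₂ = h t₂) (e3 : g t₃ = h t₃) : g = h := by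
  -- An edge of the lattice lies in exactly two triangles, so by injectivity the image of `w` must
  -- be the apex other than the image of `z`. Agreement thus passes from a triangle to each of its
  -- neighbours.
  have flip : ∀ x y z w : ℤ × ℤ, hexGraph.Adj x y → hexGraph.Adj z x → hexGraph.Adj z y →
      hexGraph.Adj w x → hexGraph.Adj w y → z ≠ w → g x = h x → g y = h y → g z = h z →
      g w = h w := by
    intro x y z w xy zx zy wx wy zw ex ey ez
    have n1 : g w ≠ g z := fun e => zw (gi e).symm
    have n2 : h w ≠ h z := fun e => zw (hi e).symm
    have a1 := gh _ _ xy
    have a2 := gh _ _ zx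
    have a3 := gh _ _ zy
    have a4 := gh _ _ wx
    have a5 := gh _ _ wy
    have b4 := hh _ _ wx
    have b5 := hh _ _ wy
    rw [← ez] at n2
    rw [← ex] at b4
    rw [← ey] at b5
    rw [hexGraph_adj] at a1 a2 a3 a4 a5 b4 b5
    rw [Prod.ext_iff]
    rw [Ne, Prod.ext_iff] at n1 n2
    omega
  set Q : ℤ → ℤ → Prop := fun a b =>
    g (a, b) = h (a, b) ∧ g (a + 1, b) = h (a + 1, b) ∧ g (a, b + 1) = h (a, b + 1) with hQ
  have right : ∀ a b, Q a b → Q (a + 1) b := by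
    rintro a b ⟨q1, q2, q3⟩
    have c : g (a + 1, b + 1) = h (a + 1, b + 1) := by
      apply flip (a + 1, b) (a, b + 1) (a, b) _ _ _ _ _ _ _ q2 q3 q1 <;>
        simp [hexGraph_adj]
    refine ⟨q2, ?_, c⟩
    apply flip (a + 1, b) (a + 1, b + 1) (a, b + 1) _ _ _ _ _ _ _ q2 c q3 <;>
        simp [hexGraph_adj]
  have left : ∀ a b, Q a b → Q (a - 1) b := by
    rintro a b ⟨q1, q2, q3⟩
    have c : g (a - 1, b + 1) = h (a - 1, b + 1) := by
      apply flip (a, b) (a, b + 1) (a + 1, b) _ _ _ _ _ _ _ q1 q3 q2 <;>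
        simp [hexGraph_adj]
    refine ⟨?_, by simpa using q1, c⟩
    apply flip (a, b) (a - 1, b + 1) (a, b + 1) _ _ _ _ _ _ _ q1 c q3 <;>
        simp [hexGraph_adj]
  have up : ∀ a b, Q a b → Q a (b + 1) := by
    rintro a b ⟨q1, q2, q3⟩
    have c : g (a + 1, b + 1) = h (a + 1, b + 1) := by
      apply flip (a + 1, b) (a, b + 1) (a, b) _ _ _ _ _ _ _ q2 q3 q1 <;>
        simp [hexGraph_adj]
    refine ⟨q3, c, ?_⟩
    apply flip (a, b + 1) (a + 1, b + 1) (a + 1, b) _ _ _ _ _ _ _ q3 c q2 <;>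
        simp [hexGraph_adj]
  have down : ∀ a b, Q a b → Q a (b - 1) := by
    rintro a b ⟨q1, q2, q3⟩
    have c : g (a + 1, b - 1) = h (a + 1, b - 1) := by
      apply flip (a, b) (a + 1, b) (a, b + 1) _ _ _ _ _ _ _ q1 q2 q3 <;>
        simp [hexGraph_adj]
    refine ⟨?_, c, by simpa using q1⟩
    apply flip (a, b) (a + 1, b - 1) (a + 1, b) _ _ _ _ _ _ _ q1 c q2 <;>
        simp [hexGraph_adj]
  have all : ∀ a b, Q a b → ∀ x : ℤ × ℤ, g x = h x := by
    intro a b q x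
    have s1 : ∀ d : ℤ, Q (a + d) b := by
      intro d
      induction d using Int.induction_on with
      | zero => simpa using q
      | succ i ih => simpa [add_assoc] using right _ _ ih
      | pred i ih => simpa [add_sub_assoc] using left _ _ ih
    have s2 : ∀ c d : ℤ, Q (a + c) (b + d) := by
      intro c d
      induction d using Int.induction_on with
      | zero => simpa using s1 c
      | succ i ih => simpa [add_assoc] using up _ _ ih
      | pred i ih => simpa [add_sub_assoc] using down _ _ ih
    simpa using (s2 (x.1 - a) (x.2 - b)).1
  have start : ∃ a b, Q a b := by
    obtain ⟨x1, y1⟩ := t₁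
    obtain ⟨x2, y2⟩ := t₂
    obtain ⟨x3, y3⟩ := t₃
    -- A triangle of the other orientation is first reflected in one of its edges, since `Q` speaks
    -- of one orientation only.
    have key : ∀ a b : ℤ, g (a + 1, b) = h (a + 1, b) → g (a, b + 1) = h (a, b + 1) →
        g (a + 1, b + 1) = h (a + 1, b + 1) → Q a b := by
      intro a b r1 r2 r3
      refine ⟨?_, r1, r2⟩
      apply flip (a + 1, b) (a, b + 1) (a + 1, b + 1) _ _ _ _ _ _ _ r1 r2 r3 <;>
        simp [hexGraph_adj]
    have cg : ∀ {x y x' y' : ℤ}, g (x, y) = h (x, y) → x' = x → y' = y → g (x', y') = h (x', y') := by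
      rintro x y _ _ e rfl rfl
      exact e
    rw [hexGraph_adj] at h12 h13 h23
    dsimp only at h12 h13 h23
    rcases h12 with h | h | h | h | h | h
    · rcases (by omega : (x3 = x1 ∧ y3 = y1 + 1) ∨ (x3 = x1 + 1 ∧ y3 = y1 - 1)) with h' | h'
      · exact ⟨x1, y1, cg e1 (by omega) (by omega), cg e2 (by omega) (by omega), cg e3 (by omega) (by omega)⟩
      · exact ⟨x1, y1 - 1, key _ _ (cg e3 (by omega) (by omega)) (cg e1 (by omega) (by omega)) (cg e2 (by omega) (by omega))⟩
    · rcases (by omega : (x3 = x1 + 1 ∧ y3 = y1) ∨ (x3 = x1 - 1 ∧ y3 = y1 + 1)) with h' | h'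
      · exact ⟨x1, y1, cg e1 (by omega) (by omega), cg e3 (by omega) (by omega), cg e2 (by omega) (by omega)⟩
      · exact ⟨x1 - 1, y1, key _ _ (cg e1 (by omega) (by omega)) (cg e3 (by omega) (by omega)) (cg e2 (by omega) (by omega))⟩
    · rcases (by omega : (x3 = x1 + 1 ∧ y3 = y1) ∨ (x3 = x1 ∧ y3 = y1 - 1)) with h' | h'
      · exact ⟨x1, y1 - 1, key _ _ (cg e2 (by omega) (by omega)) (cg e1 (by omega) (by omega)) (cg e3 (by omega) (by omega))⟩
      · exact ⟨x1, y1 - 1, cg e3 (by omega) (by omega), cg e2 (by omega) (by omega), cg e1 (by omega) (by omega)⟩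
    · rcases (by omega : (x3 = x1 ∧ y3 = y1 - 1) ∨ (x3 = x1 - 1 ∧ y3 = y1 + 1)) with h' | h'
      · exact ⟨x1 - 1, y1 - 1, key _ _ (cg e3 (by omega) (by omega)) (cg e2 (by omega) (by omega)) (cg e1 (by omega) (by omega))⟩
      · exact ⟨x1 - 1, y1, cg e2 (by omega) (by omega), cg e1 (by omega) (by omega), cg e3 (by omega) (by omega)⟩
    · rcases (by omega : (x3 = x1 + 1 ∧ y3 = y1 - 1) ∨ (x3 = x1 - 1 ∧ y3 = y1)) with h' | h'
      · exact ⟨x1, y1 - 1, cg e2 (by omega) (by omega), cg e3 (by omega) (by omega), cg e1 (by omega) (by omega)⟩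
      · exact ⟨x1 - 1, y1 - 1, key _ _ (cg e2 (by omega) (by omega)) (cg e3 (by omega) (by omega)) (cg e1 (by omega) (by omega))⟩
    · rcases (by omega : (x3 = x1 ∧ y3 = y1 + 1) ∨ (x3 = x1 - 1 ∧ y3 = y1)) with h' | h'
      · exact ⟨x1 - 1, y1, key _ _ (cg e1 (by omega) (by omega)) (cg e2 (by omega) (by omega)) (cg e3 (by omega) (by omega))⟩
      · exact ⟨x1 - 1, y1, cg e3 (by omega) (by omega), cg e1 (by omega) (by omega), cg e2 (by omega) (by omega)⟩
  obtain ⟨a, b, q⟩ := start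
  exact funext (all a b q)

/-- A family of charts of the apartments of a building. -/
structure IsChartSystem {V : Type u} (X : AbstractSimplicialComplex V)
    (C : Set (ℤ × ℤ → V)) : Prop where
  inj : ∀ f ∈ C, Function.Injective f
  face : ∀ f ∈ C, ∀ s ∈ modelApartment.faces, faceImage f s ∈ X.faces
  cover : ∀ s ∈ X.faces, ∀ t ∈ X.faces, ∃ f ∈ C,
    (∃ s' ∈ modelApartment.faces, faceImage f s' = s) ∧
    ∃ t' ∈ modelApartment.faces, faceImage f t' = t
  trans : ∀ f ∈ C, ∀ g ∈ C, ∃ θ : ℤ × ℤ → ℤ × ℤ, Function.Injective θ ∧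
    (∀ a b, hexGraph.Adj a b → hexGraph.Adj (θ a) (θ b)) ∧ ∀ a b, f a = g b → θ a = b

theorem pair_mem_modelApartment {a b : ℤ × ℤ} (h : hexGraph.Adj a b) :
    ({a, b} : Finset (ℤ × ℤ)) ∈ modelApartment.faces := by
  refine ⟨by simp, ?_⟩
  change hexGraph.IsClique _
  simp [h]

theorem adj_of_mem_modelApartment {s : Finset (ℤ × ℤ)} (hs : s ∈ modelApartment.faces)
    {a b : ℤ × ℤ} (ha : a ∈ s) (hb : b ∈ s) (hab : a ≠ b) : hexGraph.Adj a b :=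
  hs.2 ha hb hab

/-- In coordinates, the isomorphism `φ` between two apartments is `g⁻¹ ∘ φ ∘ f`. Injectivity,
preservation of adjacency and the behaviour on the overlap suffice later; surjectivity is not
recorded. -/
theorem exists_isChartSystem {V : Type u} {X : AbstractSimplicialComplex V}
    (hX : IsA2TildeBuilding X) : ∃ C, IsChartSystem X C := by
  classical
  obtain ⟨𝒜, hA, hcov, htr⟩ := hX.exists_apartments
  have himg : ∀ (f : ℤ × ℤ ↪ V) (s : Finset (ℤ × ℤ)), faceImage f s = s.map f := by
    intro f s
    ext x
    simp [mem_faceImage]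
  refine ⟨{g | ∃ A ∈ 𝒜, ∃ f : ℤ × ℤ ↪ V, A.faces = (fun s => s.map f) '' modelApartment.faces ∧
    (f : ℤ × ℤ → V) = g}, ?_, ?_, ?_, ?_⟩
  · rintro _ ⟨A, _, f, _, rfl⟩
    exact f.injective
  · rintro _ ⟨A, hAA, f, hf, rfl⟩ s hs
    refine (hA A hAA).1 ?_
    rw [hf, himg]
    exact ⟨s, hs, rfl⟩
  · intro s hs t ht
    obtain ⟨A, hAA, hsA, htA⟩ := hcov s hs t ht
    obtain ⟨-, f, hf⟩ := hA A hAA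
    refine ⟨f, ⟨A, hAA, f, hf, rfl⟩, ?_, ?_⟩
    · rw [hf] at hsA
      obtain ⟨s', h, e⟩ := hsA
      exact ⟨s', h, (himg f s').trans e⟩
    · rw [hf] at htA
      obtain ⟨s', h, e⟩ := htA
      exact ⟨s', h, (himg f s').trans e⟩
  · rintro _ ⟨A, hAA, f, hf, rfl⟩ _ ⟨B, hBB, g, hg, rfl⟩
    obtain ⟨φ, ⟨hinj, himgφ⟩, hfix⟩ := htr A hAA B hBB
    have vf : ∀ a, {f a} ∈ A.faces := by
      intro a
      rw [hf]
      exact ⟨{a}, modelApartment.singleton_mem a, by simp⟩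
    have vg : ∀ a, {g a} ∈ B.faces := by
      intro a
      rw [hg]
      exact ⟨{a}, modelApartment.singleton_mem a, by simp⟩
    have hφ : ∀ s ∈ modelApartment.faces, ∃ t ∈ modelApartment.faces,
        t.map g = faceImage φ (s.map f) := by
      intro s hs
      have : faceImage φ (s.map f) ∈ B.faces := by
        rw [← himgφ]
        exact ⟨_, by rw [hf]; exact ⟨s, hs, rfl⟩, rfl⟩
      rw [hg] at this
      obtain ⟨t, ht, e⟩ := this
      exact ⟨t, ht, e⟩
    have hex : ∀ a, ∃ b, g b = φ (f a) := by
      intro a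
      obtain ⟨t, ht, e⟩ := hφ {a} (modelApartment.singleton_mem a)
      have : φ (f a) ∈ t.map g := by
        rw [e, mem_faceImage]
        exact ⟨f a, by simp, rfl⟩
      obtain ⟨b, -, hb⟩ := Finset.mem_map.1 this
      exact ⟨b, hb⟩
    choose θ hθ using hex
    have θi : Function.Injective θ := by
      intro a b hab
      have : φ (f a) = φ (f b) := by rw [← hθ, ← hθ, hab]
      exact f.injective (hinj (vf a) (vf b) this)
    refine ⟨θ, θi, ?_, ?_⟩
    · intro a b hab
      obtain ⟨t, ht, e⟩ := hφ {a, b} (pair_mem_modelApartment hab)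
      have m : ∀ c ∈ ({a, b} : Finset (ℤ × ℤ)), θ c ∈ t := by
        intro c hc
        have : g (θ c) ∈ t.map g := by
          rw [e, mem_faceImage, hθ]
          exact ⟨f c, by simpa using hc, rfl⟩
        simpa using this
      exact adj_of_mem_modelApartment ht (m a (by simp)) (m b (by simp)) fun h => hab.ne (θi h)
    · intro a b hab
      apply g.injective
      rw [hθ, hfix (f a) (vf a) (hab ▸ vg b), hab]

namespace IsChartSystem

variable {V : Type u} {X : AbstractSimplicialComplex V} {C : Set (ℤ × ℤ → V)}

theorem adj (hC : IsChartSystem X C) {f : ℤ × ℤ → V} (hf : f ∈ C) {a b : ℤ × ℤ}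
    (h : hexGraph.Adj a b) : (skeleton X).Adj (f a) (f b) :=
  skeleton_adj.2 ⟨fun e => h.ne (hC.inj f hf e), _, hC.face f hf _ (pair_mem_modelApartment h),
    mem_faceImage.2 ⟨a, by simp, rfl⟩, mem_faceImage.2 ⟨b, by simp, rfl⟩⟩

theorem cover' (hC : IsChartSystem X C) {s t : Finset V} (hs : s ∈ X.faces) (ht : t ∈ X.faces) :
    ∃ f ∈ C, (∀ x ∈ s, ∃ a, f a = x) ∧ ∀ x ∈ t, ∃ a, f a = x := by
  obtain ⟨f, hf, ⟨s', -, rfl⟩, ⟨t', -, rfl⟩⟩ := hC.cover s hs t ht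
  refine ⟨f, hf, fun x hx => ?_, fun x hx => ?_⟩ <;>
  · obtain ⟨a, -, ha⟩ := mem_faceImage.1 hx
    exact ⟨a, ha⟩

-- The retraction centred at a triangle: choose a chart through the triangle and `x`, and move `x`
-- to the coordinates of `g`. By the rigidity `hex_hom_ext` the result does not depend on the chart.
-- The last clause, that fibres over the three vertices of the central triangle are singletons, is
-- what yields `IsBuildingGraph.closer`.
open Classical in
theorem exists_retraction (hC : IsChartSystem X C) {g : ℤ × ℤ → V} (hg : g ∈ C)
    {t₁ t₂ t₃ : ℤ × ℤ} (h12 : hexGraph.Adj t₁ t₂) (h13 : hexGraph.Adj t₁ t₃)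
    (h23 : hexGraph.Adj t₂ t₃) : ∃ ρ : V → ℤ × ℤ, (∀ a, ρ (g a) = a) ∧
      (∀ x y, (skeleton X).Adj x y → hexGraph.Adj (ρ x) (ρ y)) ∧
      ∀ x, ρ x = t₁ ∨ ρ x = t₂ ∨ ρ x = t₃ → x = g (ρ x) := by
  have hT : faceImage g {t₁, t₂, t₃} ∈ X.faces := by
    apply hC.face g hg
    refine ⟨by simp, ?_⟩
    change hexGraph.IsClique _
    simp [SimpleGraph.isClique_insert, h12, h13, h23]
  have mT : ∀ t, t = t₁ ∨ t = t₂ ∨ t = t₃ → g t ∈ faceImage g {t₁, t₂, t₃} := fun t ht =>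
    mem_faceImage.2 ⟨t, by simpa using ht, rfl⟩
  have hch : ∀ x, ∃ f, f ∈ C ∧ ∃ a b₁ b₂ b₃, f a = x ∧ f b₁ = g t₁ ∧ f b₂ = g t₂ ∧ f b₃ = g t₃ := by
    intro x
    obtain ⟨f, hf, h1, h2⟩ := hC.cover' hT (X.singleton_mem x)
    obtain ⟨a, ha⟩ := h2 x (by simp)
    obtain ⟨b₁, hb₁⟩ := h1 _ (mT t₁ (by simp))
    obtain ⟨b₂, hb₂⟩ := h1 _ (mT t₂ (by simp))
    obtain ⟨b₃, hb₃⟩ := h1 _ (mT t₃ (by simp))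
    exact ⟨f, hf, a, b₁, b₂, b₃, ha, hb₁, hb₂, hb₃⟩
  choose F hF A B₁ B₂ B₃ hA hB₁ hB₂ hB₃ using hch
  choose θ θi θh θe using fun x => hC.trans (F x) (hF x) g hg
  -- Every chart through the central triangle computes the retraction on its own vertices: two ways
  -- of passing to the coordinates of `g` agree on the triangle, hence everywhere.
  have key : ∀ f ∈ C, (∃ a, f a = g t₁) → (∃ a, f a = g t₂) → (∃ a, f a = g t₃) →
      ∃ η : ℤ × ℤ → ℤ × ℤ, Function.Injective η ∧
        (∀ a b, hexGraph.Adj a b → hexGraph.Adj (η a) (η b)) ∧ (∀ a b, f a = g b → η a = b) ∧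
        ∀ a, θ (f a) (A (f a)) = η a := by
    rintro f hf ⟨a₁, e₁⟩ ⟨a₂, e₂⟩ ⟨a₃, e₃⟩
    obtain ⟨η, ηi, ηh, ηe⟩ := hC.trans f hf g hg
    refine ⟨η, ηi, ηh, ηe, fun a => ?_⟩
    obtain ⟨ψ, ψi, ψh, ψe⟩ := hC.trans f hf (F (f a)) (hF _)
    -- The transition in the opposite direction serves to show that the preimages of the triangle in
    -- the chart `f` are pairwise adjacent.
    obtain ⟨μ, μi, μh, μe⟩ := hC.trans g hg f hf
    have k1 := μe _ _ e₁.symm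
    have k2 := μe _ _ e₂.symm
    have k3 := μe _ _ e₃.symm
    have agree : ∀ t c, f c = g t → ∀ b, F (f a) b = g t → θ (f a) (ψ c) = η c := by
      intro t c hc b hb
      rw [ηe _ _ hc, ψe c b (hc.trans hb.symm), θe _ _ _ hb]
    have := hex_hom_ext ((θi (f a)).comp ψi) ηi (fun x y h => θh _ _ _ (ψh _ _ h)) ηh
      (k1 ▸ k2 ▸ μh _ _ h12) (k1 ▸ k3 ▸ μh _ _ h13) (k2 ▸ k3 ▸ μh _ _ h23)
      (agree t₁ a₁ e₁ _ (hB₁ _)) (agree t₂ a₂ e₂ _ (hB₂ _)) (agree t₃ a₃ e₃ _ (hB₃ _))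
    rw [← this]
    exact congrArg _ (ψe _ _ (hA (f a)).symm).symm
  refine ⟨fun x => θ x (A x), fun a => θe _ _ _ (hA _), ?_, ?_⟩
  · intro x y hxy
    obtain ⟨f, hf, ⟨s, hs, h1⟩, ⟨t, ht, h2⟩⟩ := hC.cover _ hT _ (pair_mem_faces hxy)
    have r : ∀ t, t = t₁ ∨ t = t₂ ∨ t = t₃ → ∃ a, f a = g t := by
      intro t ht
      have := mT t ht
      rw [← h1, mem_faceImage] at this
      obtain ⟨a, -, ha⟩ := this
      exact ⟨a, ha⟩
    obtain ⟨η, ηi, ηh, ηe, hη⟩ := key f hf (r _ (by simp)) (r _ (by simp)) (r _ (by simp))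
    obtain ⟨a, ha, rfl⟩ := mem_faceImage.1 (h2 ▸ Finset.mem_insert_self x {y} : x ∈ faceImage f t)
    obtain ⟨b, hb, rfl⟩ := mem_faceImage.1 (h2 ▸ by simp : y ∈ faceImage f t)
    change hexGraph.Adj (θ (f a) (A (f a))) (θ (f b) (A (f b)))
    rw [hη, hη]
    exact ηh _ _ (adj_of_mem_modelApartment ht ha hb fun e => hxy.ne (congrArg f e))
  · intro x hx
    change θ x (A x) = t₁ ∨ θ x (A x) = t₂ ∨ θ x (A x) = t₃ at hx
    obtain ⟨η, ηi, ηh, ηe, hη⟩ := key (F x) (hF x) ⟨_, hB₁ x⟩ ⟨_, hB₂ x⟩ ⟨_, hB₃ x⟩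
    have e := hη (A x)
    rw [hA] at e
    change x = g (θ x (A x))
    have : ∀ b t, F x b = g t → θ x (A x) = t → x = g t := by
      intro b t hb ht
      have : A x = b := ηi (by rw [← e, ht, ηe _ _ hb])
      rw [← hb, ← this, hA]
    rcases hx with hx | hx | hx
    · rw [hx]; exact this _ _ (hB₁ x) hx
    · rw [hx]; exact this _ _ (hB₂ x) hx
    · rw [hx]; exact this _ _ (hB₃ x) hx

end IsChartSystem
end BuildingSymmetry

/-! ### Metric of the lattice and the axioms for the `1`-skeleton of a building -/

namespace BuildingSymmetry

/-- `b` lies in the combinatorial ball of radius `k` around `a` in the triangular lattice. -/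
def HexBall (k : ℤ) (a b : ℤ × ℤ) : Prop :=
  (b.1 - a.1 ≤ k ∧ a.1 - b.1 ≤ k) ∧ (b.2 - a.2 ≤ k ∧ a.2 - b.2 ≤ k) ∧
    (b.1 - a.1 + (b.2 - a.2) ≤ k ∧ a.1 - b.1 + (a.2 - b.2) ≤ k)

theorem HexBall.succ {k : ℤ} {a b c : ℤ × ℤ} (h : HexBall k a b) (hbc : hexGraph.Adj b c) :
    HexBall (k + 1) a c := by
  rw [hexGraph_adj] at hbc
  simp only [HexBall] at *
  omega

theorem HexBall.pred {k : ℤ} (hk : 0 ≤ k) {a b : ℤ × ℤ} (h : HexBall (k + 1) a b) :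
    HexBall k a b ∨ ∃ c, hexGraph.Adj c b ∧ HexBall k a c := by
  by_cases h0 : HexBall k a b
  · exact Or.inl h0
  right
  obtain ⟨a1, a2⟩ := a
  obtain ⟨b1, b2⟩ := b
  simp only [HexBall] at h h0
  have H : ∀ c1 c2 : ℤ, hexGraph.Adj (c1, c2) (b1, b2) → HexBall k (a1, a2) (c1, c2) →
    ∃ c, hexGraph.Adj c (b1, b2) ∧ HexBall k (a1, a2) c := fun c1 c2 h1 h2 => ⟨_, h1, h2⟩
  rcases le_total a1 b1 with h1 | h1 <;> rcases le_total a2 b2 with h2 | h2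
  · by_cases h3 : a1 = b1
    · apply H b1 (b2 - 1) <;> simp only [hexGraph_adj, HexBall, true_and, and_true, true_or, or_true] <;> omega
    · apply H (b1 - 1) b2 <;> simp only [hexGraph_adj, HexBall, true_and, and_true, true_or, or_true] <;> omega
  · by_cases h3 : a1 = b1
    · apply H b1 (b2 + 1) <;> simp only [hexGraph_adj, HexBall, true_and, and_true, true_or, or_true] <;> omega
    · by_cases h4 : a2 = b2
      · apply H (b1 - 1) b2 <;> simp only [hexGraph_adj, HexBall, true_and, and_true, true_or, or_true] <;> omega
      · apply H (b1 - 1) (b2 + 1) <;> simp only [hexGraph_adj, HexBall, true_and, and_true, true_or, or_true] <;> omega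
  · by_cases h3 : a1 = b1
    · apply H b1 (b2 - 1) <;> simp only [hexGraph_adj, HexBall, true_and, and_true, true_or, or_true] <;> omega
    · by_cases h4 : a2 = b2
      · apply H (b1 + 1) b2 <;> simp only [hexGraph_adj, HexBall, true_and, and_true, true_or, or_true] <;> omega
      · apply H (b1 + 1) (b2 - 1) <;> simp only [hexGraph_adj, HexBall, true_and, and_true, true_or, or_true] <;> omega
  · by_cases h3 : a1 = b1
    · apply H b1 (b2 + 1) <;> simp only [hexGraph_adj, HexBall, true_and, and_true, true_or, or_true] <;> omega
    · apply H (b1 + 1) b2 <;> simp only [hexGraph_adj, HexBall, true_and, and_true, true_or, or_true] <;> omega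

/-- The neighbours of `u` that are closer to `z` lie in a common triangle with `u`. -/
theorem exists_triangle_of_closer (u z : ℤ × ℤ) : ∃ s s', hexGraph.Adj u s ∧ hexGraph.Adj u s' ∧
    hexGraph.Adj s s' ∧ ∀ (k : ℤ) (x : ℤ × ℤ), hexGraph.Adj u x → HexBall k z x → ¬ HexBall k z u →
      x = s ∨ x = s' := by
  obtain ⟨u1, u2⟩ := u
  obtain ⟨z1, z2⟩ := z
  have H : ∀ s1 s2 s1' s2' : ℤ, hexGraph.Adj (u1, u2) (s1, s2) → hexGraph.Adj (u1, u2) (s1', s2') →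
      hexGraph.Adj (s1, s2) (s1', s2') → (∀ k x1 x2 : ℤ, hexGraph.Adj (u1, u2) (x1, x2) →
        HexBall k (z1, z2) (x1, x2) → ¬ HexBall k (z1, z2) (u1, u2) →
        (x1 = s1 ∧ x2 = s2) ∨ (x1 = s1' ∧ x2 = s2')) → ∃ s s', hexGraph.Adj (u1, u2) s ∧
        hexGraph.Adj (u1, u2) s' ∧ hexGraph.Adj s s' ∧ ∀ (k : ℤ) (x : ℤ × ℤ),
        hexGraph.Adj (u1, u2) x → HexBall k (z1, z2) x → ¬ HexBall k (z1, z2) (u1, u2) →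
        x = s ∨ x = s' := by
    intro s1 s2 s1' s2' h1 h2 h3 h4
    refine ⟨_, _, h1, h2, h3, ?_⟩
    rintro k ⟨x1, x2⟩ h5 h6 h7
    simpa only [Prod.mk.injEq] using h4 k x1 x2 h5 h6 h7
  -- The six cases are the closed sectors of angle `π / 3` around `u` that can contain `z`; the two
  -- neighbours of `u` bounding the sector are the witnesses.
  rcases le_total u1 z1 with h1 | h1 <;> rcases le_total u2 z2 with h2 | h2
  · apply H (u1 + 1) u2 u1 (u2 + 1) <;> simp only [hexGraph_adj, HexBall, true_and, and_true, true_or, or_true] <;> omega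
  · rcases le_total (u1 + u2) (z1 + z2) with h3 | h3
    · apply H (u1 + 1) u2 (u1 + 1) (u2 - 1) <;> simp only [hexGraph_adj, HexBall, true_and, and_true, true_or, or_true] <;> omega
    · apply H u1 (u2 - 1) (u1 + 1) (u2 - 1) <;> simp only [hexGraph_adj, HexBall, true_and, and_true, true_or, or_true] <;> omega
  · rcases le_total (u1 + u2) (z1 + z2) with h3 | h3
    · apply H u1 (u2 + 1) (u1 - 1) (u2 + 1) <;> simp only [hexGraph_adj, HexBall, true_and, and_true, true_or, or_true] <;> omega
    · apply H (u1 - 1) u2 (u1 - 1) (u2 + 1) <;> simp only [hexGraph_adj, HexBall, true_and, and_true, true_or, or_true] <;> omega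
  · apply H (u1 - 1) u2 u1 (u2 - 1) <;> simp only [hexGraph_adj, HexBall, true_and, and_true, true_or, or_true] <;> omega

/-- The edge `v w` lies in the boundary of the hexagonal ball of radius `k + 1` around `u`, and one
of the two triangles on it points inwards. -/
theorem hex_triangle_condition {k : ℤ} (hk : 0 ≤ k) {u v w : ℤ × ℤ} (hvw : hexGraph.Adj v w)
    (hv : HexBall (k + 1) u v) (hw : HexBall (k + 1) u w) (hv' : ¬ HexBall k u v)
    (hw' : ¬ HexBall k u w) :
    ∃ x, hexGraph.Adj x v ∧ hexGraph.Adj x w ∧ HexBall k u x := by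
  obtain ⟨u1, u2⟩ := u
  obtain ⟨v1, v2⟩ := v
  obtain ⟨w1, w2⟩ := w
  have H : ∀ x1 x2 : ℤ, hexGraph.Adj (x1, x2) (v1, v2) ∧ hexGraph.Adj (x1, x2) (w1, w2) ∧
      HexBall k (u1, u2) (x1, x2) → ∃ x, hexGraph.Adj x (v1, v2) ∧ hexGraph.Adj x (w1, w2) ∧
      HexBall k (u1, u2) x := fun x1 x2 h => ⟨_, h⟩
  rw [hexGraph_adj] at hvw
  simp only [HexBall] at hv hw hv' hw'
  -- the two common neighbours of `v` and `w` are `v + r` and `w - r`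
  have H2 : ∀ r1 r2 : ℤ, hexGraph.Adj (v1 + r1, v2 + r2) (v1, v2) →
      hexGraph.Adj (v1 + r1, v2 + r2) (w1, w2) → hexGraph.Adj (w1 - r1, w2 - r2) (v1, v2) →
      hexGraph.Adj (w1 - r1, w2 - r2) (w1, w2) →
      HexBall k (u1, u2) (v1 + r1, v2 + r2) ∨ HexBall k (u1, u2) (w1 - r1, w2 - r2) →
      ∃ x, hexGraph.Adj x (v1, v2) ∧ hexGraph.Adj x (w1, w2) ∧ HexBall k (u1, u2) x := by
    rintro r1 r2 h1 h2 h3 h4 (h5 | h5)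
    exacts [⟨_, h1, h2, h5⟩, ⟨_, h3, h4, h5⟩]
  rcases hvw with h | h | h | h | h | h
  · apply H2 0 1 <;> simp only [hexGraph_adj, HexBall, true_and, and_true, true_or, or_true] <;> omega
  · apply H2 1 0 <;> simp only [hexGraph_adj, HexBall, true_and, and_true, true_or, or_true] <;> omega
  · apply H2 1 0 <;> simp only [hexGraph_adj, HexBall, true_and, and_true, true_or, or_true] <;> omega
  · apply H2 0 (-1) <;> simp only [hexGraph_adj, HexBall, true_and, and_true, true_or, or_true] <;> omega
  · apply H2 (-1) 0 <;> simp only [hexGraph_adj, HexBall, true_and, and_true, true_or, or_true] <;> omega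
  · apply H2 (-1) 0 <;> simp only [hexGraph_adj, HexBall, true_and, and_true, true_or, or_true] <;> omega

/-- The six shortest vectors of the triangular lattice. -/
def hexDirections : List (ℤ × ℤ) := [(1, 0), (0, 1), (1, -1), (-1, 0), (0, -1), (-1, 1)]

theorem hexGraph_adj_iff_mem {a b : ℤ × ℤ} : hexGraph.Adj a b ↔ b - a ∈ hexDirections := by
  simp only [hexGraph_adj, hexDirections, List.mem_cons, List.not_mem_nil, or_false, Prod.ext_iff,
    Prod.fst_sub, Prod.snd_sub]
  omega

theorem hexDirections_link : ∀ d ∈ hexDirections, ∀ e ∈ hexDirections, e - d ∈ hexDirections ∨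
    (∃ f ∈ hexDirections, d - f ∈ hexDirections ∧ e - f ∈ hexDirections) ∨
    ∃ f ∈ hexDirections, d - f ∈ hexDirections ∧ ∃ g ∈ hexDirections, f - g ∈ hexDirections ∧
      e - g ∈ hexDirections := by
  decide

/-- Two neighbours of a vertex are adjacent, or they are joined by a path of length two or three in
the link. -/
theorem hex_link {y b c : ℤ × ℤ} (hb : hexGraph.Adj y b) (hc : hexGraph.Adj y c) :
    hexGraph.Adj b c ∨ (∃ x, hexGraph.Adj x y ∧ hexGraph.Adj x b ∧ hexGraph.Adj x c) ∨
    ∃ x z, hexGraph.Adj x y ∧ hexGraph.Adj x b ∧ hexGraph.Adj z y ∧ hexGraph.Adj z x ∧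
      hexGraph.Adj z c := by
  rw [hexGraph_adj_iff_mem] at hb hc
  have e : ∀ f, f ∈ hexDirections → hexGraph.Adj (y + f) y := fun f hf => by
    rw [SimpleGraph.adj_comm, hexGraph_adj_iff_mem]
    simpa using hf
  have e' : ∀ f b, b - y - f ∈ hexDirections → hexGraph.Adj (y + f) b := fun f b hf => by
    rw [hexGraph_adj_iff_mem]
    simpa [sub_sub] using hf
  rcases hexDirections_link _ hb _ hc with h | ⟨f, hf, h1, h2⟩ | ⟨f, hf, h1, g, hg, h2, h3⟩
  · left
    rw [hexGraph_adj_iff_mem]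
    simpa using h
  · exact Or.inr (Or.inl ⟨y + f, e f hf, e' f b h1, e' f c h2⟩)
  · exact Or.inr (Or.inr ⟨y + f, y + g, e f hf, e' f b h1, e g hg, e' g _ (by simpa using h2),
      e' g c h3⟩)

namespace IsChartSystem

variable {V : Type u} {X : AbstractSimplicialComplex V} {C : Set (ℤ × ℤ → V)}

theorem exists_chart_edges (hC : IsChartSystem X C) {a b c d : V}
    (h : (skeleton X).Adj a b) (h' : (skeleton X).Adj c d) :
    ∃ f ∈ C, ∃ a' b' c' d', f a' = a ∧ f b' = b ∧ f c' = c ∧ f d' = d := by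
  classical
  obtain ⟨f, hf, h1, h2⟩ := hC.cover' (pair_mem_faces h) (pair_mem_faces h')
  obtain ⟨a', ha⟩ := h1 a (by simp)
  obtain ⟨b', hb⟩ := h1 b (by simp)
  obtain ⟨c', hc⟩ := h2 c (by simp)
  obtain ⟨d', hd⟩ := h2 d (by simp)
  exact ⟨f, hf, a', b', c', d', ha, hb, hc, hd⟩

theorem exists_chart_vertex_edge (hC : IsChartSystem X C) (a : V) {c d : V}
    (h' : (skeleton X).Adj c d) :
    ∃ f ∈ C, ∃ a' c' d', f a' = a ∧ f c' = c ∧ f d' = d := by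
  classical
  obtain ⟨f, hf, h1, h2⟩ := hC.cover' (X.singleton_mem a) (pair_mem_faces h')
  obtain ⟨a', ha⟩ := h1 a (by simp)
  obtain ⟨c', hc⟩ := h2 c (by simp)
  obtain ⟨d', hd⟩ := h2 d (by simp)
  exact ⟨f, hf, a', c', d', ha, hc, hd⟩

theorem exists_chart_vertices (hC : IsChartSystem X C) (a b : V) :
    ∃ f ∈ C, ∃ a' b', f a' = a ∧ f b' = b := by
  obtain ⟨f, hf, h1, h2⟩ := hC.cover' (X.singleton_mem a) (X.singleton_mem b)
  obtain ⟨a', ha⟩ := h1 a (by simp)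
  obtain ⟨c', hc⟩ := h2 b (by simp)
  exact ⟨f, hf, a', c', ha, hc⟩

theorem exists_retraction_default (hC : IsChartSystem X C) {g : ℤ × ℤ → V} (hg : g ∈ C) :
    ∃ ρ : V → ℤ × ℤ, (∀ a, ρ (g a) = a) ∧
      ∀ x y, (skeleton X).Adj x y → hexGraph.Adj (ρ x) (ρ y) := by
  obtain ⟨ρ, h1, h2, -⟩ := hC.exists_retraction hg (t₁ := (0, 0)) (t₂ := (1, 0)) (t₃ := (0, 1))
    (by simp [hexGraph_adj]) (by simp [hexGraph_adj]) (by simp [hexGraph_adj])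
  exact ⟨ρ, h1, h2⟩

theorem adj_iff (hC : IsChartSystem X C) {f : ℤ × ℤ → V} (hf : f ∈ C) {a b : ℤ × ℤ} :
    (skeleton X).Adj (f a) (f b) ↔ hexGraph.Adj a b := by
  refine ⟨fun h => ?_, hC.adj hf⟩
  obtain ⟨ρ, h1, h2⟩ := hC.exists_retraction_default hf
  simpa [h1] using h2 _ _ h

theorem exists_walk (hC : IsChartSystem X C) {f : ℤ × ℤ → V} (hf : f ∈ C) (k : ℕ) :
    ∀ {a b : ℤ × ℤ}, HexBall k a b → ∃ p : (skeleton X).Walk (f a) (f b), p.length ≤ k := by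
  induction k with
  | zero =>
    intro a b h
    have : a = b := by
      simp only [HexBall, Prod.ext_iff] at *
      omega
    subst this
    exact ⟨SimpleGraph.Walk.nil, le_rfl⟩
  | succ k ih =>
    intro a b h
    push_cast at h
    rcases h.pred (by positivity) with h | ⟨c, hc, h⟩
    · obtain ⟨p, hp⟩ := ih h
      exact ⟨p, by omega⟩
    · obtain ⟨p, hp⟩ := ih h
      exact ⟨p.concat (hC.adj hf hc), by simpa using hp⟩

theorem connected (hC : IsChartSystem X C) [Nonempty V] : (skeleton X).Connected := by
  rw [SimpleGraph.connected_iff]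
  refine ⟨fun x y => ?_, inferInstance⟩
  obtain ⟨f, hf, a, b, rfl, rfl⟩ := hC.exists_chart_vertices x y
  obtain ⟨p, -⟩ := hC.exists_walk hf
    ((b.1 - a.1).natAbs + (b.2 - a.2).natAbs) (a := a) (b := b) (by
      simp only [HexBall]
      omega)
  exact ⟨p⟩

/-- Apartments are isometrically embedded: a retraction does not lengthen walks, so leaving the
apartment gives no shortcut. -/
theorem dist_le_iff (hC : IsChartSystem X C) [Nonempty V] {f : ℤ × ℤ → V} (hf : f ∈ C)
    {a b : ℤ × ℤ} {k : ℕ} : (skeleton X).dist (f a) (f b) ≤ k ↔ HexBall k a b := by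
  constructor
  · intro h
    obtain ⟨ρ, h1, h2⟩ := hC.exists_retraction_default hf
    have key : ∀ {x y : V} (p : (skeleton X).Walk x y), HexBall p.length (ρ y) (ρ x) := by
      intro x y p
      induction p with
      | nil => simp [HexBall]
      | cons hadj p ih =>
        simp only [SimpleGraph.Walk.length_cons, Nat.cast_add, Nat.cast_one]
        exact ih.succ (h2 _ _ hadj.symm)
    obtain ⟨p, hp⟩ := hC.connected.exists_walk_length_eq_dist (f a) (f b)
    have := key p
    rw [h1, h1, hp] at this
    simp only [HexBall] at *
    omega
  · intro h
    obtain ⟨p, hp⟩ := hC.exists_walk hf k h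
    exact (SimpleGraph.dist_le p).trans hp

end IsChartSystem

/-- The properties of the `1`-skeleton of a building of type `Ã₂`, with its vertex colouring, on
which the counting of isometries is based. -/
structure IsBuildingGraph {V : Type u} (G : SimpleGraph V) (τ : V → ZMod 3) : Prop where
  connected : G.Connected
  color : ∀ {x y}, G.Adj x y → τ x ≠ τ y
  /-- the neighbours of a vertex that are closer to another vertex form a clique -/
  closer : ∀ {u z x y}, G.Adj u x → G.Adj u y → G.dist z x < G.dist z u →
    G.dist z y < G.dist z u → x = y ∨ G.Adj x y
  /-- the triangle condition -/
  triangle : ∀ {u v w k}, G.Adj v w → G.dist u v = k + 1 → G.dist u w = k + 1 →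
    ∃ x, G.Adj x v ∧ G.Adj x w ∧ G.dist u x = k
  /-- vertices of the same colour in a link have a common neighbour in the link -/
  exists_join : ∀ {y b c}, G.Adj y b → G.Adj y c → τ b = τ c →
    ∃ x, G.Adj x y ∧ G.Adj x b ∧ G.Adj x c

theorem zmod3_eq {a b c d : ZMod 3} (h1 : a ≠ b) (h2 : a ≠ c) (h3 : b ≠ c) (h4 : a ≠ d)
    (h5 : b ≠ d) : c = d := by
  revert a b c d
  decide

namespace IsChartSystem

variable {V : Type u} {X : AbstractSimplicialComplex V} {C : Set (ℤ × ℤ → V)}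

theorem exists_isBuildingGraph (hC : IsChartSystem X C) [Nonempty V] :
    ∃ τ : V → ZMod 3, IsBuildingGraph (skeleton X) τ := by
  inhabit V
  obtain ⟨g, hg, -⟩ := hC.exists_chart_vertices (default : V) default
  obtain ⟨ρ, -, hρ⟩ := hC.exists_retraction_default hg
  -- The lattice colouring by first minus second coordinate modulo `3` changes along all six
  -- directions; it is pulled back by a retraction.
  have hcol : ∀ {x y}, (skeleton X).Adj x y →
      (((ρ x).1 - (ρ x).2 : ℤ) : ZMod 3) ≠ (((ρ y).1 - (ρ y).2 : ℤ) : ZMod 3) := by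
    intro x y h e
    rw [ZMod.intCast_eq_intCast_iff, Int.modEq_iff_dvd] at e
    have := hρ _ _ h
    rw [hexGraph_adj] at this
    omega
  refine ⟨fun x => (((ρ x).1 - (ρ x).2 : ℤ) : ZMod 3), hC.connected, hcol, ?_, ?_, ?_⟩
  · intro u z x y hx hy hzx hzy
    obtain ⟨f, hf, a, b, rfl, rfl⟩ := hC.exists_chart_vertices u z
    obtain ⟨s, s', h1, h2, h3, h4⟩ := exists_triangle_of_closer a b
    -- The retraction is centred at the triangle formed by `u` and the only two neighbours in the
    -- apartment that can be closer to `z`. A closer neighbour anywhere in the building retracts to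
    -- one of these two, and by the singleton fibres it is that vertex itself.
    obtain ⟨r, hr1, hr2, hr3⟩ := hC.exists_retraction hf h1 h2 h3
    have key : ∀ x, (skeleton X).Adj (f a) x →
        (skeleton X).dist (f b) x < (skeleton X).dist (f b) (f a) → x = f s ∨ x = f s' := by
      intro x hx hd
      have hadj := hr2 _ _ hx
      rw [hr1] at hadj
      have hle : (skeleton X).dist (f b) (f (r x)) ≤ (skeleton X).dist (f b) x := by
        obtain ⟨p, hp⟩ := hC.connected.exists_walk_length_eq_dist (f b) x
        let F : skeleton X →g skeleton X := ⟨fun v => f (r v), fun h => hC.adj hf (hr2 _ _ h)⟩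
        have := SimpleGraph.dist_le (p.map F)
        rw [SimpleGraph.Walk.length_map, hp] at this
        have e : F (f b) = f b := congrArg f (hr1 b)
        rw [e] at this
        exact this
      have hb := (hC.dist_le_iff hf).1 hle
      have hb' : ¬ HexBall ((skeleton X).dist (f b) x : ℕ) b a := by
        rw [← hC.dist_le_iff hf]
        omega
      rcases h4 _ _ hadj hb hb' with h | h
      · left
        rw [hr3 x (Or.inr (Or.inl h)), h]
      · right
        rw [hr3 x (Or.inr (Or.inr h)), h]
    rcases key x hx hzx with rfl | rfl <;> rcases key y hy hzy with rfl | rfl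
    · exact Or.inl rfl
    · exact Or.inr (hC.adj hf h3)
    · exact Or.inr (hC.adj hf h3.symm)
    · exact Or.inl rfl
  · intro u v w k hvw hv hw
    obtain ⟨f, hf, a, b, c, rfl, rfl, rfl⟩ := hC.exists_chart_vertex_edge u hvw
    rw [hC.adj_iff hf] at hvw
    have b1 := (hC.dist_le_iff hf).1 hv.le
    have c1 := (hC.dist_le_iff hf).1 hw.le
    have b2 : ¬ HexBall (k : ℤ) a b := by
      rw [← hC.dist_le_iff hf]
      omega
    have c2 : ¬ HexBall (k : ℤ) a c := by
      rw [← hC.dist_le_iff hf]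
      omega
    obtain ⟨x, h1, h2, h3⟩ := hex_triangle_condition (by positivity) hvw (by exact_mod_cast b1)
      (by exact_mod_cast c1) b2 c2
    refine ⟨f x, hC.adj hf h1, hC.adj hf h2, le_antisymm ((hC.dist_le_iff hf).2 h3) ?_⟩
    have := hC.connected.dist_triangle (u := f a) (v := f x) (w := f b)
    rw [SimpleGraph.dist_eq_one_iff_adj.2 (hC.adj hf h1)] at this
    omega
  · intro y b c hb hc hbc
    obtain ⟨f, hf, y', b', y'', c', rfl, rfl, h, rfl⟩ := hC.exists_chart_edges hb hc
    have := hC.inj f hf h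
    subst this
    have key : ∀ x, hexGraph.Adj x y'' → hexGraph.Adj x b' → hexGraph.Adj x c' →
        ∃ x, (skeleton X).Adj x (f y'') ∧ (skeleton X).Adj x (f b') ∧ (skeleton X).Adj x (f c') :=
      fun x h1 h2 h3 => ⟨f x, hC.adj hf h1, hC.adj hf h2, hC.adj hf h3⟩
    -- Distance three in the hexagonal link is odd, while the colours alternate around the link, so
    -- it cannot occur between vertices of equal colour.
    have opp : ∀ x z, hexGraph.Adj x y'' → hexGraph.Adj x b' → hexGraph.Adj z y'' →
        hexGraph.Adj z x → ¬ hexGraph.Adj z c' := by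
      intro x z h1 h2 h3 h4 h5
      have k1 := hcol (hC.adj hf h1)
      have k2 := hcol (hC.adj hf h2)
      have k3 := hcol (hC.adj hf h3)
      have k4 := hcol (hC.adj hf h4)
      have k5 := hcol (hC.adj hf h5)
      have k6 := hcol hb
      rw [← hbc] at k5
      exact k5 (zmod3_eq k1.symm k6 k2 k3.symm k4.symm).symm
    rw [hC.adj_iff hf] at hb hc
    rcases hex_link hb hc with h | ⟨x, h1, h2, h3⟩ | ⟨x, z, h1, h2, h3, h4, h5⟩
    · exact absurd hbc (hcol (hC.adj hf h))
    · exact key x h1 h2 h3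
    · exact absurd h5 (opp x z h1 h2 h3 h4)

end IsChartSystem
end BuildingSymmetry

/-! ### From local to global, and links as projective planes -/

namespace BuildingSymmetry

theorem exists_adj_dist_eq {Z : Type u} {H : SimpleGraph Z} (hH : H.Connected) {a b : Z} {k : ℕ}
    (h : H.dist a b = k + 1) : ∃ c, H.Adj c b ∧ H.dist a c = k := by
  obtain ⟨p, hp⟩ := hH.exists_walk_length_eq_dist b a
  rw [SimpleGraph.dist_comm, h] at hp
  cases p with
  | nil => simp at hp
  | cons hadj p =>
    rename_i c
    refine ⟨c, hadj.symm, ?_⟩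
    have h1 := SimpleGraph.dist_le p
    have h2 := hH.dist_triangle (u := a) (v := c) (w := b)
    rw [SimpleGraph.dist_eq_one_iff_adj.2 hadj.symm] at h2
    rw [SimpleGraph.dist_comm] at h1
    simp only [SimpleGraph.Walk.length_cons] at hp
    omega

namespace IsBuildingGraph

variable {V : Type u} {G : SimpleGraph V} {τ : V → ZMod 3}

theorem dist_eq_two (hG : IsBuildingGraph G τ) {b c y : V} (hb : G.Adj y b) (hc : G.Adj y c)
    (hne : b ≠ c) (hn : ¬ G.Adj b c) : G.dist b c = 2 := by
  have h1 := hG.connected.dist_triangle (u := b) (v := y) (w := c)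
  rw [SimpleGraph.dist_eq_one_iff_adj.2 hb.symm, SimpleGraph.dist_eq_one_iff_adj.2 hc] at h1
  have h2 : G.dist b c ≠ 0 := fun h => hne (hG.connected.dist_eq_zero_iff.1 h)
  have h3 : G.dist b c ≠ 1 := fun h => hn (SimpleGraph.dist_eq_one_iff_adj.1 h)
  omega

/-- As `b` and `c` are at distance two, `x` and `y` are both neighbours of `b` closer to `c`, and
such neighbours form a clique. -/
theorem eq_or_adj_of_common (hG : IsBuildingGraph G τ) {b c x y : V} (hb : G.Adj y b)
    (hc : G.Adj y c) (hb' : G.Adj x b) (hc' : G.Adj x c) (hne : b ≠ c) (hn : ¬ G.Adj b c) :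
    x = y ∨ G.Adj x y := by
  have h2 := hG.dist_eq_two hb hc hne hn
  rw [SimpleGraph.dist_comm] at h2
  refine hG.closer (z := c) hb'.symm hb.symm ?_ ?_
  · rw [h2, SimpleGraph.dist_eq_one_iff_adj.2 hc'.symm]
    norm_num
  · rw [h2, SimpleGraph.dist_eq_one_iff_adj.2 hc.symm]
    norm_num

theorem color_eq (hG : IsBuildingGraph G τ) {a b c d : V} (hab : G.Adj a b) (hac : G.Adj a c)
    (hbc : G.Adj b c) (had : G.Adj a d) (hbd : G.Adj b d) : τ c = τ d :=
  zmod3_eq (hG.color hab) (hG.color hac) (hG.color hbc) (hG.color had) (hG.color hbd)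

theorem color_eq_of_ne (hG : IsBuildingGraph G τ) {y b c d : V} (hb : G.Adj y b) (hc : G.Adj y c)
    (hd : G.Adj y d) (hbc : τ b ≠ τ c) (hbd : τ b ≠ τ d) : τ c = τ d :=
  zmod3_eq (hG.color hb) (hG.color hc) hbc (hG.color hd) hbd

theorem not_adj_of_color_eq (hG : IsBuildingGraph G τ) {b c : V} (h : τ b = τ c) : ¬ G.Adj b c :=
  fun h' => hG.color h' h

/-- Two points of a projective plane lie on one line only: distinct joins would be adjacent, but
they have the same colour. -/
theorem join_unique (hG : IsBuildingGraph G τ) {y b c x x' : V} (hb : G.Adj y b)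
    (hne : b ≠ c) (hτ : τ b = τ c) (hxy : G.Adj x y) (hxb : G.Adj x b) (hxc : G.Adj x c)
    (hxy' : G.Adj x' y) (hxb' : G.Adj x' b) (hxc' : G.Adj x' c) : x = x' := by
  rcases hG.eq_or_adj_of_common hxb' hxc' hxb hxc hne (hG.not_adj_of_color_eq hτ) with h | h
  · exact h
  · exact absurd h (hG.not_adj_of_color_eq (hG.color_eq hb hxy.symm hxb.symm hxy'.symm hxb'.symm))

/-- A map from a connected graph that is an embedding with convex image in the neighbourhood of
every vertex preserves distances and has convex image. -/
theorem isometric_of_local (hG : IsBuildingGraph G τ) {Z : Type v} {H : SimpleGraph Z}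
    (hH : H.Connected) {f : Z → V} (hadj : ∀ a b, H.Adj a b → G.Adj (f a) (f b))
    (hloc : ∀ y b c, H.Adj y b → H.Adj y c → b ≠ c → ¬ H.Adj b c → f b ≠ f c ∧ ¬ G.Adj (f b) (f c) ∧
      ∀ x, G.Adj x (f b) → G.Adj x (f c) → ∃ w, H.Adj w b ∧ H.Adj w c ∧ f w = x) :
    (∀ a b, G.dist (f a) (f b) = H.dist a b) ∧
    ∀ a b x, G.dist (f a) x + G.dist x (f b) = G.dist (f a) (f b) → ∃ c, f c = x := by
  have far : ∀ {a b b' b'' : Z}, H.Adj b' b → H.Adj b'' b' → H.dist a b'' + 2 = H.dist a b →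
      b'' ≠ b ∧ ¬ H.Adj b'' b := by
    intro a b b' b'' h1 h2 h3
    constructor
    · rintro rfl
      omega
    · intro h
      have := hH.dist_triangle (u := a) (v := b'') (w := b)
      rw [SimpleGraph.dist_eq_one_iff_adj.2 h] at this
      omega
  have iso : ∀ n a b, H.dist a b = n → G.dist (f a) (f b) = n := by
    intro n
    induction n using Nat.strong_induction_on with
    | _ n ih =>
    intro a b hab
    match n, ih, hab with
    | 0, _, hab =>
      rw [hH.dist_eq_zero_iff] at hab
      rw [hab, SimpleGraph.dist_self]
    | 1, _, hab =>
      rw [SimpleGraph.dist_eq_one_iff_adj] at hab ⊢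
      exact hadj _ _ hab
    | k + 2, ih, hab =>
      obtain ⟨b', hb', hd'⟩ := exists_adj_dist_eq hH hab
      obtain ⟨b'', hb'', hd''⟩ := exists_adj_dist_eq hH hd'
      obtain ⟨hne, hn⟩ := far hb' hb'' (a := a) (by omega)
      obtain ⟨l1, l2, l3⟩ := hloc b' b'' b hb''.symm hb' hne hn
      have e' := ih _ (by omega) _ _ hd'
      have e'' := ih _ (by omega) _ _ hd''
      have a' := hadj _ _ hb'
      have a'' := hadj _ _ hb''
      have t1 := hG.connected.dist_triangle (u := f a) (v := f b') (w := f b)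
      have t2 := hG.connected.dist_triangle (u := f a) (v := f b) (w := f b')
      rw [SimpleGraph.dist_eq_one_iff_adj.2 a'] at t1
      rw [SimpleGraph.dist_eq_one_iff_adj.2 a'.symm] at t2
      -- Otherwise `f b''` and `f b` are both closer to `f a` than `f b'`, hence equal or adjacent,
      -- against the local hypothesis.
      have n1 : G.dist (f a) (f b) ≠ k := by
        intro h
        rcases hG.closer (z := f a) a''.symm a' (by omega) (by omega) with h | h
        · exact l1 h
        · exact l2 h
      -- Otherwise the edge from `f b'` to `f b` has an apex `x` closer to `f a`. Then `x` is
      -- adjacent to `f b''`, so by local convexity it is the image of some `c` at distance `k + 1`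
      -- from `a`, while `x` is at distance `k`.
      have n2 : G.dist (f a) (f b) ≠ k + 1 := by
        intro h
        obtain ⟨x, x1, x2, x3⟩ := hG.triangle a' e' h
        rcases hG.closer (z := f a) a''.symm x1.symm (by omega) (by omega) with h' | h'
        · exact l2 (h' ▸ x2)
        · obtain ⟨c, c1, c2, rfl⟩ := l3 x h'.symm x2
          have s1 := hH.dist_triangle (u := a) (v := b'') (w := c)
          have s2 := hH.dist_triangle (u := a) (v := c) (w := b)
          rw [SimpleGraph.dist_eq_one_iff_adj.2 c1.symm] at s1
          rw [SimpleGraph.dist_eq_one_iff_adj.2 c2] at s2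
          have := ih (k + 1) (by omega) a c (by omega)
          omega
      omega
  have iso' : ∀ a b, G.dist (f a) (f b) = H.dist a b := fun a b => iso _ a b rfl
  -- The image contains every possible last step of a geodesic from `f a` to `f b`. If `x` is not `f
  -- b'`, it is adjacent to it; the closer apex over that edge is in the image by induction, say `f
  -- c`, and `x` is a common neighbour of `f c` and `f b`.
  have step : ∀ n a b, H.dist a b = n + 1 → ∀ x, G.Adj x (f b) → G.dist (f a) x = n →
      ∃ c, f c = x := by
    intro n
    induction n with
    | zero =>
      intro a b _ x _ hx
      rw [hG.connected.dist_eq_zero_iff] at hx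
      exact ⟨a, hx⟩
    | succ k ih =>
      intro a b hab x hxb hx
      obtain ⟨b', hb', hd'⟩ := exists_adj_dist_eq hH hab
      have a' := hadj _ _ hb'
      have e' := iso' a b'
      have e := iso' a b
      rcases hG.closer (z := f a) hxb.symm a'.symm (by omega) (by omega) with h | h
      · exact ⟨b', h.symm⟩
      · obtain ⟨y, y1, y2, y3⟩ := hG.triangle h hx (by omega)
        obtain ⟨c, rfl⟩ := ih a b' hd' y y2 y3
        have hcb : H.dist c b' = 1 := by
          rw [← iso', SimpleGraph.dist_eq_one_iff_adj]
          exact y2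
        rw [SimpleGraph.dist_eq_one_iff_adj] at hcb
        have hac := iso' a c
        obtain ⟨hne, hn⟩ := far hb' hcb (a := a) (by omega)
        obtain ⟨w, -, -, hw⟩ := (hloc b' c b hcb.symm hb' hne hn).2.2 x y1.symm hxb
        exact ⟨w, hw⟩
  refine ⟨iso', ?_⟩
  intro a b x hx
  induction n : G.dist x (f b) generalizing b with
  | zero =>
    rw [hG.connected.dist_eq_zero_iff] at n
    exact ⟨b, n.symm⟩
  | succ m ih =>
    obtain ⟨y, hy, hxy⟩ := exists_adj_dist_eq hG.connected n
    have t1 := hG.connected.dist_triangle (u := f a) (v := x) (w := y)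
    have t2 := hG.connected.dist_triangle (u := f a) (v := y) (w := f b)
    rw [SimpleGraph.dist_eq_one_iff_adj.2 hy] at t2
    have e := iso' a b
    obtain ⟨c, rfl⟩ := step (G.dist (f a) y) a b (by omega) y hy rfl
    exact ih c (by omega) hxy

/-- A perspectivity in the projective plane of the link: `b` is a point off the line `c` (or
dually), and a line through `b` is sent to the point where it meets `c`. -/
theorem encard_commonNeighbors_le_of_opposite (hG : IsBuildingGraph G τ) {y b c : V}
    (hb : G.Adj y b) (hc : G.Adj y c) (hτ : τ b ≠ τ c) (hn : ¬ G.Adj b c) :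
    (G.commonNeighbors y b).encard ≤ (G.commonNeighbors y c).encard := by
  have hcol : ∀ l, l ∈ G.commonNeighbors y b → τ l = τ c := by
    rintro l ⟨h1, h2⟩
    exact hG.color_eq_of_ne hb h1 hc (hG.color h2) hτ
  have hex : ∀ l, ∃ m, l ∈ G.commonNeighbors y b → G.Adj m y ∧ G.Adj m l ∧ G.Adj m c := by
    intro l
    by_cases hl : l ∈ G.commonNeighbors y b
    · obtain ⟨m, h⟩ := hG.exists_join hl.1 hc (hcol l hl)
      exact ⟨m, fun _ => h⟩
    · exact ⟨l, fun h => absurd h hl⟩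
  choose j hj using hex
  refine Set.encard_le_encard_of_injOn (f := j) ?_ ?_
  · intro l hl
    exact ⟨(hj l hl).1.symm, (hj l hl).2.2.symm⟩
  · intro l hl l' hl' e
    obtain ⟨h1, h2, h3⟩ := hj l hl
    obtain ⟨h1', h2', h3'⟩ := hj l' hl'
    rw [← e] at h1' h2' h3'
    have hne : b ≠ j l := fun h => hn (h ▸ h3)
    have : τ b = τ (j l) :=
      hG.color_eq_of_ne hc hb h1.symm hτ.symm (hG.color h3.symm)
    exact hG.join_unique hb hne this hl.1.symm hl.2.symm h2.symm hl'.1.symm hl'.2.symm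
      h2'.symm

theorem encard_commonNeighbors_eq_of_opposite (hG : IsBuildingGraph G τ) {y b c : V}
    (hb : G.Adj y b) (hc : G.Adj y c) (hτ : τ b ≠ τ c) (hn : ¬ G.Adj b c) :
    (G.commonNeighbors y b).encard = (G.commonNeighbors y c).encard :=
  le_antisymm (hG.encard_commonNeighbors_le_of_opposite hb hc hτ hn)
    (hG.encard_commonNeighbors_le_of_opposite hc hb hτ.symm fun h => hn h.symm)

/-- For points `b` and `c`, thickness gives a third point `d` on their common line and a second line
`l` through `d`. It misses both points, so two perspectivities through `l` compare them. -/
theorem encard_commonNeighbors_eq_of_color_eq (hG : IsBuildingGraph G τ)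
    (hthick : ∀ y b, G.Adj y b → 3 ≤ (G.commonNeighbors y b).encard) {y b c : V}
    (hb : G.Adj y b) (hc : G.Adj y c) (hτ : τ b = τ c) :
    (G.commonNeighbors y b).encard = (G.commonNeighbors y c).encard := by
  by_cases hne : b = c
  · rw [hne]
  obtain ⟨m, m1, m2, m3⟩ := hG.exists_join hb hc hτ
  have h3 : ∃ d ∈ G.commonNeighbors y m, d ∉ ({b, c} : Set V) := by
    by_contra! h
    have := (hthick y m m1.symm).trans ((Set.encard_le_encard h).trans ((Set.encard_insert_le _ _).trans_eq (by rw [Set.encard_singleton])))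
    exact absurd this (by norm_num)
  obtain ⟨d, hd, hdn⟩ := h3
  simp only [Set.mem_insert_iff, Set.mem_singleton_iff, not_or] at hdn
  have h4 : ∃ l ∈ G.commonNeighbors y d, l ∉ ({m} : Set V) := by
    by_contra! h
    have := (hthick y d hd.1).trans ((Set.encard_le_encard h).trans (Set.encard_singleton m).le)
    exact absurd this (by norm_num)
  obtain ⟨l, hl, hlm⟩ := h4
  have hdb : τ d = τ b := hG.color_eq m1.symm hd.1 hd.2 hb m2
  have hdc : τ d = τ c := hG.color_eq m1.symm hd.1 hd.2 hc m3
  have hlb : ¬ G.Adj l b := fun h => hlm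
    (hG.join_unique hd.1 hdn.1 hdb hl.1.symm hl.2.symm h m1 hd.2 m2)
  have hlc : ¬ G.Adj l c := fun h => hlm
    (hG.join_unique hd.1 hdn.2 hdc hl.1.symm hl.2.symm h m1 hd.2 m3)
  have hτl := hG.color hl.2
  rw [← hG.encard_commonNeighbors_eq_of_opposite hl.1 hb (by rw [← hdb]; exact hτl.symm) hlb,
    hG.encard_commonNeighbors_eq_of_opposite hl.1 hc (by rw [← hdc]; exact hτl.symm) hlc]

theorem encard_commonNeighbors_eq_of_adj (hG : IsBuildingGraph G τ)
    (hthick : ∀ y b, G.Adj y b → 3 ≤ (G.commonNeighbors y b).encard) {y b c : V}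
    (hb : G.Adj y b) (hc : G.Adj y c) :
    (G.commonNeighbors y b).encard = (G.commonNeighbors y c).encard := by
  by_cases hτ : τ b = τ c
  · exact hG.encard_commonNeighbors_eq_of_color_eq hthick hb hc hτ
  by_cases hn : G.Adj b c
  swap
  · exact hG.encard_commonNeighbors_eq_of_opposite hb hc hτ hn
  have h1 : ∃ d ∈ G.commonNeighbors y c, d ∉ ({b} : Set V) := by
    by_contra! h
    have := (hthick y c hc).trans ((Set.encard_le_encard h).trans (Set.encard_singleton b).le)
    exact absurd this (by norm_num)
  obtain ⟨d, hd, hdb⟩ := h1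
  have h2 : ∃ l ∈ G.commonNeighbors y d, l ∉ ({c} : Set V) := by
    by_contra! h
    have := (hthick y d hd.1).trans ((Set.encard_le_encard h).trans (Set.encard_singleton c).le)
    exact absurd this (by norm_num)
  obtain ⟨l, hl, hlc⟩ := h2
  have e1 : τ d = τ b := hG.color_eq hc hd.1 hd.2 hb hn.symm
  have e2 : τ l = τ c := hG.color_eq hd.1 hl.1 hl.2 hc hd.2.symm
  have hlb : ¬ G.Adj b l := fun h => hlc
    (hG.join_unique hd.1 hdb e1 hl.1.symm hl.2.symm h.symm hc.symm hd.2 hn.symm)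
  rw [hG.encard_commonNeighbors_eq_of_opposite hb hl.1 (by rw [e2]; exact hτ) hlb,
    hG.encard_commonNeighbors_eq_of_color_eq hthick hl.1 hc e2]

/-- The number of triangles on an edge does not depend on the edge. -/
theorem encard_commonNeighbors_eq (hG : IsBuildingGraph G τ)
    (hthick : ∀ y b, G.Adj y b → 3 ≤ (G.commonNeighbors y b).encard) {y b y' b' : V}
    (hb : G.Adj y b) (hb' : G.Adj y' b') :
    (G.commonNeighbors y b).encard = (G.commonNeighbors y' b').encard := by
  obtain ⟨p⟩ := hG.connected.preconnected y y'
  induction p generalizing b with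
  | nil => exact hG.encard_commonNeighbors_eq_of_adj hthick hb hb'
  | cons h p ih =>
    rw [hG.encard_commonNeighbors_eq_of_adj hthick hb h, SimpleGraph.commonNeighbors_symm]
    exact ih h.symm hb'

end IsBuildingGraph

/-! ### Counting in links of order `q` -/

/-- The `1`-skeleton of a building of type `Ã₂` in which every edge lies in `q + 1` triangles. -/
structure IsRegularBuildingGraph {V : Type u} (G : SimpleGraph V) (τ : V → ZMod 3) (q : ℕ) : Prop
    extends IsBuildingGraph G τ where
  two_le : 2 ≤ q
  encard_common : ∀ {y b}, G.Adj y b → (G.commonNeighbors y b).encard = ((q + 1 : ℕ) : ℕ∞)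
  exists_adj : ∀ y, ∃ b, G.Adj y b

namespace IsRegularBuildingGraph

variable {V : Type u} {G : SimpleGraph V} {τ : V → ZMod 3} {q : ℕ}

/-- The points of a projective plane are counted from one of them: through `c` pass `q + 1` lines,
each with `q` further points, and these lines meet only in `c`. -/
theorem encard_same_color (hG : IsRegularBuildingGraph G τ q) {y c : V} (hc : G.Adj y c) :
    {b | G.Adj y b ∧ τ b = τ c}.encard = ((q ^ 2 + q + 1 : ℕ) : ℕ∞) := by
  classical
  have hfin : ∀ m, ∃ F : Finset V, G.Adj y m →
      ((F : Set V) = G.commonNeighbors y m ∧ F.card = q + 1) := by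
    intro m
    by_cases hm : G.Adj y m
    · have h := hG.encard_common hm
      have hf : (G.commonNeighbors y m).Finite :=
        Set.finite_of_encard_eq_coe h
      refine ⟨hf.toFinset, fun _ => ⟨by simp, ?_⟩⟩
      rw [hf.encard_eq_coe_toFinset_card] at h
      exact_mod_cast h
    · exact ⟨∅, fun h => absurd h hm⟩
  choose F hF using hfin
  have memF : ∀ {m x}, G.Adj y m → (x ∈ F m ↔ G.Adj y x ∧ G.Adj m x) := by
    intro m x hm
    rw [← Finset.mem_coe, (hF m hm).1]
    rfl
  have hset : {b | G.Adj y b ∧ τ b = τ c} =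
      ((insert c ((F c).biUnion fun m => (F m).erase c) : Finset V) : Set V) := by
    ext b
    simp only [Set.mem_ofPred_eq, Finset.coe_insert, Finset.coe_biUnion, Set.mem_insert_iff,
      Set.mem_iUnion, Finset.mem_coe, Finset.mem_erase]
    constructor
    · rintro ⟨h1, h2⟩
      by_cases hbc : b = c
      · exact Or.inl hbc
      obtain ⟨m, m1, m2, m3⟩ := hG.exists_join h1 hc h2
      exact Or.inr ⟨m, (memF hc).2 ⟨m1.symm, m3.symm⟩, hbc, (memF m1.symm).2 ⟨h1, m2⟩⟩
    · rintro (rfl | ⟨m, h1, h2, h3⟩)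
      · exact ⟨hc, rfl⟩
      · rw [memF hc] at h1
        rw [memF h1.1] at h3
        exact ⟨h3.1, hG.color_eq h1.1 h3.1 h3.2 hc h1.2.symm⟩
  rw [hset, Set.encard_coe_eq_coe_finsetCard, Finset.card_insert_of_notMem (by simp),
    Finset.card_biUnion]
  · have : ∀ m ∈ F c, ((F m).erase c).card = q := by
      intro m hm
      rw [memF hc] at hm
      rw [Finset.card_erase_of_mem ((memF hm.1).2 ⟨hc, hm.2.symm⟩), (hF m hm.1).2]
      rfl
    rw [Finset.sum_congr rfl this, Finset.sum_const, (hF c hc).2, smul_eq_mul]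
    congr 1
    ring
  · intro m hm m' hm' hne
    rw [Finset.mem_coe, memF hc] at hm hm'
    rw [Function.onFun, Finset.disjoint_left]
    intro x hx hx'
    rw [Finset.mem_erase, memF hm.1] at hx
    rw [Finset.mem_erase, memF hm'.1] at hx'
    exact hne (hG.join_unique hc hx.1.symm
      (hG.color_eq hm.1 hc hm.2.symm hx.2.1 hx.2.2) hm.1.symm hm.2.symm hx.2.2 hm'.1.symm hm'.2.symm
      hx'.2.2)

theorem exists_commonNeighbor (hG : IsRegularBuildingGraph G τ q) {y c : V} (hc : G.Adj y c) :
    ∃ d, G.Adj y d ∧ G.Adj c d := by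
  have : (G.commonNeighbors y c).Nonempty := by
    rw [← Set.encard_pos, hG.encard_common hc]
    exact_mod_cast Nat.succ_pos q
  exact this

theorem setOf_color_ne (hG : IsRegularBuildingGraph G τ q) {y c d : V} (hc : G.Adj y c)
    (hd : G.Adj y d) (hcd : G.Adj c d) :
    {b | G.Adj y b ∧ τ b ≠ τ c} = {b | G.Adj y b ∧ τ b = τ d} := by
  ext b
  constructor
  · rintro ⟨h1, h2⟩
    exact ⟨h1, hG.color_eq_of_ne hc h1 hd h2.symm (hG.color hcd)⟩
  · rintro ⟨h1, h2⟩
    exact ⟨h1, by rw [h2]; exact (hG.color hcd).symm⟩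

/-- Of the `q ^ 2 + q + 1` vertices of the other colour in the link, `q + 1` are adjacent to `c`. -/
theorem encard_opposite (hG : IsRegularBuildingGraph G τ q) {y c : V} (hc : G.Adj y c) :
    {b | G.Adj y b ∧ τ b ≠ τ c ∧ ¬ G.Adj b c}.encard = ((q ^ 2 : ℕ) : ℕ∞) := by
  obtain ⟨d, hd, hcd⟩ := hG.exists_commonNeighbor hc
  have h1 := hG.encard_same_color hd
  rw [← hG.setOf_color_ne hc hd hcd] at h1
  have h2 : {b | G.Adj y b ∧ τ b ≠ τ c} =
      {b | G.Adj y b ∧ τ b ≠ τ c ∧ ¬ G.Adj b c} ∪ G.commonNeighbors y c := by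
    ext b
    simp only [Set.mem_ofPred_eq, Set.mem_union, SimpleGraph.mem_commonNeighbors]
    constructor
    · rintro ⟨h1, h2⟩
      by_cases h : G.Adj b c
      · exact Or.inr ⟨h1, h.symm⟩
      · exact Or.inl ⟨h1, h2, h⟩
    · rintro (⟨h1, h2, -⟩ | ⟨h1, h2⟩)
      · exact ⟨h1, h2⟩
      · exact ⟨h1, (hG.color h2).symm⟩
  rw [h2, Set.encard_union_eq, hG.encard_common hc] at h1
  · have hfin : {b | G.Adj y b ∧ τ b ≠ τ c ∧ ¬ G.Adj b c}.Finite := by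
      rw [← Set.encard_ne_top_iff]
      intro h
      rw [h] at h1
      rw [top_add] at h1
      exact ENat.natCast_ne_top _ h1.symm
    rw [← hfin.cast_ncard_eq] at h1 ⊢
    norm_cast at h1 ⊢
    omega
  · rw [Set.disjoint_left]
    rintro b ⟨-, -, h⟩ ⟨-, h'⟩
    exact h h'.symm

theorem encard_neighborSet (hG : IsRegularBuildingGraph G τ q) (y : V) :
    (G.neighborSet y).encard = ((2 * (q ^ 2 + q + 1) : ℕ) : ℕ∞) := by
  obtain ⟨c, hc⟩ := hG.exists_adj y
  obtain ⟨d, hd, hcd⟩ := hG.exists_commonNeighbor hc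
  have h : G.neighborSet y = {b | G.Adj y b ∧ τ b = τ c} ∪ {b | G.Adj y b ∧ τ b ≠ τ c} := by
    ext b
    simp only [SimpleGraph.mem_neighborSet, Set.mem_union, Set.mem_ofPred_eq]
    tauto
  rw [h, Set.encard_union_eq, hG.setOf_color_ne hc hd hcd, hG.encard_same_color hc,
    hG.encard_same_color hd, two_mul]
  · rfl
  · rw [Set.disjoint_left]
    rintro b ⟨-, h⟩ ⟨-, h'⟩
    exact h' h

end IsRegularBuildingGraph

end BuildingSymmetry

/-! ### Buildings are flag complexes with regular links -/

namespace BuildingSymmetry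

variable {V : Type u} {X : AbstractSimplicialComplex V}

/-- A complex is a flag complex if every finite clique of its `1`-skeleton is a simplex. -/
def IsFlag (K : AbstractSimplicialComplex V) : Prop :=
  ∀ s : Finset V, s.Nonempty → (skeleton K).IsClique (s : Set V) → s ∈ K.faces

theorem isClique_of_mem_faces {K : AbstractSimplicialComplex V} {s : Finset V} (hs : s ∈ K.faces) :
    (skeleton K).IsClique (s : Set V) :=
  fun _ ha _ hb hab => skeleton_adj.2 ⟨hab, s, hs, ha, hb⟩

theorem IsA2TildeBuilding.nonempty (hX : IsA2TildeBuilding X) : Nonempty V := by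
  obtain ⟨s, hs, hc⟩ := hX.exists_triangle
  obtain ⟨x, -⟩ := Finset.card_pos.1 (by omega : 0 < s.card)
  exact ⟨x⟩

theorem IsChartSystem.triple_mem_faces [DecidableEq V] {C : Set (ℤ × ℤ → V)}
    (hC : IsChartSystem X C) {a b c : V} (hab : (skeleton X).Adj a b) (hac : (skeleton X).Adj a c)
    (hbc : (skeleton X).Adj b c) : ({a, b, c} : Finset V) ∈ X.faces := by
  obtain ⟨f, hf, a, b, c, rfl, rfl, rfl⟩ := hC.exists_chart_vertex_edge a hbc
  rw [hC.adj_iff hf] at hab hac hbc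
  have := hC.face f hf {a, b, c} ⟨by simp, by
    change hexGraph.IsClique _
    simp [SimpleGraph.isClique_insert, hab, hac, hbc]⟩
  convert this
  ext x
  simp [mem_faceImage, eq_comm]

/-- The colouring bounds cliques by three vertices. For three pairwise adjacent vertices, one
apartment contains an edge and the third vertex, and there they form a lattice triangle. -/
theorem IsA2TildeBuilding.isFlag (hX : IsA2TildeBuilding X) : IsFlag X := by
  classical
  obtain ⟨C, hC⟩ := exists_isChartSystem hX
  have := hX.nonempty
  obtain ⟨τ, hG⟩ := hC.exists_isBuildingGraph
  intro s hne hs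
  have hcard : s.card ≤ 3 := by
    have h := Finset.card_le_card_of_injOn (s := s) (t := (Finset.univ : Finset (ZMod 3))) τ
      (fun _ _ => Finset.mem_univ _) (by
        intro a ha b hb hab
        by_contra h
        exact hG.color (hs ha hb h) hab)
    simpa [ZMod.card] using h
  have hpos := hne.card_pos
  rcases (by omega : s.card = 1 ∨ s.card = 2 ∨ s.card = 3) with h | h | h
  · obtain ⟨a, rfl⟩ := Finset.card_eq_one.1 h
    exact X.singleton_mem a
  · obtain ⟨a, b, hab, rfl⟩ := Finset.card_eq_two.1 h
    exact pair_mem_faces (hs (by simp) (by simp) hab)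
  · obtain ⟨a, b, c, hab, hac, hbc, rfl⟩ := Finset.card_eq_three.1 h
    exact hC.triple_mem_faces (hs (by simp) (by simp) hab) (hs (by simp) (by simp) hac)
      (hs (by simp) (by simp) hbc)

theorem IsA2TildeBuilding.encard_trianglesOver [DecidableEq V] (hX : IsA2TildeBuilding X) {y b : V}
    (h : (skeleton X).Adj y b) :
    (trianglesOver X {y, b}).encard = ((skeleton X).commonNeighbors y b).encard := by
  obtain ⟨C, hC⟩ := exists_isChartSystem hX
  have : trianglesOver X {y, b} =
      (fun c => ({y, b, c} : Finset V)) '' (skeleton X).commonNeighbors y b := by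
    ext t
    constructor
    · rintro ⟨h1, h2, h3⟩
      have hyb : ({y, b} : Finset V).card = 2 := Finset.card_pair h.ne
      obtain ⟨c, hc⟩ := Finset.card_eq_one.1 (by
        rw [Finset.card_sdiff_of_subset h3, h2, hyb] : (t \ {y, b}).card = 1)
      have hct : c ∈ t \ {y, b} := by rw [hc]; simp
      rw [Finset.mem_sdiff] at hct
      have hcn : c ≠ y ∧ c ≠ b := by simpa using hct.2
      refine ⟨c, ⟨skeleton_adj.2 ⟨hcn.1.symm, t, h1, h3 (by simp), hct.1⟩,
        skeleton_adj.2 ⟨hcn.2.symm, t, h1, h3 (by simp), hct.1⟩⟩, ?_⟩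
      have := Finset.union_sdiff_of_subset h3
      rw [hc] at this
      rw [← this]
      ext x
      simp
    · rintro ⟨c, hc, rfl⟩
      obtain ⟨h1, h2⟩ := (SimpleGraph.mem_commonNeighbors _).1 hc
      refine ⟨hC.triple_mem_faces h h1 h2, ?_, ?_⟩
      · exact Finset.card_eq_three.2 ⟨y, b, c, h.ne, h1.ne, h2.ne, rfl⟩
      · intro x
        simp only [Finset.mem_insert, Finset.mem_singleton]
        tauto
  rw [this, Set.InjOn.encard_image]
  intro c hc d hd hcd
  rw [SimpleGraph.mem_commonNeighbors] at hc
  have : c ∈ ({y, b, d} : Finset V) := by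
    rw [← show ({y, b, c} : Finset V) = {y, b, d} from hcd]
    simp
  simp only [Finset.mem_insert, Finset.mem_singleton] at this
  rcases this with rfl | rfl | h
  · exact absurd rfl hc.1.ne
  · exact absurd rfl hc.2.ne
  · exact h

theorem IsA2TildeBuilding.exists_isRegularBuildingGraph (hX : IsA2TildeBuilding X) {q : ℕ}
    (hq : ∃ e ∈ X.faces, e.card = 2 ∧ (trianglesOver X e).encard = ((q + 1 : ℕ) : ℕ∞)) :
    ∃ τ, IsRegularBuildingGraph (skeleton X) τ q := by
  classical
  obtain ⟨C, hC⟩ := exists_isChartSystem hX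
  have := hX.nonempty
  obtain ⟨τ, hG⟩ := hC.exists_isBuildingGraph
  have hthick : ∀ y b, (skeleton X).Adj y b → 3 ≤ ((skeleton X).commonNeighbors y b).encard := by
    intro y b h
    rw [← hX.encard_trianglesOver h]
    exact hX.thick _ (pair_mem_faces h) (Finset.card_pair h.ne)
  obtain ⟨e, he, hc, hcard⟩ := hq
  obtain ⟨a, b, hab, rfl⟩ := Finset.card_eq_two.1 hc
  have hadj : (skeleton X).Adj a b := isClique_of_mem_faces he (by simp) (by simp) hab
  rw [hX.encard_trianglesOver hadj] at hcard
  refine ⟨τ, hG, ?_, ?_, ?_⟩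
  · have := hthick a b hadj
    rw [hcard] at this
    have : 3 ≤ q + 1 := by exact_mod_cast this
    omega
  · intro y b h
    rw [hG.encard_commonNeighbors_eq hthick h hadj, hcard]
  · intro y
    obtain ⟨f, hf, c, -, rfl, -⟩ := hC.exists_chart_vertices y y
    exact ⟨f (c.1 + 1, c.2), hC.adj hf (by simp [hexGraph_adj])⟩

end BuildingSymmetry

/-! ### Isometries between flag complexes -/

namespace BuildingSymmetry

section Flag

variable {V : Type u} {W : Type v} {K : AbstractSimplicialComplex V}
  {L : AbstractSimplicialComplex W} {f : V → W}

theorem IsIsometry.injective (hf : IsIsometry K L f) : Function.Injective f := by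
  intro a b hab
  have := hf.edist_eq a b
  rw [hab, SimpleGraph.edist_self] at this
  exact SimpleGraph.edist_eq_zero_iff.1 this.symm

theorem IsIsometry.adj_iff (hf : IsIsometry K L f) {a b : V} :
    (skeleton L).Adj (f a) (f b) ↔ (skeleton K).Adj a b := by
  rw [← SimpleGraph.edist_eq_one_iff_adj, hf.edist_eq, SimpleGraph.edist_eq_one_iff_adj]

/-- This is where condition (ii) on isometries enters. By induction on a clique its proper subsets
are simplices, so the boundary of the image simplex lies in the image; hence so does the simplex,
and injectivity identifies its source with the clique. -/
theorem IsIsometry.isFlag (hf : IsIsometry K L f) (hL : IsFlag L) : IsFlag K := by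
  classical
  intro s
  induction s using Finset.strongInduction with
  | _ s ih =>
  intro hne hs
  by_cases h1 : s.card = 1
  · obtain ⟨a, rfl⟩ := Finset.card_eq_one.1 h1
    exact K.singleton_mem a
  have hcard : (faceImage f s).card = s.card := by
    unfold faceImage
    convert Finset.card_image_of_injective s hf.injective
  have hL' : faceImage f s ∈ L.faces := by
    apply hL
    · rw [← Finset.card_pos, hcard]
      exact hne.card_pos
    · intro x hx y hy hxy
      obtain ⟨a, ha, rfl⟩ := mem_faceImage.1 hx
      obtain ⟨b, hb, rfl⟩ := mem_faceImage.1 hy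
      rw [hf.adj_iff]
      exact hs ha hb fun h => hxy (congrArg f h)
  have hpos := hne.card_pos
  obtain ⟨s', hs', e⟩ := hf.full _ hL' (by omega) (by
    intro r hr hrt
    have hsub : s.filter (fun x => f x ∈ r) ⊂ s := by
      refine ⟨Finset.filter_subset _ _, fun h => hrt.2 ?_⟩
      intro y hy
      obtain ⟨a, ha, rfl⟩ := mem_faceImage.1 hy
      exact (Finset.mem_filter.1 (h ha)).2
    have himg : faceImage f (s.filter fun x => f x ∈ r) = r := by
      ext y
      rw [mem_faceImage]
      constructor
      · rintro ⟨a, ha, rfl⟩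
        exact (Finset.mem_filter.1 ha).2
      · intro hy
        obtain ⟨a, ha, rfl⟩ := mem_faceImage.1 (hrt.1 hy)
        exact ⟨a, Finset.mem_filter.2 ⟨ha, hy⟩, rfl⟩
    refine ⟨_, ih _ hsub ?_ (hs.subset (by exact_mod_cast hsub.1)), himg⟩
    obtain ⟨y, hy⟩ := hr
    rw [← himg] at hy
    obtain ⟨a, ha, -⟩ := mem_faceImage.1 hy
    exact ⟨a, ha⟩)
  have : s' = s := by
    ext a
    constructor <;> intro ha
    · have := e ▸ mem_faceImage.2 ⟨a, ha, rfl⟩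
      obtain ⟨b, hb, h⟩ := mem_faceImage.1 this
      exact hf.injective h ▸ hb
    · have := e.symm ▸ mem_faceImage.2 ⟨a, ha, rfl⟩
      obtain ⟨b, hb, h⟩ := mem_faceImage.1 this
      exact hf.injective h ▸ hb
  exact this ▸ hs'

/-- For flag complexes, isometries are the distance preserving maps with convex image. -/
theorem isIsometry_of_isFlag (hK : IsFlag K) (hL : IsFlag L)
    (hd : ∀ a b, (skeleton L).edist (f a) (f b) = (skeleton K).edist a b)
    (hc : GeodesicallyConvex (skeleton L) (Set.range f)) : IsIsometry K L f := by
  classical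
  have hadj : ∀ {a b}, (skeleton L).Adj (f a) (f b) ↔ (skeleton K).Adj a b := by
    intro a b
    rw [← SimpleGraph.edist_eq_one_iff_adj, hd, SimpleGraph.edist_eq_one_iff_adj]
  refine ⟨?_, hd, ?_, hc⟩
  · intro s hs
    apply hL
    · obtain ⟨a, ha⟩ := (K.isRelLowerSet_faces hs).1
      exact ⟨f a, mem_faceImage.2 ⟨a, ha, rfl⟩⟩
    · intro x hx y hy hxy
      obtain ⟨a, ha, rfl⟩ := mem_faceImage.1 hx
      obtain ⟨b, hb, rfl⟩ := mem_faceImage.1 hy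
      rw [hadj]
      exact isClique_of_mem_faces hs ha hb fun h => hxy (congrArg f h)
  · intro t ht h2 hr
    have hv : ∀ y ∈ t, ∃ a, f a = y := by
      intro y hy
      obtain ⟨s, -, hs⟩ := hr {y} (by simp) (by
        rw [Finset.ssubset_iff_subset_ne]
        refine ⟨by simpa using hy, ?_⟩
        rintro rfl
        simp at h2)
      obtain ⟨a, -, ha⟩ := mem_faceImage.1 (hs.symm ▸ Finset.mem_singleton_self y)
      exact ⟨a, ha⟩
    have hinj : Function.Injective f := by
      intro a b hab
      have := hd a b
      rw [hab, SimpleGraph.edist_self] at this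
      exact SimpleGraph.edist_eq_zero_iff.1 this.symm
    have himg : faceImage f (t.preimage f hinj.injOn) = t := by
      ext y
      rw [mem_faceImage]
      constructor
      · rintro ⟨a, ha, rfl⟩
        simpa using ha
      · intro hy
        obtain ⟨a, rfl⟩ := hv y hy
        exact ⟨a, by simpa using hy, rfl⟩
    refine ⟨_, hK _ ?_ ?_, himg⟩
    · obtain ⟨y, hy⟩ := (L.isRelLowerSet_faces ht).1
      rw [← himg] at hy
      obtain ⟨a, ha, -⟩ := mem_faceImage.1 hy
      exact ⟨a, ha⟩
    · intro a ha b hb hab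
      rw [← hadj]
      exact isClique_of_mem_faces ht (by simpa using ha) (by simpa using hb)
        fun h => hab (hinj h)

theorem skeleton_flagComplex (G : SimpleGraph V) : skeleton (flagComplex G) = G := by
  classical
  ext a b
  rw [skeleton_adj]
  constructor
  · rintro ⟨hne, s, hs, ha, hb⟩
    exact hs.2 ha hb hne
  · intro h
    exact ⟨h.ne, {a, b}, ⟨by simp, by simp [h]⟩, by simp, by simp⟩

theorem isFlag_flagComplex (G : SimpleGraph V) : IsFlag (flagComplex G) := by
  intro s hs hc
  rw [skeleton_flagComplex] at hc
  exact ⟨hs, hc⟩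

theorem geodesicallyConvex_of_dist {G : SimpleGraph V} {S : Set V}
    (h : ∀ a ∈ S, ∀ b ∈ S, ∀ c, G.Reachable a c → G.Reachable c b →
      G.dist a c + G.dist c b = G.dist a b → c ∈ S) :
    GeodesicallyConvex G S := by
  classical
  intro a ha b hb p hp c hc
  have h1 := SimpleGraph.dist_le (p.takeUntil c hc)
  have h2 := SimpleGraph.dist_le (p.dropUntil c hc)
  have h3 := congrArg SimpleGraph.Walk.length (p.take_spec hc)
  rw [SimpleGraph.Walk.length_append] at h3
  have h4 := (SimpleGraph.Walk.reachable (p.takeUntil c hc)).dist_triangle_left b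
  exact h a ha b hb c ⟨p.takeUntil c hc⟩ ⟨p.dropUntil c hc⟩ (by omega)

theorem GeodesicallyConvex.mem_of_dist {G : SimpleGraph V} {S : Set V}
    (hS : GeodesicallyConvex G S) {a b c : V} (ha : a ∈ S) (hb : b ∈ S) (h1 : G.Reachable a c)
    (h2 : G.Reachable c b) (h : G.dist a c + G.dist c b = G.dist a b) : c ∈ S := by
  obtain ⟨p, hp⟩ := h1.exists_walk_length_eq_dist
  obtain ⟨r, hr⟩ := h2.exists_walk_length_eq_dist
  refine hS a ha b hb (p.append r) (by rw [SimpleGraph.Walk.length_append]; omega) c ?_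
  simp

theorem IsIsometry.reachable_iff (hf : IsIsometry K L f) {a b : V} :
    (skeleton L).Reachable (f a) (f b) ↔ (skeleton K).Reachable a b := by
  rw [← SimpleGraph.edist_ne_top_iff_reachable, hf.edist_eq,
    SimpleGraph.edist_ne_top_iff_reachable]

theorem IsIsometry.dist_eq (hf : IsIsometry K L f) (a b : V) :
    (skeleton L).dist (f a) (f b) = (skeleton K).dist a b := by
  rw [SimpleGraph.dist, hf.edist_eq, SimpleGraph.dist]

theorem IsIsometry.comp {Z : Type w} {M : AbstractSimplicialComplex Z} {g : W → Z}
    (hM : IsFlag M) (hg : IsIsometry L M g) (hf : IsIsometry K L f) : IsIsometry K M (g ∘ f) := by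
  refine isIsometry_of_isFlag (hf.isFlag (hg.isFlag hM)) hM
    (fun a b => (hg.edist_eq _ _).trans (hf.edist_eq a b)) ?_
  apply geodesicallyConvex_of_dist
  rintro _ ⟨a, rfl⟩ _ ⟨b, rfl⟩ c h1 h2 h3
  obtain ⟨c, rfl⟩ := hg.convex.mem_of_dist ⟨f a, rfl⟩ ⟨f b, rfl⟩ h1 h2 h3
  simp only [Function.comp_apply] at h1 h2 h3
  rw [hg.reachable_iff] at h1 h2
  rw [hg.dist_eq, hg.dist_eq, hg.dist_eq] at h3
  obtain ⟨d, rfl⟩ := hf.convex.mem_of_dist ⟨a, rfl⟩ ⟨b, rfl⟩ h1 h2 h3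
  exact ⟨d, rfl⟩

end Flag

end BuildingSymmetry

/-! ### Trees and the graph of the wall-tree -/

namespace BuildingSymmetry

section Tree

variable {W : Type w} {T : SimpleGraph W}

theorem tree_dist_adj (hT : T.IsTree) (x : W) {a b : W} (h : T.Adj a b) :
    T.dist x b = T.dist x a + 1 ∨ T.dist x a = T.dist x b + 1 :=
  (hT.dist_eq_dist_add_one_of_adj x h).symm

theorem tree_not_adj (hT : T.IsTree) {z a b : W} (ha : T.Adj z a) (hb : T.Adj z b) :
    ¬ T.Adj a b := by
  intro h
  have := tree_dist_adj hT z h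
  rw [SimpleGraph.dist_eq_one_iff_adj.2 ha, SimpleGraph.dist_eq_one_iff_adj.2 hb] at this
  omega

theorem exists_walk_through {z c x : W} (hT : T.IsTree) (h : T.Adj z c)
    (hd : T.dist x c < T.dist x z) : ∃ p : T.Walk z x, p.IsPath ∧ c ∈ p.support ∧
      p.snd = c := by
  obtain ⟨p, hp⟩ := hT.connected.exists_walk_length_eq_dist c x
  refine ⟨SimpleGraph.Walk.cons h p, ?_, by simp, by simp⟩
  apply SimpleGraph.Walk.isPath_of_length_eq_dist
  rw [SimpleGraph.Walk.length_cons, hp, SimpleGraph.dist_comm]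
  have := tree_dist_adj hT x h
  rw [SimpleGraph.dist_comm (u := z)]
  omega

/-- A vertex of a tree has at most one neighbour that is closer to a given vertex. -/
theorem tree_closer_unique (hT : T.IsTree) {x z a b : W} (ha : T.Adj z a) (hb : T.Adj z b)
    (hda : T.dist x a < T.dist x z) (hdb : T.dist x b < T.dist x z) : a = b := by
  obtain ⟨p, hp, -, h1⟩ := exists_walk_through hT ha hda
  obtain ⟨r, hr, -, h2⟩ := exists_walk_through hT hb hdb
  have : p = r := congrArg Subtype.val
    ((hT.isAcyclic.subsingleton_path z x).elim ⟨p, hp⟩ ⟨r, hr⟩)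
  rw [← h1, ← h2, this]

theorem tree_exists_closer (hT : T.IsTree) {x z : W} (h : x ≠ z) :
    ∃ a, T.Adj z a ∧ T.dist x z = T.dist x a + 1 := by
  have h0 : T.dist x z ≠ 0 := fun e => h (hT.connected.dist_eq_zero_iff.1 e)
  obtain ⟨k, hk⟩ := Nat.exists_eq_succ_of_ne_zero h0
  obtain ⟨a, ha, hd⟩ := exists_adj_dist_eq hT.connected hk
  exact ⟨a, ha.symm, by omega⟩

end Tree

/-- The `1`-skeleton of the model wall-tree over `T`, together with that of its translate. -/
def wallGraph {W : Type w} (T : SimpleGraph W) : SimpleGraph (W × ℤ) where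
  Adj a b := (a.1 = b.1 ∧ (b.2 = a.2 + 2 ∨ a.2 = b.2 + 2)) ∨
    (T.Adj a.1 b.1 ∧ (b.2 = a.2 + 1 ∨ a.2 = b.2 + 1))
  symm := ⟨by
    rintro a b (⟨h, h'⟩ | ⟨h, h'⟩)
    · exact Or.inl ⟨h.symm, h'.symm⟩
    · exact Or.inr ⟨h.symm, h'.symm⟩⟩
  loopless := ⟨by
    rintro a (⟨h, h'⟩ | ⟨h, h'⟩)
    · omega
    · exact h.ne rfl⟩

section WallGraph

variable {W : Type w} {T : SimpleGraph W}

theorem wallGraph_adj {a b : W × ℤ} : (wallGraph T).Adj a b ↔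
    (a.1 = b.1 ∧ (b.2 = a.2 + 2 ∨ a.2 = b.2 + 2)) ∨
    (T.Adj a.1 b.1 ∧ (b.2 = a.2 + 1 ∨ a.2 = b.2 + 1)) := Iff.rfl

theorem wallGraph_adj_vertical {z : W} {m n : ℤ} (h : n = m + 2 ∨ m = n + 2) :
    (wallGraph T).Adj (z, m) (z, n) := Or.inl ⟨rfl, h⟩

theorem wallGraph_adj_transverse {z z' : W} {m n : ℤ} (hz : T.Adj z z')
    (h : n = m + 1 ∨ m = n + 1) : (wallGraph T).Adj (z, m) (z', n) := Or.inr ⟨hz, h⟩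

/-- The height modulo `3` is a proper colouring, as edges change the height by one or two. -/
theorem wallGraph_color {a b : W × ℤ} (h : (wallGraph T).Adj a b) : ¬ (3 : ℤ) ∣ a.2 - b.2 := by
  rw [wallGraph_adj] at h
  omega

theorem wallGraph_neighbor {y b : W × ℤ} (h : (wallGraph T).Adj y b) :
    (b.1 = y.1 ∧ (b.2 = y.2 + 2 ∨ b.2 = y.2 - 2)) ∨
    (b.1 ≠ y.1 ∧ T.Adj y.1 b.1 ∧ (b.2 = y.2 + 1 ∨ b.2 = y.2 - 1)) := by
  rcases h with ⟨h, h'⟩ | ⟨h, h'⟩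
  · exact Or.inl ⟨h.symm, by omega⟩
  · exact Or.inr ⟨h.ne.symm, h, by omega⟩

/-- The link of `y` has two poles, the vertices above and below `y` in its fibre. Each neighbouring
fibre contributes an arc of length three between the poles, passing through its two vertices
adjacent to `y`. -/
theorem wallGraph_link_adj (hT : T.IsTree) {y b x : W × ℤ} (hb : (wallGraph T).Adj y b)
    (hx : (wallGraph T).Adj y x) : (wallGraph T).Adj b x ↔
      (b.1 = y.1 ∧ x.1 ≠ y.1 ∧ b.2 - y.2 = 2 * (x.2 - y.2)) ∨
      (b.1 ≠ y.1 ∧ x.1 = y.1 ∧ x.2 - y.2 = 2 * (b.2 - y.2)) ∨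
      (b.1 ≠ y.1 ∧ b.1 = x.1 ∧ b.2 + x.2 = 2 * y.2) := by
  rcases wallGraph_neighbor hb with ⟨h1, h2⟩ | ⟨h1, h1', h2⟩ <;>
    rcases wallGraph_neighbor hx with ⟨h3, h4⟩ | ⟨h3, h3', h4⟩
  · simp only [wallGraph_adj, h1, h3, SimpleGraph.irrefl, ne_eq, not_true_eq_false, false_and,
      and_false, or_false, true_and, iff_false]
    omega
  · simp only [wallGraph_adj, h1, h3, h3', ne_eq, not_true_eq_false, not_false_eq_true, false_and,
      or_false, true_and, h3.symm, false_or]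
    omega
  · simp only [wallGraph_adj, h1, h3, h1'.symm, ne_eq, not_true_eq_false, not_false_eq_true,
      false_and, and_false, or_false, true_and, false_or]
    omega
  · have := tree_not_adj hT h1' h3'
    by_cases hbx : b.1 = x.1
    · simp only [wallGraph_adj, hbx, SimpleGraph.irrefl, h3, ne_eq, not_false_eq_true, false_and,
        and_false, or_false, true_and, false_or]
      omega
    · simp [wallGraph_adj, hbx, h1, h3, this]

theorem wallGraph_exists_join {y b c : W × ℤ} (hb : (wallGraph T).Adj y b)
    (hc : (wallGraph T).Adj y c) (hne : b ≠ c) (h3 : (3 : ℤ) ∣ b.2 - c.2) :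
    ∃ x, (wallGraph T).Adj x y ∧ (wallGraph T).Adj x b ∧ (wallGraph T).Adj x c := by
  obtain ⟨z, n⟩ := y
  obtain ⟨z1, b⟩ := b
  obtain ⟨z2, c⟩ := c
  rcases wallGraph_neighbor hb with ⟨h1, h2⟩ | ⟨h1, h1', h2⟩ <;>
    rcases wallGraph_neighbor hc with ⟨h3, h4⟩ | ⟨h3, h3', h4⟩ <;> dsimp only at *
  · subst h1 h3
    exfalso
    apply hne
    rw [Prod.mk.injEq]
    exact ⟨rfl, by omega⟩
  · subst h1
    refine ⟨(z2, n + (n - c)), ?_⟩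
    simp only [wallGraph_adj, h3'.symm, h3, false_and, true_and, false_or, or_true, true_or]
    omega
  · subst h3
    refine ⟨(z1, n + (n - b)), ?_⟩
    simp only [wallGraph_adj, h1'.symm, h1, false_and, true_and, false_or, or_true, true_or]
    omega
  · refine ⟨(z, n + 2 * (b - n)), ?_⟩
    simp only [wallGraph_adj, h1', h3', h1.symm, h3.symm, false_and, true_and, false_or, or_true,
      true_or, SimpleGraph.irrefl, or_false]
    omega

theorem wallGraph_join_unique (hT : T.IsTree) {y b c x x' : W × ℤ} (hb : (wallGraph T).Adj y b)
    (hc : (wallGraph T).Adj y c) (hne : b ≠ c)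
    (hxy : (wallGraph T).Adj x y) (hxb : (wallGraph T).Adj x b) (hxc : (wallGraph T).Adj x c)
    (hxy' : (wallGraph T).Adj x' y) (hxb' : (wallGraph T).Adj x' b)
    (hxc' : (wallGraph T).Adj x' c) : x = x' := by
  rw [wallGraph_link_adj hT hxy.symm hb] at hxb
  rw [wallGraph_link_adj hT hxy.symm hc] at hxc
  rw [wallGraph_link_adj hT hxy'.symm hb] at hxb'
  rw [wallGraph_link_adj hT hxy'.symm hc] at hxc'
  have k1 := wallGraph_neighbor hb
  have k2 := wallGraph_neighbor hc
  have k3 := wallGraph_neighbor hxy.symm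
  have k4 := wallGraph_neighbor hxy'.symm
  rw [Ne, Prod.ext_iff] at hne
  rw [Prod.ext_iff]
  grind

end WallGraph
end BuildingSymmetry

/-! ### Good maps and their extension by one vertex -/

namespace BuildingSymmetry

/-- A map on a set `D` of vertices of the wall-tree that is, in the neighbourhood of every vertex
of `D`, an embedding of graphs compatible with the colourings. -/
structure IsGood {V : Type u} {W : Type w} (T : SimpleGraph W) (G : SimpleGraph V) (τ : V → ZMod 3)
    (D : Set (W × ℤ)) (g : W × ℤ → V) : Prop where
  adj : ∀ {a b}, a ∈ D → b ∈ D → (wallGraph T).Adj a b → G.Adj (g a) (g b)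
  -- Only the partition by colour is prescribed, because an isometry may permute the colours.
  color : ∀ {y b c}, y ∈ D → b ∈ D → c ∈ D → (wallGraph T).Adj y b → (wallGraph T).Adj y c →
    (τ (g b) = τ (g c) ↔ (3 : ℤ) ∣ b.2 - c.2)
  inj : ∀ {y b c}, y ∈ D → b ∈ D → c ∈ D → (wallGraph T).Adj y b → (wallGraph T).Adj y c →
    g b = g c → b = c
  induced : ∀ {y b c}, y ∈ D → b ∈ D → c ∈ D → (wallGraph T).Adj y b → (wallGraph T).Adj y c →
    G.Adj (g b) (g c) → (wallGraph T).Adj b c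

variable {V : Type u} {W : Type w} {T : SimpleGraph W} {G : SimpleGraph V} {τ : V → ZMod 3} {q : ℕ}
  {D M : Set (W × ℤ)} {g h : W × ℤ → V}

namespace IsGood

theorem mono (hg : IsGood T G τ D g) (hMD : M ⊆ D) : IsGood T G τ M g :=
  ⟨fun ha hb => hg.adj (hMD ha) (hMD hb), fun hy hb hc => hg.color (hMD hy) (hMD hb) (hMD hc),
    fun hy hb hc => hg.inj (hMD hy) (hMD hb) (hMD hc),
    fun hy hb hc => hg.induced (hMD hy) (hMD hb) (hMD hc)⟩

theorem congr (hg : IsGood T G τ D g) (hgh : Set.EqOn g h D) : IsGood T G τ D h := by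
  constructor
  · intro a b ha hb
    rw [← hgh ha, ← hgh hb]
    exact hg.adj ha hb
  all_goals
    intro y b c hy hb hc
    rw [← hgh hb, ← hgh hc]
  exacts [hg.color hy hb hc, hg.inj hy hb hc, hg.induced hy hb hc]

theorem insert_vertex {v : W × ℤ} (hg : IsGood T G τ M g)
    (hadj : ∀ y ∈ M, (wallGraph T).Adj v y → G.Adj (g v) (g y))
    (hcenter : ∀ b ∈ M, ∀ c ∈ M, (wallGraph T).Adj v b → (wallGraph T).Adj v c → b ≠ c →
      (τ (g b) = τ (g c) ↔ (3 : ℤ) ∣ b.2 - c.2) ∧ g b ≠ g c ∧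
      (G.Adj (g b) (g c) → (wallGraph T).Adj b c))
    (hstar : ∀ y ∈ M, (wallGraph T).Adj v y → ∀ c ∈ M, (wallGraph T).Adj y c →
      (τ (g v) = τ (g c) ↔ (3 : ℤ) ∣ v.2 - c.2) ∧ g v ≠ g c ∧
      (G.Adj (g v) (g c) → (wallGraph T).Adj v c)) :
    IsGood T G τ (insert v M) g := by
  have all : ∀ {y b c}, y ∈ insert v M → b ∈ insert v M → c ∈ insert v M →
      (wallGraph T).Adj y b → (wallGraph T).Adj y c →
      (τ (g b) = τ (g c) ↔ (3 : ℤ) ∣ b.2 - c.2) ∧ (g b = g c → b = c) ∧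
      (G.Adj (g b) (g c) → (wallGraph T).Adj b c) := by
    intro y b c hy hb hc hyb hyc
    by_cases hbc : b = c
    · subst hbc
      simp
    rcases hy with rfl | hy
    · have hb := hb.resolve_left hyb.ne.symm
      have hc := hc.resolve_left hyc.ne.symm
      obtain ⟨h1, h2, h3⟩ := hcenter b hb c hc hyb hyc hbc
      exact ⟨h1, fun h => absurd h h2, h3⟩
    · rcases hb with rfl | hb
      · have hc := hc.resolve_left (Ne.symm hbc)
        obtain ⟨h1, h2, h3⟩ := hstar y hy hyb.symm c hc hyc
        exact ⟨h1, fun h => absurd h h2, h3⟩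
      · rcases hc with rfl | hc
        · obtain ⟨h1, h2, h3⟩ := hstar y hy hyc.symm b hb hyb
          refine ⟨?_, fun h => absurd h.symm h2, fun h => (h3 h.symm).symm⟩
          rw [eq_comm, h1]
          omega
        · exact ⟨hg.color hy hb hc hyb hyc, hg.inj hy hb hc hyb hyc, hg.induced hy hb hc hyb hyc⟩
  constructor
  · rintro a b (rfl | ha) (rfl | hb) hab
    · exact absurd rfl hab.ne
    · exact hadj b hb hab
    · exact (hadj a ha hab.symm).symm
    · exact hg.adj ha hb hab
  · exact fun hy hb hc h1 h2 => (all hy hb hc h1 h2).1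
  · exact fun hy hb hc h1 h2 => (all hy hb hc h1 h2).2.1
  · exact fun hy hb hc h1 h2 => (all hy hb hc h1 h2).2.2

end IsGood

/-- Every vertex of `M` opposite to `v` in the link of a neighbour `y` of `v` is joined in the
link, within `M`, to a common neighbour of `v` and `y`. -/
def LinksJoined (T : SimpleGraph W) (M : Set (W × ℤ)) (v : W × ℤ) : Prop :=
  ∀ y ∈ M, (wallGraph T).Adj v y → ∀ c ∈ M, (wallGraph T).Adj y c → ¬ (wallGraph T).Adj v c →
    ¬ (3 : ℤ) ∣ v.2 - c.2 → ∃ y' ∈ M, ∃ x ∈ M, (wallGraph T).Adj v y' ∧ (wallGraph T).Adj y y' ∧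
      (wallGraph T).Adj x y ∧ (wallGraph T).Adj x c ∧ (wallGraph T).Adj x y'

/-- Around an old neighbour `y` of `v` it suffices that the image of `v` be new among the apexes of
`hnew`. Colours are fixed by a common neighbour `y'`; a coincidence of `g v` with `g c` would make
`c` such an apex; an unwanted adjacency to `g c` would make `g v` the join of `g c` and `g y'`,
which is the image of the old vertex `x` supplied by `LinksJoined`. -/
theorem IsGood.insert_of_linksJoined (hG : IsBuildingGraph G τ) {v : W × ℤ}
    (hg : IsGood T G τ M g) (hlink : LinksJoined T M v)
    (hadj : ∀ y ∈ M, (wallGraph T).Adj v y → G.Adj (g v) (g y))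
    (hcenter : ∀ b ∈ M, ∀ c ∈ M, (wallGraph T).Adj v b → (wallGraph T).Adj v c → b ≠ c →
      (τ (g b) = τ (g c) ↔ (3 : ℤ) ∣ b.2 - c.2) ∧ g b ≠ g c ∧
      (G.Adj (g b) (g c) → (wallGraph T).Adj b c))
    (hex : ∀ y ∈ M, (wallGraph T).Adj v y → ∃ y' ∈ M, (wallGraph T).Adj v y' ∧
      (wallGraph T).Adj y y')
    (hnew : ∀ y ∈ M, ∀ y' ∈ M, ∀ x ∈ M, (wallGraph T).Adj v y → (wallGraph T).Adj v y' →
      (wallGraph T).Adj y y' → (wallGraph T).Adj x y → (wallGraph T).Adj x y' → g x ≠ g v) :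
    IsGood T G τ (insert v M) g := by
  refine hg.insert_vertex hadj hcenter ?_
  intro y hy hvy c hc hyc
  obtain ⟨y', hy', hvy', hyy'⟩ := hex y hy hvy
  have c1 := wallGraph_color hvy
  have c2 := wallGraph_color hvy'
  have c3 := wallGraph_color hyy'
  have c4 := wallGraph_color hyc
  have g1 := hadj y hy hvy
  have g2 := hadj y' hy' hvy'
  have g3 := hg.adj hy hc hyc
  have g4 := hg.adj hy hy' hyy'
  have hcol : τ (g v) = τ (g c) ↔ (3 : ℤ) ∣ v.2 - c.2 := by
    have e := hg.color hy hc hy' hyc hyy'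
    constructor
    · intro h
      have : ¬ (3 : ℤ) ∣ c.2 - y'.2 := by
        rw [← e, ← h]
        exact hG.color g2
      omega
    · intro h
      have : ¬ (3 : ℤ) ∣ c.2 - y'.2 := by omega
      rw [← e] at this
      exact hG.color_eq_of_ne g4 g1.symm g3 (hG.color g2).symm (Ne.symm this)
  refine ⟨hcol, ?_, ?_⟩
  · intro h
    rw [h] at g2
    have := hg.induced hy hc hy' hyc hyy' g2
    exact hnew y hy y' hy' c hc hvy hvy' hyy' hyc.symm this h.symm
  · intro h
    by_contra hn
    have hc3 : ¬ (3 : ℤ) ∣ v.2 - c.2 := by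
      rw [← hcol]
      exact hG.color h
    obtain ⟨y', hy', x, hx, k1, k2, k3, k4, k5⟩ := hlink y hy hvy c hc hyc hn hc3
    have c2 := wallGraph_color k1
    have c3 := wallGraph_color k2
    have e := (hg.color hy hc hy' hyc k2).2 (by omega)
    have hne : g c ≠ g y' := fun h => hn (hg.inj hy hc hy' hyc k2 h ▸ k1)
    exact hnew y hy y' hy' x hx hvy k1 k2 k3 k5 (hG.join_unique g3 hne e (hg.adj hx hy k3)
      (hg.adj hx hc k4) (hg.adj hx hy' k5) g1 h (hadj y' hy' k1))

/-- Every good map on `D₀` has the same finite positive number of extensions to a good map on `D`;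
maps on `D` are normalized to take the value `v₀` outside of `D`. -/
def UniformExtension (T : SimpleGraph W) (G : SimpleGraph V) (τ : V → ZMod 3) (v₀ : V)
    (D₀ D : Set (W × ℤ)) : Prop :=
  ∃ N : ℕ, 0 < N ∧ ∀ g, IsGood T G τ D₀ g →
    {h | IsGood T G τ D h ∧ Set.EqOn h g D₀ ∧ ∀ x, x ∉ D → h x = v₀}.encard = N

variable {v₀ : V}

theorem UniformExtension.refl (D : Set (W × ℤ)) : UniformExtension T G τ v₀ D D := by
  classical
  refine ⟨1, one_pos, fun g hg => ?_⟩
  have : {h | IsGood T G τ D h ∧ Set.EqOn h g D ∧ ∀ x, x ∉ D → h x = v₀} =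
      {fun x => if x ∈ D then g x else v₀} := by
    ext h
    simp only [Set.mem_ofPred_eq, Set.mem_singleton_iff]
    constructor
    · rintro ⟨-, h1, h2⟩
      funext x
      by_cases hx : x ∈ D
      · simp [hx, h1 hx]
      · simp [hx, h2 x hx]
    · rintro rfl
      refine ⟨hg.congr fun x hx => by simp [hx], fun x hx => by simp [hx], fun x hx => by simp [hx]⟩
  rw [this, Set.encard_singleton]
  rfl

/-- Each extension to `D₂` lies over exactly one normalized extension to `D₁`, so the two counts
multiply. -/
theorem UniformExtension.trans {D₀ D₁ D₂ : Set (W × ℤ)} (h₀₁ : D₀ ⊆ D₁) (h₁₂ : D₁ ⊆ D₂)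
    (h : UniformExtension T G τ v₀ D₀ D₁) (h' : UniformExtension T G τ v₀ D₁ D₂) :
    UniformExtension T G τ v₀ D₀ D₂ := by
  classical
  obtain ⟨N, hN, h⟩ := h
  obtain ⟨N', hN', h'⟩ := h'
  refine ⟨N * N', Nat.mul_pos hN hN', fun g hg => ?_⟩
  have h1 := h g hg
  set A := {h | IsGood T G τ D₁ h ∧ Set.EqOn h g D₀ ∧ ∀ x, x ∉ D₁ → h x = v₀} with hA
  have hAfin : A.Finite := Set.finite_of_encard_eq_coe h1
  have hBfin : ∀ k, ∃ F : Finset (W × ℤ → V), k ∈ A → F.card = N' ∧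
      (F : Set _) = {h | IsGood T G τ D₂ h ∧ Set.EqOn h k D₁ ∧ ∀ x, x ∉ D₂ → h x = v₀} := by
    intro k
    by_cases hk : k ∈ A
    · have hk2 := h' k hk.1
      have hf := Set.finite_of_encard_eq_coe hk2
      refine ⟨hf.toFinset, fun _ => ⟨?_, by simp⟩⟩
      rw [hf.encard_eq_coe_toFinset_card] at hk2
      exact_mod_cast hk2
    · exact ⟨∅, fun h => absurd h hk⟩
  choose F hF using hBfin
  have memF : ∀ {k h}, k ∈ A → (h ∈ F k ↔
      IsGood T G τ D₂ h ∧ Set.EqOn h k D₁ ∧ ∀ x, x ∉ D₂ → h x = v₀) := by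
    intro k h hk
    rw [← Finset.mem_coe, (hF k hk).2]
    rfl
  have hset : {h | IsGood T G τ D₂ h ∧ Set.EqOn h g D₀ ∧ ∀ x, x ∉ D₂ → h x = v₀} =
      (hAfin.toFinset.biUnion F : Finset _) := by
    ext h
    simp only [Set.mem_ofPred_eq, Finset.coe_biUnion, Set.mem_iUnion, Finset.mem_coe,
      Set.Finite.mem_toFinset, exists_prop]
    constructor
    · rintro ⟨h1, h2, h3⟩
      have e : Set.EqOn h (fun x => if x ∈ D₁ then h x else v₀) D₁ := fun x hx => by simp [hx]
      have hk : (fun x => if x ∈ D₁ then h x else v₀) ∈ A :=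
        ⟨(h1.mono h₁₂).congr e, fun x hx => by simp [h₀₁ hx, h2 hx], fun x hx => by simp [hx]⟩
      exact ⟨_, hk, (memF hk).2 ⟨h1, e, h3⟩⟩
    · rintro ⟨k, hk, hh⟩
      rw [memF hk] at hh
      exact ⟨hh.1, fun x hx => (hh.2.1 (h₀₁ hx)).trans (hk.2.1 hx), hh.2.2⟩
  rw [hset, Set.encard_coe_eq_coe_finsetCard, Finset.card_biUnion]
  · rw [Finset.sum_congr rfl fun k hk => (hF k (by simpa using hk)).1, Finset.sum_const,
      smul_eq_mul]
    rw [hAfin.encard_eq_coe_toFinset_card] at h1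
    have h1' : hAfin.toFinset.card = N := by exact_mod_cast h1
    rw [h1']
  · intro k hk k' hk' hne
    rw [Finset.mem_coe, Set.Finite.mem_toFinset] at hk hk'
    rw [Function.onFun, Finset.disjoint_left]
    intro h hh hh'
    rw [memF hk] at hh
    rw [memF hk'] at hh'
    apply hne
    funext x
    by_cases hx : x ∈ D₁
    · rw [← hh.2.1 hx, ← hh'.2.1 hx]
    · rw [hk.2.2 x hx, hk'.2.2 x hx]

-- An extension is determined by its value at `v`, so counting admissible values suffices.
open Classical in
theorem UniformExtension.insert_vertex {v : W × ℤ} (hv : v ∉ M) {N : ℕ} (hN : 0 < N)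
    (h : ∀ g, IsGood T G τ M g →
      {x | IsGood T G τ (insert v M) (Function.update g v x)}.encard = N) :
    UniformExtension T G τ v₀ M (insert v M) := by
  refine ⟨N, hN, fun g hg => ?_⟩
  set k : W × ℤ → V := fun x => if x ∈ M then g x else v₀ with hk
  have hkM : ∀ x ∈ M, k x = g x := fun x hx => by simp [hk, hx]
  have hk' : ∀ x, x ∉ M → k x = v₀ := fun x hx => by simp [hk, hx]
  have hgk : IsGood T G τ M k := hg.congr fun x hx => (hkM x hx).symm
  rw [← h k hgk]
  have : {h | IsGood T G τ (insert v M) h ∧ Set.EqOn h g M ∧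
      ∀ x, x ∉ insert v M → h x = v₀} =
      Function.update k v '' {x | IsGood T G τ (insert v M) (Function.update k v x)} := by
    ext h
    constructor
    · rintro ⟨h1, h2, h3⟩
      have e : Function.update k v (h v) = h := by
        funext x
        by_cases hx : x = v
        · subst hx
          simp
        · rw [Function.update_of_ne hx]
          by_cases hxM : x ∈ M
          · rw [hkM x hxM, h2 hxM]
          · rw [hk' x hxM, h3 x (by simp [hx, hxM])]
      exact ⟨h v, by rw [Set.mem_ofPred_eq, e]; exact h1, e⟩
    · rintro ⟨x, hx, rfl⟩
      refine ⟨hx, fun y hy => ?_, fun y hy => ?_⟩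
      · rw [Function.update_of_ne (ne_of_mem_of_not_mem hy hv), hkM y hy]
      · rw [Set.mem_insert_iff, not_or] at hy
        rw [Function.update_of_ne hy.1, hk' y hy.2]
  rw [this, (Function.update_injective k v).encard_image]

theorem eqOn_update [DecidableEq (W × ℤ)] {v : W × ℤ} (hv : v ∉ M) (x : V) :
    Set.EqOn g (Function.update g v x) M :=
  fun _ hy => (Function.update_of_ne (ne_of_mem_of_not_mem hy hv) _ _).symm

/-- Adding a vertex with only one, isolated, neighbour. -/
theorem UniformExtension.insert_isolated (hG : IsRegularBuildingGraph G τ q) {v y : W × ℤ}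
    (hv : v ∉ M) (hy : y ∈ M) (hvM : ∀ u ∈ M, (wallGraph T).Adj v u ↔ u = y)
    (hyM : ∀ u ∈ M, ¬ (wallGraph T).Adj y u) : UniformExtension T G τ v₀ M (insert v M) := by
  classical
  refine UniformExtension.insert_vertex hv (N := 2 * (q ^ 2 + q + 1)) (by positivity) fun g hg => ?_
  rw [← hG.encard_neighborSet (g y)]
  congr 1
  ext x
  have hgood := hg.congr (eqOn_update (g := g) hv x)
  have ey : Function.update g v x y = g y := (eqOn_update hv x hy).symm
  constructor
  · intro h
    have := h.adj (a := y) (b := v) (by simp [hy]) (by simp) ((hvM y hy).2 rfl).symm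
    rwa [ey, Function.update_self] at this
  · intro h
    refine hgood.insert_vertex ?_ ?_ ?_
    · intro u hu hvu
      rw [(hvM u hu).1 hvu, ey, Function.update_self]
      exact SimpleGraph.Adj.symm h
    · intro b hb c hc hvb hvc hne
      exact absurd (((hvM b hb).1 hvb).trans ((hvM c hc).1 hvc).symm) hne
    · intro u hu hvu c hc huc
      rw [(hvM u hu).1 hvu] at huc
      exact absurd huc (hyM c hc)

/-- Adding a vertex opposite to the only neighbour of its only neighbour. -/
theorem UniformExtension.insert_opposite (hG : IsRegularBuildingGraph G τ q) {v y c : W × ℤ}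
    (hv : v ∉ M) (hy : y ∈ M) (hc : c ∈ M) (hvM : ∀ u ∈ M, (wallGraph T).Adj v u ↔ u = y)
    (hyM : ∀ u ∈ M, (wallGraph T).Adj y u ↔ u = c) (h3 : ¬ (3 : ℤ) ∣ v.2 - c.2) :
    UniformExtension T G τ v₀ M (insert v M) := by
  classical
  have hq := hG.two_le
  refine UniformExtension.insert_vertex hv (N := q ^ 2) (by positivity) fun g hg => ?_
  have hyc := (hyM c hc).2 rfl
  have hvy := (hvM y hy).2 rfl
  have hvc : ¬ (wallGraph T).Adj v c := fun h => hyc.ne ((hvM c hc).1 h).symm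
  rw [← hG.encard_opposite (hg.adj hy hc hyc)]
  congr 1
  ext x
  have hgood := hg.congr (eqOn_update (g := g) hv x)
  have ey : Function.update g v x y = g y := (eqOn_update hv x hy).symm
  have ec : Function.update g v x c = g c := (eqOn_update hv x hc).symm
  have ev : Function.update g v x v = x := Function.update_self ..
  constructor
  · intro h
    have h1 := h.adj (a := y) (b := v) (by simp [hy]) (by simp) hvy.symm
    have h2 := h.color (y := y) (b := v) (c := c) (by simp [hy]) (by simp) (by simp [hc])
      hvy.symm hyc
    have h4 := h.induced (y := y) (b := v) (c := c) (by simp [hy]) (by simp) (by simp [hc])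
      hvy.symm hyc
    rw [ey, ev] at h1
    rw [ev, ec] at h2 h4
    exact ⟨h1, fun e => h3 (h2.1 e), fun e => hvc (h4 e)⟩
  · rintro ⟨h1, h2, h4⟩
    refine hgood.insert_vertex ?_ ?_ ?_
    · intro u hu hvu
      rw [(hvM u hu).1 hvu, ey, ev]
      exact h1.symm
    · intro b hb c hc hvb hvc hne
      exact absurd (((hvM b hb).1 hvb).trans ((hvM c hc).1 hvc).symm) hne
    · intro u hu hvu d hd hud
      rw [(hvM u hu).1 hvu] at hud
      rw [(hyM d hd).1 hud, ev, ec]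
      exact ⟨⟨fun e => absurd e h2, fun e => absurd e h3⟩, fun e => h2 (by rw [e]),
        fun e => absurd e h4⟩

/-- Adding a vertex that spans a triangle with an edge. -/
theorem UniformExtension.insert_edge (hG : IsRegularBuildingGraph G τ q)
    (hdeg : ∀ {y y'}, (wallGraph T).Adj y y' →
      ((wallGraph T).commonNeighbors y y').encard ≤ ((q + 1 : ℕ) : ℕ∞)) {v y y' : W × ℤ}
    (hv : v ∉ M) (hy : y ∈ M) (hy' : y' ∈ M) (hyy' : (wallGraph T).Adj y y')
    (hvM : ∀ u ∈ M, (wallGraph T).Adj v u ↔ u = y ∨ u = y') (hlink : LinksJoined T M v) :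
    UniformExtension T G τ v₀ M (insert v M) := by
  classical
  have hvy := (hvM y hy).2 (Or.inl rfl)
  have hvy' := (hvM y' hy').2 (Or.inr rfl)
  -- These apexes of the edge are already placed. As `v` is a further apex, there are fewer than `q
  -- + 1` of them and the number of free images is positive.
  set C := (wallGraph T).commonNeighbors y y' ∩ M with hC
  have hCfin : ((wallGraph T).commonNeighbors y y').Finite :=
    Set.finite_of_encard_le_coe (hdeg hyy')
  have hCf : C.Finite := hCfin.subset Set.inter_subset_left
  have hlt : C.ncard < q + 1 := by
    have h1 : C ⊂ (wallGraph T).commonNeighbors y y' := by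
      refine ⟨Set.inter_subset_left, fun h => ?_⟩
      exact hv (h (⟨hvy.symm, hvy'.symm⟩ : v ∈ (wallGraph T).commonNeighbors y y')).2
    have h2 := Set.ncard_lt_ncard h1 hCfin
    have h3 := hdeg hyy'
    rw [← hCfin.cast_ncard_eq] at h3
    have : ((wallGraph T).commonNeighbors y y').ncard ≤ q + 1 := by exact_mod_cast h3
    omega
  refine UniformExtension.insert_vertex hv (N := q + 1 - C.ncard) (by omega) fun g hg => ?_
  have hgy := hg.adj hy hy' hyy'
  have hinj : Set.InjOn g C := fun a ha b hb hab => hg.inj hy ha.2 hb.2 ha.1.1 hb.1.1 hab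
  have hsub : g '' C ⊆ G.commonNeighbors (g y) (g y') := by
    rintro _ ⟨a, ha, rfl⟩
    exact ⟨hg.adj hy ha.2 ha.1.1, hg.adj hy' ha.2 ha.1.2⟩
  have hcount : (G.commonNeighbors (g y) (g y') \ (g '' C)).encard =
      ((q + 1 - C.ncard : ℕ) : ℕ∞) := by
    have h1 := Set.encard_sdiff_add_encard_of_subset hsub
    rw [hG.encard_common hgy, hinj.encard_image, ← hCf.cast_ncard_eq] at h1
    have hfin : (G.commonNeighbors (g y) (g y') \ (g '' C)).Finite :=
      (Set.finite_of_encard_eq_coe (hG.encard_common hgy)).subset Set.sdiff_subset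
    rw [← hfin.cast_ncard_eq] at h1 ⊢
    norm_cast at h1 ⊢
    omega
  rw [← hcount]
  congr 1
  ext x
  have hgood := hg.congr (eqOn_update (g := g) hv x)
  have eM : ∀ u ∈ M, Function.update g v x u = g u := fun u hu => (eqOn_update hv x hu).symm
  have ev : Function.update g v x v = x := Function.update_self ..
  constructor
  · intro h
    have h1 := h.adj (a := y) (b := v) (by simp [hy]) (by simp) hvy.symm
    have h2 := h.adj (a := y') (b := v) (by simp [hy']) (by simp) hvy'.symm
    rw [eM y hy, ev] at h1
    rw [eM y' hy', ev] at h2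
    refine ⟨⟨h1, h2⟩, ?_⟩
    rintro ⟨c, hc, hcx⟩
    have h3 := h.inj (y := y) (b := v) (c := c) (by simp [hy]) (by simp) (by simp [hc.2]) hvy.symm
      hc.1.1 (by rw [ev, eM c hc.2, hcx])
    exact hv (h3 ▸ hc.2)
  · rintro ⟨⟨h1, h2⟩, h3⟩
    refine hgood.insert_of_linksJoined hG.toIsBuildingGraph hlink ?_ ?_ ?_ ?_
    · intro u hu hvu
      rw [eM u hu, ev]
      rcases (hvM u hu).1 hvu with rfl | rfl
      exacts [SimpleGraph.Adj.symm h1, SimpleGraph.Adj.symm h2]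
    · intro b hb c hc hvb hvc hne
      rw [eM b hb, eM c hc]
      have hbc : (wallGraph T).Adj b c := by
        rcases (hvM b hb).1 hvb with rfl | rfl <;> rcases (hvM c hc).1 hvc with rfl | rfl
        · exact absurd rfl hne
        · exact hyy'
        · exact hyy'.symm
        · exact absurd rfl hne
      have := hg.adj hb hc hbc
      exact ⟨⟨fun e => absurd e (hG.color this), fun e => absurd e (wallGraph_color hbc)⟩, this.ne,
        fun _ => hbc⟩
    · intro u hu hvu
      rcases (hvM u hu).1 hvu with rfl | rfl
      · exact ⟨y', hy', hvy', hyy'⟩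
      · exact ⟨y, hy, hvy, hyy'.symm⟩
    · intro a ha b hb c hc hva hvb hab hca hcb
      rw [eM c hc, ev]
      rintro rfl
      refine h3 ⟨c, ⟨?_, hc⟩, rfl⟩
      rcases (hvM a ha).1 hva with rfl | rfl <;> rcases (hvM b hb).1 hvb with rfl | rfl
      · exact absurd rfl hab.ne
      · exact ⟨hca.symm, hcb.symm⟩
      · exact ⟨hcb.symm, hca.symm⟩
      · exact absurd rfl hab.ne

/-- Adding a vertex that is adjacent to a path of length two of its link. -/
theorem UniformExtension.insert_path (hT : T.IsTree) (hG : IsRegularBuildingGraph G τ q)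
    {v y₁ y₂ y₃ : W × ℤ} (hv : v ∉ M) (hy₁ : y₁ ∈ M) (hy₂ : y₂ ∈ M) (hy₃ : y₃ ∈ M)
    (h12 : (wallGraph T).Adj y₂ y₁) (h23 : (wallGraph T).Adj y₂ y₃) (hne : y₁ ≠ y₃)
    (hvM : ∀ u ∈ M, (wallGraph T).Adj v u ↔ u = y₁ ∨ u = y₂ ∨ u = y₃) (hlink : LinksJoined T M v) :
    UniformExtension T G τ v₀ M (insert v M) := by
  classical
  have hv1 := (hvM y₁ hy₁).2 (by simp)
  have hv2 := (hvM y₂ hy₂).2 (by simp)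
  have hv3 := (hvM y₃ hy₃).2 (by simp)
  have h3 : (3 : ℤ) ∣ y₁.2 - y₃.2 := by
    have := wallGraph_color hv1
    have := wallGraph_color hv2
    have := wallGraph_color hv3
    have := wallGraph_color h12
    have := wallGraph_color h23
    omega
  have h13 : ¬ (wallGraph T).Adj y₁ y₃ := fun h => wallGraph_color h h3
  refine UniformExtension.insert_vertex hv (N := 1) one_pos fun g hg => ?_
  have g12 := hg.adj hy₂ hy₁ h12
  have g23 := hg.adj hy₂ hy₃ h23
  have gne : g y₁ ≠ g y₃ := fun h => hne (hg.inj hy₂ hy₁ hy₃ h12 h23 h)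
  have gcol : τ (g y₁) = τ (g y₃) := (hg.color hy₂ hy₁ hy₃ h12 h23).2 h3
  -- The value at `v` is forced: it has to be the unique join of `g y₁` and `g y₃` in the link of `g
  -- y₂`.
  obtain ⟨x₀, k2, k1, k3⟩ := hG.exists_join g12 g23 gcol
  have : {x | IsGood T G τ (insert v M) (Function.update g v x)} = {x₀} := by
    ext x
    have hgood := hg.congr (eqOn_update (g := g) hv x)
    have eM : ∀ u ∈ M, Function.update g v x u = g u := fun u hu => (eqOn_update hv x hu).symm
    have ev : Function.update g v x v = x := Function.update_self ..
    constructor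
    · intro h
      have a : ∀ u ∈ M, (wallGraph T).Adj v u → G.Adj x (g u) := by
        intro u hu hvu
        have := h.adj (a := v) (b := u) (by simp) (by simp [hu]) hvu
        rwa [ev, eM u hu] at this
      exact hG.join_unique g12 gne gcol (a y₂ hy₂ hv2) (a y₁ hy₁ hv1) (a y₃ hy₃ hv3) k2 k1 k3
    · rintro rfl
      refine hgood.insert_of_linksJoined hG.toIsBuildingGraph hlink ?_ ?_ ?_ ?_
      · intro u hu hvu
        rw [eM u hu, ev]
        rcases (hvM u hu).1 hvu with rfl | rfl | rfl
        exacts [k1, k2, k3]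
      · intro b hb c hc hvb hvc hbc
        rw [eM b hb, eM c hc]
        by_cases hadj : (wallGraph T).Adj b c
        · have := hg.adj hb hc hadj
          exact ⟨⟨fun e => absurd e (hG.color this), fun e => absurd e (wallGraph_color hadj)⟩,
            this.ne, fun _ => hadj⟩
        · have hyb : (wallGraph T).Adj y₂ b ∧ (wallGraph T).Adj y₂ c := by
            rcases (hvM b hb).1 hvb with rfl | rfl | rfl <;>
              rcases (hvM c hc).1 hvc with rfl | rfl | rfl
            · exact absurd rfl hbc
            · exact absurd h12.symm hadj
            · exact ⟨h12, h23⟩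
            · exact absurd h12 hadj
            · exact absurd rfl hbc
            · exact absurd h23 hadj
            · exact ⟨h23, h12⟩
            · exact absurd h23.symm hadj
            · exact absurd rfl hbc
          exact ⟨hg.color hy₂ hb hc hyb.1 hyb.2, fun e => hbc (hg.inj hy₂ hb hc hyb.1 hyb.2 e),
            hg.induced hy₂ hb hc hyb.1 hyb.2⟩
      · intro u hu hvu
        rcases (hvM u hu).1 hvu with rfl | rfl | rfl
        · exact ⟨y₂, hy₂, hv2, h12.symm⟩
        · exact ⟨y₁, hy₁, hv1, h12⟩
        · exact ⟨y₂, hy₂, hv2, h23.symm⟩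
      -- An old vertex with the forced value would be adjacent to `y₁`, `y₂` and `y₃` because `g` is
      -- induced; joins being unique in the wall-tree, it would be `v`.
      · intro a ha b hb c hc hva hvb hab hca hcb e
        rw [eM c hc, ev] at e
        have hc2 : (wallGraph T).Adj c y₂ := by
          rcases (hvM a ha).1 hva with rfl | rfl | rfl
          · rcases (hvM b hb).1 hvb with rfl | rfl | rfl
            · exact absurd rfl hab.ne
            · exact hcb
            · exact absurd hab h13
          · exact hca
          · rcases (hvM b hb).1 hvb with rfl | rfl | rfl
            · exact absurd hab.symm h13
            · exact hcb
            · exact absurd rfl hab.ne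
        have c1 : (wallGraph T).Adj c y₁ := hg.induced hy₂ hc hy₁ hc2.symm h12 (by rw [e]; exact k1)
        have c3 : (wallGraph T).Adj c y₃ := hg.induced hy₂ hc hy₃ hc2.symm h23 (by rw [e]; exact k3)
        have := wallGraph_join_unique hT h12 h23 hne hv2 hv1 hv3 hc2 c1 c3
        exact hv (this ▸ hc)
  rw [this, Set.encard_singleton]
  rfl

end BuildingSymmetry

/-! ### Double cones, and attaching a fibre over a leaf -/

namespace BuildingSymmetry

variable {V : Type u} {W : Type w} {T : SimpleGraph W} {G : SimpleGraph V} {τ : V → ZMod 3} {q : ℕ}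
  {v₀ : V}

/-- Vertices can be added in the order of a rank function. -/
theorem UniformExtension.of_rank {Y Z : Set (W × ℤ)} (hYZ : Y ⊆ Z) (hfin : Z.Finite)
    (r : W × ℤ → ℤ)
    (h : ∀ M v, Y ⊆ M → M ⊆ Z → v ∈ Z → v ∉ M → (∀ u ∈ M, u ∉ Y → r u ≤ r v) →
      (∀ u ∈ Z, r u < r v → u ∈ M) → UniformExtension T G τ v₀ M (insert v M)) :
    UniformExtension T G τ v₀ Y Z := by
  have key : ∀ n M, Y ⊆ M → M ⊆ Z → (Z \ M).ncard = n →
      (∀ u ∈ M, u ∉ Y → ∀ x ∈ Z \ M, r u ≤ r x) → UniformExtension T G τ v₀ M Z := by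
    intro n
    induction n with
    | zero =>
      intro M h1 h2 h3 _
      rw [Set.ncard_eq_zero (hfin.subset Set.sdiff_subset), Set.sdiff_eq_empty] at h3
      rw [h2.antisymm h3]
      exact UniformExtension.refl Z
    | succ n ih =>
      intro M h1 h2 h3 h4
      have hne : (Z \ M).Nonempty := by
        rw [← Set.ncard_pos (hfin.subset Set.sdiff_subset)]
        omega
      obtain ⟨v, hv, hmin⟩ := Set.exists_min_image (Z \ M) r (hfin.subset Set.sdiff_subset) hne
      have hMv : insert v M ⊆ Z := Set.insert_subset hv.1 h2
      refine UniformExtension.trans (Set.subset_insert v M) hMv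
        (h M v h1 h2 hv.1 hv.2 (fun u hu huY => h4 u hu huY v hv) ?_)
        (ih _ (h1.trans (Set.subset_insert v M)) hMv ?_ ?_)
      · intro u hu hlt
        by_contra hn
        exact absurd (hmin u ⟨hu, hn⟩) (not_le.2 hlt)
      · have e : Z \ insert v M = (Z \ M) \ {v} := by
          ext x
          simp only [Set.mem_sdiff, Set.mem_insert_iff, Set.mem_singleton_iff]
          tauto
        rw [e, Set.ncard_sdiff_singleton_of_mem hv, h3]
        rfl
      · intro u hu huY x hx
        have hx' : x ∈ Z \ M := ⟨hx.1, fun e => hx.2 (Set.mem_insert_of_mem v e)⟩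
        rcases hu with rfl | hu
        · exact hmin x hx'
        · exact h4 u hu huY x hx'
  exact key _ Y subset_rfl hYZ rfl fun u hu hn => absurd hu hn

/-- A vertical edge has at most one apex over each neighbour of its base vertex; a transverse edge
has at most one over each of its two ends. -/
theorem encard_commonNeighbors_wallGraph_le (hT : T.IsTree) (hq : 1 ≤ q)
    (hdeg : ∀ z, (T.neighborSet z).encard = ((q + 1 : ℕ) : ℕ∞)) {y y' : W × ℤ}
    (h : (wallGraph T).Adj y y') :
    ((wallGraph T).commonNeighbors y y').encard ≤ ((q + 1 : ℕ) : ℕ∞) := by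
  by_cases hz : y'.1 = y.1
  · rw [← hdeg y.1]
    refine Set.encard_le_encard_of_injOn (f := Prod.fst) ?_ ?_
    · rintro x ⟨h1, h2⟩
      have h2' : (wallGraph T).Adj x y' := SimpleGraph.Adj.symm h2
      rw [wallGraph_link_adj hT h1 h] at h2'
      rcases wallGraph_neighbor (y := y) (b := x) h1 with k | k
      · grind
      · exact k.2.1
    · rintro x ⟨h1, h2⟩ x' ⟨h1', h2'⟩ e
      have k2 : (wallGraph T).Adj x y' := SimpleGraph.Adj.symm h2
      have k2' : (wallGraph T).Adj x' y' := SimpleGraph.Adj.symm h2'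
      rw [wallGraph_link_adj hT h1 h] at k2
      rw [wallGraph_link_adj hT h1' h] at k2'
      rw [Prod.ext_iff]
      grind
  · have : (wallGraph T).commonNeighbors y y' ⊆
        {(y.1, y.2 + 2 * (y'.2 - y.2)), (y'.1, 2 * y.2 - y'.2)} := by
      rintro x ⟨h1, h2⟩
      have h2' : (wallGraph T).Adj x y' := SimpleGraph.Adj.symm h2
      rw [wallGraph_link_adj hT h1 h] at h2'
      simp only [Set.mem_insert_iff, Set.mem_singleton_iff, Prod.ext_iff]
      grind
    calc _ ≤ _ := Set.encard_le_encard this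
      _ ≤ _ := Set.encard_insert_le _ _
      _ = ((2 : ℕ) : ℕ∞) := by rw [Set.encard_singleton]; rfl
      _ ≤ _ := by exact_mod_cast (by omega : 2 ≤ q + 1)

theorem tree_parity (hT : T.IsTree) (o p z : W) :
    (T.dist o z + T.dist o p + T.dist p z) % 2 = 0 := by
  obtain ⟨r⟩ := hT.connected.preconnected z p
  induction r with
  | nil => simp; omega
  | cons h r ih =>
    rename_i a b c
    have := tree_dist_adj hT o h
    have := tree_dist_adj hT c h
    omega

/-- The part over `S` of the intersection of the upper cone of `p` with the lower cone of `t` in the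
wall-tree over `T` with base point `o`. -/
def doubleCone (T : SimpleGraph W) (o : W) (S : Set W) (p t : W × ℤ) : Set (W × ℤ) :=
  {a | a.1 ∈ S ∧ (a.2 - T.dist o a.1) % 2 = 0 ∧ p.2 + T.dist p.1 a.1 ≤ a.2 ∧
    a.2 + T.dist t.1 a.1 ≤ t.2}

/-- `S` contains the geodesics between its members. -/
def TreeConvex (T : SimpleGraph W) (S : Set W) : Prop :=
  ∀ x ∈ S, ∀ z ∈ S, ∀ c, T.Adj z c → T.dist x c < T.dist x z → c ∈ S

/-- The data of a finite convex subset of the wall-tree. -/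
structure IsConeDatum (T : SimpleGraph W) (o : W) (S : Set W) (p t : W × ℤ) : Prop where
  finite : S.Finite
  convex : TreeConvex T S
  lower_mem : p.1 ∈ S
  upper_mem : t.1 ∈ S
  lower_even : (p.2 - T.dist o p.1) % 2 = 0
  upper_even : (t.2 - T.dist o t.1) % 2 = 0
  nonempty : ∀ z ∈ S, p.2 + T.dist p.1 z + T.dist t.1 z ≤ t.2

theorem TreeConvex.insert_adj (hT : T.IsTree) {S : Set W} (hS : TreeConvex T S) {z c : W} (hz : z ∈ S)
    (hzc : T.Adj z c) : TreeConvex T (insert c S) := by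
  by_cases hc : c ∈ S
  · rwa [Set.insert_eq_of_mem hc]
  have far : ∀ x ∈ S, T.dist x c = T.dist x z + 1 := by
    intro x hx
    rcases tree_dist_adj hT x hzc with h | h
    · exact h
    · exact absurd (hS x hx z hz c hzc (by omega)) hc
  intro x hx y hy d hyd hd
  rcases hx with rfl | hx <;> rcases hy with rfl | hy
  · simp at hd
  · by_cases hyz : y = z
    · subst hyz
      left
      have h1 : T.dist x y = 1 := SimpleGraph.dist_eq_one_iff_adj.2 hzc.symm
      have h0 : T.dist x d = 0 := by omega
      exact (hT.connected.dist_eq_zero_iff.1 h0).symm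
    · right
      obtain ⟨a, ha, hda⟩ := tree_exists_closer hT (Ne.symm hyz)
      have e := far y hy
      have haS := hS z hz y hy a ha (by omega)
      have e' := far a haS
      rw [SimpleGraph.dist_comm, SimpleGraph.dist_comm (v := z)] at e e'
      rwa [← tree_closer_unique hT ha hyd (x := x) (by omega) hd]
  · right
    have e := far x hx
    rwa [← tree_closer_unique hT hzc.symm hyd (x := x) (by omega) hd]
  · exact Or.inr (hS x hx y hy d hyd hd)

section

variable {o : W} {S : Set W} {p t : W × ℤ}

theorem IsConeDatum.doubleCone_finite (h : IsConeDatum T o S p t) :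
    (doubleCone T o S p t).Finite := by
  refine (h.finite.prod (Set.finite_Icc p.2 t.2)).subset ?_
  rintro a ⟨h1, -, h2, h3⟩
  exact ⟨h1, by omega, by omega⟩

theorem TreeConvex.dist_eq_of_notMem (hT : T.IsTree) (hS : TreeConvex T S) {x z c : W} (hx : x ∈ S)
    (hz : z ∈ S) (hzc : T.Adj z c) (hc : c ∉ S) : T.dist x c = T.dist x z + 1 := by
  rcases tree_dist_adj hT x hzc with h | h
  · exact h
  · exact absurd (hS x hx z hz c hzc (by omega)) hc

theorem TreeConvex.eq_of_adj_of_notMem (hT : T.IsTree) (hS : TreeConvex T S) {x z c : W}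
    (hx : x ∈ S) (hz : z ∈ S) (hzc : T.Adj z c) (hxc : T.Adj c x) (hc : c ∉ S) : x = z := by
  have h1 := hS.dist_eq_of_notMem hT hx hz hzc hc
  rw [SimpleGraph.dist_eq_one_iff_adj.2 hxc.symm] at h1
  exact hT.connected.dist_eq_zero_iff.1 (by omega)

/-- Attaching a strip over a new leaf of the base tree. -/
theorem UniformExtension.leaf (hT : T.IsTree) (hG : IsRegularBuildingGraph G τ q)
    (hdeg : ∀ z, (T.neighborSet z).encard = ((q + 1 : ℕ) : ℕ∞)) (h : IsConeDatum T o S p t)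
    {z c : W} (hz : z ∈ S) (hc : c ∉ S) (hzc : T.Adj z c)
    (hk : p.2 + T.dist p.1 z + 2 + T.dist t.1 z ≤ t.2) :
    IsConeDatum T o (insert c S) p t ∧ doubleCone T o S p t ⊆ doubleCone T o (insert c S) p t ∧
    UniformExtension T G τ v₀ (doubleCone T o S p t) (doubleCone T o (insert c S) p t) := by
  have hq := hG.two_le
  have dp := h.convex.dist_eq_of_notMem hT h.lower_mem hz hzc hc
  have dt := h.convex.dist_eq_of_notMem hT h.upper_mem hz hzc hc
  have hD : IsConeDatum T o (insert c S) p t := by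
    refine ⟨h.finite.insert c, h.convex.insert_adj hT hz hzc, Or.inr h.lower_mem, Or.inr h.upper_mem,
      h.lower_even, h.upper_even, ?_⟩
    rintro x (rfl | hx)
    · omega
    · exact h.nonempty x hx
  have hsub : doubleCone T o S p t ⊆ doubleCone T o (insert c S) p t :=
    fun a ha => ⟨Or.inr ha.1, ha.2⟩
  -- The new fibre is filled from the bottom upwards, so the rank is the height.
  refine ⟨hD, hsub, UniformExtension.of_rank hsub hD.doubleCone_finite Prod.snd ?_⟩
  intro M v hYM hMZ hv hvM hle hlt
  obtain ⟨x, m⟩ := v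
  obtain ⟨v1, v2, v3, v4⟩ := hv
  dsimp only at v1 v2 v3 v4 hle hlt
  have hx : x = c := by
    rcases v1 with h1 | h1
    · exact h1
    · exact absurd (hYM ⟨h1, v2, v3, v4⟩) hvM
  subst hx
  have pz := tree_dist_adj hT o hzc
  have memz : ∀ n : ℤ, (n = m - 1 ∨ n = m + 1 ∨ n = m - 3) → p.2 + T.dist p.1 z ≤ n → (z, n) ∈ M := by
    intro n hn hn'
    refine hYM ⟨hz, ?_, hn', ?_⟩ <;> dsimp only <;> omega
  have memS : ∀ {a : W × ℤ}, a ∈ M → a.1 ≠ x → a.1 ∈ S := fun {a} ha hax =>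
    (hMZ ha).1.resolve_left hax
  have hne : ∀ a ∈ M, T.Adj x a.1 → a.1 = z := by
    intro a ha hax
    exact h.convex.eq_of_adj_of_notMem hT (memS ha hax.ne.symm) hz hzc hax hc
  have mem1 := memz (m - 1) (by simp) (by omega)
  have mem2 := memz (m + 1) (by simp) (by omega)
  have hxz : x ≠ z := hzc.ne.symm
  have nbr : ∀ u ∈ M, (wallGraph T).Adj (x, m) u →
      u = (x, m - 2) ∨ u = (z, m - 1) ∨ u = (z, m + 1) := by
    rintro ⟨u1, u2⟩ hu hvu
    have hZ := (hMZ hu).2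
    dsimp only at hZ
    rcases wallGraph_neighbor hvu with ⟨k1, k2⟩ | ⟨k1, k2, k3⟩ <;> dsimp only at *
    · subst k1
      rcases k2 with k2 | k2
      · have := hle _ hu (fun e => hc e.1)
        dsimp only at this
        omega
      · left
        rw [k2]
    · have := hne _ hu k2
      dsimp only at this
      subst this
      rcases k3 with k3 | k3
      · right; right; rw [k3]
      · right; left; rw [k3]
  -- A vertex opposite to `v` lies two places below it in the new fibre, if `y` does too, or else
  -- over another branch at `z`. The connecting vertex is over `z` in the first case and over that
  -- branch in the second.
  have hlink : LinksJoined T M (x, m) := by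
    intro y hy hvy d hd hyd hvd h3
    have hnot := fun h => hvd (Or.inl h)
    have hnot' := fun h => hvd (Or.inr h)
    obtain ⟨d1, d2⟩ := d
    have hdZ := hMZ hd
    rcases nbr y hy hvy with rfl | rfl | rfl
    · rcases wallGraph_neighbor hyd with ⟨k1, k2⟩ | ⟨k1, k2, k3⟩ <;> dsimp only at *
      · subst k1
        rcases k2 with k2 | k2
        · omega
        · have := hdZ.2.2.1
          dsimp only at this
          refine ⟨(z, m - 1), mem1, (z, m - 3), memz _ (by simp) (by omega),
            wallGraph_adj_transverse hzc.symm (by omega), wallGraph_adj_transverse hzc.symm (by omega), wallGraph_adj_transverse hzc (by omega),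
            wallGraph_adj_transverse hzc (by omega), wallGraph_adj_vertical (by omega)⟩
      · have e := hne _ hd k2
        dsimp only at e
        exfalso
        rcases k3 with k3 | k3
        · exact hnot' ⟨k2, by omega⟩
        · omega
    · rcases wallGraph_neighbor hyd with ⟨k1, k2⟩ | ⟨k1, k2, k3⟩ <;> dsimp only at *
      · subst k1
        exfalso
        rcases k2 with k2 | k2
        · exact hnot' ⟨hzc.symm, by omega⟩
        · omega
      · by_cases hdx : d1 = x
        · exfalso
          rcases k3 with k3 | k3
          · omega
          · exact hnot ⟨hdx.symm, by omega⟩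
        · have k3 := k3.resolve_left (by omega)
          have hdS := memS hd hdx
          have tp := tree_dist_adj hT p.1 k2
          have tt := tree_dist_adj hT t.1 k2
          have tob := tree_dist_adj hT o k2
          have hZ := hdZ.2
          dsimp only at hZ hdS
          refine ⟨(z, m + 1), mem2, (d1, m), hYM ⟨hdS, ?_, ?_, ?_⟩, wallGraph_adj_transverse hzc.symm (by omega),
            wallGraph_adj_vertical (by omega),
            wallGraph_adj_transverse k2.symm (by omega),
            wallGraph_adj_vertical (by omega),
            wallGraph_adj_transverse k2.symm (by omega)⟩ <;>
            dsimp only <;> omega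
    · rcases wallGraph_neighbor hyd with ⟨k1, k2⟩ | ⟨k1, k2, k3⟩ <;> dsimp only at *
      · subst k1
        exfalso
        rcases k2 with k2 | k2
        · omega
        · exact hnot' ⟨hzc.symm, by omega⟩
      · by_cases hdx : d1 = x
        · exfalso
          rcases k3 with k3 | k3
          · exact hnot ⟨hdx.symm, by omega⟩
          · omega
        · have k3 := k3.resolve_right (by omega)
          have hdS := memS hd hdx
          have tp := tree_dist_adj hT p.1 k2
          have tt := tree_dist_adj hT t.1 k2
          have tob := tree_dist_adj hT o k2
          have hZ := hdZ.2
          dsimp only at hZ hdS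
          refine ⟨(z, m - 1), mem1, (d1, m), hYM ⟨hdS, ?_, ?_, ?_⟩, wallGraph_adj_transverse hzc.symm (by omega),
            wallGraph_adj_vertical (by omega),
            wallGraph_adj_transverse k2.symm (by omega),
            wallGraph_adj_vertical (by omega),
            wallGraph_adj_transverse k2.symm (by omega)⟩ <;>
            dsimp only <;> omega
  have a1 : (wallGraph T).Adj (x, m) (z, m - 1) := Or.inr ⟨hzc.symm, by dsimp only; omega⟩
  have a2 : (wallGraph T).Adj (x, m) (z, m + 1) := Or.inr ⟨hzc.symm, by dsimp only; omega⟩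
  have a3 : (wallGraph T).Adj (x, m) (x, m - 2) := Or.inl ⟨rfl, by dsimp only; omega⟩
  have a4 : (wallGraph T).Adj (z, m - 1) (z, m + 1) := Or.inl ⟨rfl, by dsimp only; omega⟩
  have a5 : (wallGraph T).Adj (z, m - 1) (x, m - 2) := Or.inr ⟨hzc, by dsimp only; omega⟩
  -- Only the lowest vertex of the fibre leaves a choice; each higher one also has a neighbour below
  -- it and is forced.
  by_cases hm : (x, m - 2) ∈ M
  · refine UniformExtension.insert_path hT hG hvM hm mem1 mem2 a5 a4 (fun e => hxz (congrArg Prod.fst e))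
      (fun u hu => ⟨nbr u hu, ?_⟩) hlink
    rintro (rfl | rfl | rfl)
    exacts [a3, a1, a2]
  · refine UniformExtension.insert_edge hG (encard_commonNeighbors_wallGraph_le hT (by omega) hdeg)
      hvM mem1 mem2 a4 (fun u hu => ⟨fun e => ?_, ?_⟩) hlink
    · rcases nbr u hu e with rfl | e
      · exact absurd hu hm
      · exact e
    · rintro (rfl | rfl)
      exacts [a1, a2]

end
end BuildingSymmetry

/-! ### Moving the lower vertex of a double cone -/

namespace BuildingSymmetry

variable {V : Type u} {W : Type w} {T : SimpleGraph W} {G : SimpleGraph V} {τ : V → ZMod 3} {q : ℕ}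
  {v₀ : V} {o : W} {S : Set W} {p t : W × ℤ}

/-- Moving the lower vertex of a double cone outwards from a fibre that consists of one vertex. -/
theorem UniformExtension.transverse (hT : T.IsTree) (hG : IsRegularBuildingGraph G τ q)
    (h : IsConeDatum T o S p t) {c : W} (hc : c ∉ S) (hpc : T.Adj p.1 c)
    (hk : p.2 + T.dist t.1 p.1 = t.2) :
    IsConeDatum T o (insert c S) (c, p.2 - 1) t ∧
    doubleCone T o S p t ⊆ doubleCone T o (insert c S) (c, p.2 - 1) t ∧
    UniformExtension T G τ v₀ (doubleCone T o S p t)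
      (doubleCone T o (insert c S) (c, p.2 - 1) t) := by
  have far : ∀ x ∈ S, T.dist c x = T.dist p.1 x + 1 := by
    intro x hx
    rw [SimpleGraph.dist_comm, h.convex.dist_eq_of_notMem hT hx h.lower_mem hpc hc,
      SimpleGraph.dist_comm]
  have hct : T.dist t.1 c = T.dist t.1 p.1 + 1 :=
    h.convex.dist_eq_of_notMem hT h.upper_mem h.lower_mem hpc hc
  have hoc := tree_dist_adj hT o hpc
  have hpe := h.lower_even
  have hD : IsConeDatum T o (insert c S) (c, p.2 - 1) t := by
    refine ⟨h.finite.insert c, h.convex.insert_adj hT h.lower_mem hpc, Or.inl rfl,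
      Or.inr h.upper_mem, by dsimp only; omega, h.upper_even, ?_⟩
    rintro x (rfl | hx)
    · simp only [SimpleGraph.dist_self]
      omega
    · have := far x hx
      have := h.nonempty x hx
      dsimp only
      omega
  -- On `S` the distance from `c` is one more than from `p.1`, which cancels the lower height of the
  -- new vertex; over `c` the two bounds meet in one height.
  have heq : doubleCone T o (insert c S) (c, p.2 - 1) t =
      insert (c, p.2 - 1) (doubleCone T o S p t) := by
    ext ⟨x, m⟩
    constructor
    · rintro ⟨h1, h2, h3, h4⟩
      dsimp only at h1 h2 h3 h4
      rcases h1 with rfl | h1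
      · left
        rw [Prod.mk.injEq]
        exact ⟨rfl, by omega⟩
      · right
        have := far x h1
        exact ⟨h1, h2, by dsimp only; omega, h4⟩
    · rintro (e | ⟨h1, h2, h3, h4⟩)
      · rw [Prod.mk.injEq] at e
        obtain ⟨rfl, rfl⟩ := e
        refine ⟨Or.inl rfl, by dsimp only; omega, by simp, by dsimp only; omega⟩
      · dsimp only at h1 h2 h3 h4
        have := far x h1
        exact ⟨Or.inr h1, h2, by dsimp only; omega, h4⟩
  refine ⟨hD, heq ▸ Set.subset_insert _ _, ?_⟩
  rw [heq]
  have hvM : (c, p.2 - 1) ∉ doubleCone T o S p t := fun e => hc e.1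
  have hpM : p ∈ doubleCone T o S p t :=
    ⟨h.lower_mem, hpe, by simp, by omega⟩
  have nbr : ∀ u ∈ doubleCone T o S p t, (wallGraph T).Adj (c, p.2 - 1) u ↔ u = p := by
    rintro ⟨x, m⟩ ⟨h1, h2, h3, h4⟩
    dsimp only at h1 h2 h3 h4
    constructor
    · intro e
      rcases wallGraph_neighbor e with ⟨k1, k2⟩ | ⟨k1, k2, k3⟩ <;> dsimp only at *
      · exact absurd (k1 ▸ h1) hc
      · have := h.convex.eq_of_adj_of_notMem hT h1 h.lower_mem hpc k2 hc
        subst this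
        rw [SimpleGraph.dist_self] at h3
        rw [Prod.ext_iff]
        exact ⟨rfl, by dsimp only; omega⟩
    · rintro rfl
      exact wallGraph_adj_transverse hpc.symm (by dsimp only; omega)
  -- The fibre over `p.1` is reduced to `p`, so a neighbour of `p` must lie over the step of the
  -- tree towards `t.1`. There is at most one such neighbour.
  have up : ∀ u ∈ doubleCone T o S p t, (wallGraph T).Adj p u → T.Adj p.1 u.1 ∧ u.2 = p.2 + 1 ∧
      T.dist t.1 u.1 < T.dist t.1 p.1 := by
    rintro ⟨x, m⟩ ⟨h1, h2, h3, h4⟩ e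
    dsimp only at h1 h2 h3 h4
    rcases wallGraph_neighbor e with ⟨k1, k2⟩ | ⟨k1, k2, k3⟩ <;> dsimp only at *
    · subst k1
      omega
    · have := tree_dist_adj hT t.1 k2
      have : T.dist p.1 x = 1 := SimpleGraph.dist_eq_one_iff_adj.2 k2
      exact ⟨k2, by omega, by omega⟩
  by_cases hex : ∃ d ∈ doubleCone T o S p t, (wallGraph T).Adj p d
  · obtain ⟨d, hd, hpd⟩ := hex
    obtain ⟨d1, d2, d3⟩ := up d hd hpd
    refine UniformExtension.insert_opposite hG hvM hpM hd nbr (fun u hu => ⟨fun e => ?_, ?_⟩) ?_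
    · obtain ⟨u1, u2, u3⟩ := up u hu e
      rw [Prod.ext_iff]
      exact ⟨tree_closer_unique hT u1 d1 u3 d3, by omega⟩
    · rintro rfl
      exact hpd
    · dsimp only
      omega
  · push Not at hex
    exact UniformExtension.insert_isolated hG hvM hpM nbr hex

/-- Moving the lower vertex of a vertical segment downwards. -/
theorem UniformExtension.vertical (hG : IsRegularBuildingGraph G τ q)
    (h : IsConeDatum T o S p t) (hS : ∀ z ∈ S, z = p.1) :
    IsConeDatum T o S (p.1, p.2 - 2) t ∧
    doubleCone T o S p t ⊆ doubleCone T o S (p.1, p.2 - 2) t ∧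
    UniformExtension T G τ v₀ (doubleCone T o S p t) (doubleCone T o S (p.1, p.2 - 2) t) := by
  have hpe := h.lower_even
  have ht1 := hS _ h.upper_mem
  have hn := h.nonempty _ h.lower_mem
  rw [ht1, SimpleGraph.dist_self] at hn
  have hD : IsConeDatum T o S (p.1, p.2 - 2) t := by
    refine ⟨h.finite, h.convex, h.lower_mem, h.upper_mem, by dsimp only; omega, h.upper_even, ?_⟩
    intro x hx
    have := h.nonempty x hx
    dsimp only
    omega
  have heq : doubleCone T o S (p.1, p.2 - 2) t =
      insert (p.1, p.2 - 2) (doubleCone T o S p t) := by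
    ext ⟨x, m⟩
    constructor
    · rintro ⟨h1, h2, h3, h4⟩
      dsimp only at h1 h2 h3 h4
      obtain rfl := hS x h1
      by_cases hm : m = p.2 - 2
      · left
        rw [hm]
      · right
        exact ⟨h1, h2, by dsimp only; rw [SimpleGraph.dist_self] at *; omega, h4⟩
    · rintro (e | ⟨h1, h2, h3, h4⟩)
      · rw [Prod.mk.injEq] at e
        obtain ⟨rfl, rfl⟩ := e
        refine ⟨h.lower_mem, by dsimp only; omega, by simp, ?_⟩
        rw [ht1, SimpleGraph.dist_self]
        dsimp only
        omega
      · dsimp only at h1 h2 h3 h4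
        exact ⟨h1, h2, by dsimp only; omega, h4⟩
  refine ⟨hD, heq ▸ Set.subset_insert _ _, ?_⟩
  rw [heq]
  have hvM : (p.1, p.2 - 2) ∉ doubleCone T o S p t := by
    rintro ⟨-, -, h3, -⟩
    simp only [SimpleGraph.dist_self] at h3
    omega
  have hpM : p ∈ doubleCone T o S p t := ⟨h.lower_mem, hpe, by simp, by
    rw [ht1, SimpleGraph.dist_self]
    omega⟩
  have fib : ∀ u ∈ doubleCone T o S p t, u.1 = p.1 ∧ p.2 ≤ u.2 := by
    rintro ⟨x, m⟩ ⟨h1, h2, h3, h4⟩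
    dsimp only at h1 h2 h3 h4
    exact ⟨hS x h1, by dsimp only; omega⟩
  have nbr : ∀ u ∈ doubleCone T o S p t, (wallGraph T).Adj (p.1, p.2 - 2) u ↔ u = p := by
    intro u hu
    obtain ⟨f1, f2⟩ := fib u hu
    constructor
    · intro e
      rcases wallGraph_neighbor e with ⟨k1, k2⟩ | ⟨k1, k2, k3⟩ <;> dsimp only at *
      · rw [Prod.ext_iff]
        exact ⟨f1, by omega⟩
      · exact absurd f1 k1
    · rintro rfl
      exact wallGraph_adj_vertical (by omega)
  have up : ∀ u ∈ doubleCone T o S p t, (wallGraph T).Adj p u → u = (p.1, p.2 + 2) := by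
    intro u hu e
    obtain ⟨f1, f2⟩ := fib u hu
    rcases wallGraph_neighbor e with ⟨k1, k2⟩ | ⟨k1, k2, k3⟩
    · rw [Prod.ext_iff]
      exact ⟨f1, by dsimp only; omega⟩
    · exact absurd f1 k1
  by_cases hex : ∃ d ∈ doubleCone T o S p t, (wallGraph T).Adj p d
  · obtain ⟨d, hd, hpd⟩ := hex
    have hd' := up d hd hpd
    refine UniformExtension.insert_opposite hG hvM hpM hd nbr (fun u hu => ⟨fun e => ?_, ?_⟩) ?_
    · rw [up u hu e, hd']
    · rintro rfl
      exact hpd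
    · rw [hd']
      dsimp only
      omega
  · push Not at hex
    exact UniformExtension.insert_isolated hG hvM hpM nbr hex

/-- Moving the lower vertex of a double cone to a neighbouring fibre. -/
theorem UniformExtension.strip (hT : T.IsTree) (hG : IsRegularBuildingGraph G τ q)
    (hdeg : ∀ z, (T.neighborSet z).encard = ((q + 1 : ℕ) : ℕ∞))
    (h : IsConeDatum T o S p t) {c : W} (hc : c ∈ S) (hpc : T.Adj p.1 c) :
    IsConeDatum T o S (c, p.2 - 1) t ∧
    doubleCone T o S p t ⊆ doubleCone T o S (c, p.2 - 1) t ∧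
    UniformExtension T G τ v₀ (doubleCone T o S p t) (doubleCone T o S (c, p.2 - 1) t) := by
  have hq := hG.two_le
  have hcp : ∀ x, T.dist c x = T.dist p.1 x + 1 ∨ T.dist p.1 x = T.dist c x + 1 := by
    intro x
    rw [SimpleGraph.dist_comm, SimpleGraph.dist_comm (u := p.1)]
    exact tree_dist_adj hT x hpc
  have hoc := tree_dist_adj hT o hpc
  have hpe := h.lower_even
  have hD : IsConeDatum T o S (c, p.2 - 1) t := by
    refine ⟨h.finite, h.convex, hc, h.upper_mem, by dsimp only; omega, h.upper_even, ?_⟩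
    intro x hx
    have := h.nonempty x hx
    have := hcp x
    dsimp only
    omega
  have hsub : doubleCone T o S p t ⊆ doubleCone T o S (c, p.2 - 1) t := by
    rintro ⟨x, m⟩ ⟨h1, h2, h3, h4⟩
    have := hcp x
    dsimp only at h1 h2 h3 h4
    exact ⟨h1, h2, by dsimp only; omega, h4⟩
  -- Only fibres on the side of `c` grow, each by one vertex at its bottom. They are treated in the
  -- order of their distance from `p.1`.
  refine ⟨hD, hsub, UniformExtension.of_rank hsub hD.doubleCone_finite
    (fun u => (T.dist p.1 u.1 : ℤ)) ?_⟩
  intro M v hYM hMZ hv hvM hle hlt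
  obtain ⟨x, m⟩ := v
  obtain ⟨v1, v2, v3, v4⟩ := hv
  dsimp only at v1 v2 v3 v4 hle hlt
  have par := tree_parity hT o p.1 x
  -- membership in the smaller double cone
  have memY : ∀ {y : W} {n : ℤ}, y ∈ S → (n - T.dist o y) % 2 = 0 → p.2 + T.dist p.1 y ≤ n →
      n + T.dist t.1 y ≤ t.2 → (y, n) ∈ M := fun h1 h2 h3 h4 => hYM ⟨h1, h2, h3, h4⟩
  have hlow : ¬ p.2 + T.dist p.1 x ≤ m := fun e => hvM (memY v1 v2 e v4)
  have hcx := hcp x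
  have hm : m = p.2 + T.dist p.1 x - 2 := by omega
  have hside : T.dist p.1 x = T.dist c x + 1 := by omega
  have htx := h.nonempty x v1
  have mem1 : (x, m + 2) ∈ M := memY v1 (by omega) (by omega) (by omega)
  -- the neighbour of `x` towards `p`
  obtain ⟨y, hxy, hy, hyS⟩ : ∃ y, T.Adj x y ∧ T.dist p.1 x = T.dist p.1 y + 1 ∧ y ∈ S := by
    obtain ⟨y, h1, h2⟩ := tree_exists_closer hT (x := p.1) (z := x) (by
      rintro rfl
      simp at hside)
    exact ⟨y, h1, h2, h.convex _ h.lower_mem x v1 y h1 (by omega)⟩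
  have hoy := tree_dist_adj hT o hxy
  have hty := h.nonempty y hyS
  have mem2 : (y, m + 1) ∈ M := memY hyS (by omega) (by omega) (by omega)
  have lowM : ∀ u ∈ M, p.2 + T.dist p.1 u.1 - 2 ≤ u.2 ∧ u.2 + T.dist t.1 u.1 ≤ t.2 ∧ u.1 ∈ S ∧
      (u.2 - T.dist o u.1) % 2 = 0 := by
    intro u hu
    obtain ⟨u1, u2, u3, u4⟩ := hMZ hu
    have := hcp u.1
    dsimp only at u3
    exact ⟨by omega, u4, u1, u2⟩
  have lowM' : ∀ u ∈ M, T.dist p.1 x < T.dist p.1 u.1 → p.2 + T.dist p.1 u.1 ≤ u.2 := by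
    intro u hu hlt'
    by_contra hn
    have := hle u hu (fun e => hn e.2.2.1)
    omega
  have away : ∀ z, T.Adj x z → z ≠ y → T.dist p.1 z = T.dist p.1 x + 1 := by
    intro z hz hzy
    rcases tree_dist_adj hT p.1 hz with e | e
    · exact e
    · exact absurd (tree_closer_unique hT hz hxy (x := p.1) (by omega) (by omega)) hzy
  have a1 : (wallGraph T).Adj (x, m) (x, m + 2) := wallGraph_adj_vertical (by omega)
  have a2 : (wallGraph T).Adj (x, m) (y, m + 1) := wallGraph_adj_transverse hxy (by omega)
  have a3 : (wallGraph T).Adj (x, m) (y, m - 1) := wallGraph_adj_transverse hxy (by omega)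
  have a4 : (wallGraph T).Adj (y, m + 1) (x, m + 2) :=
    wallGraph_adj_transverse hxy.symm (by omega)
  have a5 : (wallGraph T).Adj (y, m + 1) (y, m - 1) := wallGraph_adj_vertical (by omega)
  have nbr : ∀ u ∈ M, (wallGraph T).Adj (x, m) u →
      u = (x, m + 2) ∨ u = (y, m + 1) ∨ u = (y, m - 1) := by
    rintro ⟨u1, u2⟩ hu hvu
    obtain ⟨l1, l2, l3, l4⟩ := lowM _ hu
    have l5 := lowM' _ hu
    rcases wallGraph_neighbor hvu with ⟨k1, k2⟩ | ⟨k1, k2, k3⟩ <;> dsimp only at *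
    · subst k1
      left
      rw [Prod.mk.injEq]
      exact ⟨rfl, by omega⟩
    · right
      by_cases huy : u1 = y
      · subst huy
        rcases k3 with k3 | k3
        · left; rw [k3]
        · right; rw [k3]
      · have := away u1 k2 huy
        have := l5 (by omega)
        omega
  have hlink : LinksJoined T M (x, m) := by
    rintro y' hy' hvy ⟨d1, d2⟩ hd hyd hvd h3
    have hnot := fun h => hvd (Or.inl h)
    have hnot' := fun h => hvd (Or.inr h)
    obtain ⟨l1, l2, l3, l4⟩ := lowM _ hd
    have txy := tree_dist_adj hT t.1 hxy
    rcases nbr y' hy' hvy with rfl | rfl | rfl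
    · rcases wallGraph_neighbor hyd with ⟨k1, k2⟩ | ⟨k1, k2, k3⟩ <;> dsimp only at *
      · subst k1
        have k2 : d2 = m + 4 := by omega
        exact ⟨(y, m + 1), mem2, (y, m + 3),
          memY hyS (by omega) (by omega) (by omega), a2, a4.symm,
          wallGraph_adj_transverse hxy.symm (by omega),
          wallGraph_adj_transverse hxy.symm (by omega), wallGraph_adj_vertical (by omega)⟩
      · exfalso
        rcases k3 with k3 | k3
        · omega
        · exact hnot' ⟨k2, by omega⟩
    · rcases wallGraph_neighbor hyd with ⟨k1, k2⟩ | ⟨k1, k2, k3⟩ <;> dsimp only at *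
      · subst k1
        exfalso
        rcases k2 with k2 | k2
        · omega
        · exact hnot' ⟨hxy, by omega⟩
      · by_cases hdx : d1 = x
        · exfalso
          rcases k3 with k3 | k3
          · exact hnot ⟨hdx.symm, by omega⟩
          · omega
        · have k3 : d2 = m + 2 := by omega
          have tyd := tree_dist_adj hT t.1 k2
          -- If the fibre over `y` ended too low, then `x` and `d1` would both be the neighbour of
          -- `y` towards `t.1`.
          have htop : m + 3 + T.dist t.1 y ≤ t.2 := by
            by_contra hn
            exact hdx (tree_closer_unique hT k2 hxy.symm (x := t.1) (by omega) (by omega))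
          exact ⟨(x, m + 2), mem1, (y, m + 3), memY hyS (by omega) (by omega) (by omega), a1, a4,
            wallGraph_adj_vertical (by omega), wallGraph_adj_transverse k2 (by omega),
            wallGraph_adj_transverse hxy.symm (by omega)⟩
    · rcases wallGraph_neighbor hyd with ⟨k1, k2⟩ | ⟨k1, k2, k3⟩ <;> dsimp only at *
      · subst k1
        exfalso
        rcases k2 with k2 | k2
        · exact hnot' ⟨hxy, by omega⟩
        · omega
      · by_cases hdx : d1 = x
        · exfalso
          rcases k3 with k3 | k3
          · omega
          · exact hnot ⟨hdx.symm, by omega⟩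
        · have k3 : d2 = m - 2 := by omega
          have pyd := tree_dist_adj hT p.1 k2
          have tyd := tree_dist_adj hT t.1 k2
          have oyd := tree_dist_adj hT o k2
          have hlow' := h.nonempty d1 l3
          exact ⟨(y, m + 1), mem2, (d1, m), memY l3 (by omega) (by omega) (by omega), a2, a5.symm,
            wallGraph_adj_transverse k2.symm (by omega), wallGraph_adj_vertical (by omega),
            wallGraph_adj_transverse k2.symm (by omega)⟩
  -- When the preceding fibre has received its new vertex, that vertex is the third neighbour and
  -- forces the image. Otherwise the new vertex is attached to an edge.
  by_cases hm3 : (y, m - 1) ∈ M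
  · refine UniformExtension.insert_path hT hG hvM mem1 mem2 hm3 a4 a5
      (fun e => hxy.ne (congrArg Prod.fst e)) (fun u hu => ⟨nbr u hu, ?_⟩) hlink
    rintro (rfl | rfl | rfl)
    exacts [a1, a2, a3]
  · refine UniformExtension.insert_edge hG (encard_commonNeighbors_wallGraph_le hT (by omega) hdeg)
      hvM mem1 mem2 a4.symm (fun u hu => ⟨fun e => ?_, ?_⟩) hlink
    · rcases nbr u hu e with e | e | rfl
      · exact Or.inl e
      · exact Or.inr e
      · exact absurd hu hm3
    · rintro (rfl | rfl)
      exacts [a1, a2]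

end BuildingSymmetry

/-! ### Reflection, and the induction between two double cones -/

namespace BuildingSymmetry

variable {V : Type u} {W : Type w} {T : SimpleGraph W} {G : SimpleGraph V} {τ : V → ZMod 3} {q : ℕ}
  {v₀ : V} {o : W} {S S' : Set W} {p t p' t' : W × ℤ}

/-- The reflection of the wall-tree in its base. -/
def wallFlip (a : W × ℤ) : W × ℤ := (a.1, -a.2)

theorem wallFlip_wallFlip (a : W × ℤ) : wallFlip (wallFlip a) = a := by
  simp [wallFlip]

theorem wallGraph_adj_wallFlip {a b : W × ℤ} :
    (wallGraph T).Adj (wallFlip a) (wallFlip b) ↔ (wallGraph T).Adj a b := by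
  have h1 : (-b.2 = -a.2 + 2 ∨ -a.2 = -b.2 + 2) ↔ (b.2 = a.2 + 2 ∨ a.2 = b.2 + 2) := by omega
  have h2 : (-b.2 = -a.2 + 1 ∨ -a.2 = -b.2 + 1) ↔ (b.2 = a.2 + 1 ∨ a.2 = b.2 + 1) := by omega
  simp only [wallGraph_adj, wallFlip, h1, h2]

theorem IsGood.comp_wallFlip {D : Set (W × ℤ)} {g : W × ℤ → V} (hg : IsGood T G τ D g) :
    IsGood T G τ (wallFlip ⁻¹' D) (g ∘ wallFlip) := by
  constructor
  · intro a b ha hb hab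
    exact hg.adj ha hb (wallGraph_adj_wallFlip.2 hab)
  · intro y b c hy hb hc hyb hyc
    have := hg.color hy hb hc (wallGraph_adj_wallFlip.2 hyb) (wallGraph_adj_wallFlip.2 hyc)
    simp only [Function.comp_apply]
    rw [this]
    simp only [wallFlip]
    omega
  · intro y b c hy hb hc hyb hyc h
    have := hg.inj hy hb hc (wallGraph_adj_wallFlip.2 hyb) (wallGraph_adj_wallFlip.2 hyc) h
    rw [← wallFlip_wallFlip b, this, wallFlip_wallFlip]
  · intro y b c hy hb hc hyb hyc h
    exact wallGraph_adj_wallFlip.1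
      (hg.induced hy hb hc (wallGraph_adj_wallFlip.2 hyb) (wallGraph_adj_wallFlip.2 hyc) h)

theorem preimage_wallFlip_preimage (D : Set (W × ℤ)) : wallFlip ⁻¹' (wallFlip ⁻¹' D) = D := by
  ext a
  simp [wallFlip_wallFlip]

/-- By reflection the moves of the lower vertex also serve for the upper one. -/
theorem UniformExtension.of_wallFlip {D₀ D : Set (W × ℤ)}
    (h : UniformExtension T G τ v₀ (wallFlip ⁻¹' D₀) (wallFlip ⁻¹' D)) :
    UniformExtension T G τ v₀ D₀ D := by
  obtain ⟨N, hN, h⟩ := h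
  refine ⟨N, hN, fun g hg => ?_⟩
  rw [← h _ hg.comp_wallFlip]
  have hinj : Function.Injective fun k : W × ℤ → V => k ∘ wallFlip := by
    intro k k' e
    funext a
    have := congrFun e (wallFlip a)
    simpa [wallFlip_wallFlip] using this
  rw [← hinj.encard_image]
  congr 1
  ext k
  constructor
  · rintro ⟨k, ⟨h1, h2, h3⟩, rfl⟩
    exact ⟨h1.comp_wallFlip, fun x hx => h2 hx, fun x hx => h3 _ hx⟩
  · rintro ⟨h1, h2, h3⟩
    refine ⟨k ∘ wallFlip, ⟨?_, fun x hx => ?_, fun x hx => ?_⟩, ?_⟩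
    · have := h1.comp_wallFlip
      rwa [preimage_wallFlip_preimage] at this
    · have := h2 (x := wallFlip x) (by simpa [wallFlip_wallFlip] using hx)
      simpa [wallFlip_wallFlip] using this
    · exact h3 _ (by simpa [wallFlip_wallFlip] using hx)
    · funext a
      simp [wallFlip_wallFlip]

theorem preimage_wallFlip_doubleCone :
    wallFlip ⁻¹' doubleCone T o S p t = doubleCone T o S (wallFlip t) (wallFlip p) := by
  ext ⟨x, m⟩
  simp only [doubleCone, wallFlip, Set.mem_preimage, Set.mem_ofPred_eq]
  constructor
  · rintro ⟨h1, h2, h3, h4⟩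
    exact ⟨h1, by omega, by omega, by omega⟩
  · rintro ⟨h1, h2, h3, h4⟩
    exact ⟨h1, by omega, by omega, by omega⟩

theorem IsConeDatum.wallFlip (h : IsConeDatum T o S p t) :
    IsConeDatum T o S (wallFlip t) (wallFlip p) := by
  refine ⟨h.finite, h.convex, h.upper_mem, h.lower_mem, ?_, ?_, ?_⟩
  · have := h.upper_even
    simp only [BuildingSymmetry.wallFlip]
    omega
  · have := h.lower_even
    simp only [BuildingSymmetry.wallFlip]
    omega
  · intro z hz
    have := h.nonempty z hz
    simp only [BuildingSymmetry.wallFlip]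
    omega

theorem IsConeDatum.mem_doubleCone (hT : T.IsTree) (h : IsConeDatum T o S p t) {z : W} (hz : z ∈ S) :
    (z, p.2 + T.dist p.1 z) ∈ doubleCone T o S p t := by
  have := h.nonempty z hz
  have h1 := h.lower_even
  have h2 := tree_parity hT o p.1 z
  refine ⟨hz, ?_, le_rfl, ?_⟩ <;> dsimp only <;> omega

theorem IsConeDatum.lower_mem_doubleCone (hT : T.IsTree) (h : IsConeDatum T o S p t) :
    p ∈ doubleCone T o S p t := by
  simpa using h.mem_doubleCone hT h.lower_mem

theorem doubleCone_mono (hT : T.IsTree) (hS : S ⊆ S') (hp : p'.2 + T.dist p'.1 p.1 ≤ p.2)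
    (ht : t.2 + T.dist t'.1 t.1 ≤ t'.2) : doubleCone T o S p t ⊆ doubleCone T o S' p' t' := by
  rintro a ⟨h1, h2, h3, h4⟩
  have := hT.connected.dist_triangle (u := p'.1) (v := p.1) (w := a.1)
  have := hT.connected.dist_triangle (u := t'.1) (v := t.1) (w := a.1)
  exact ⟨hS h1, h2, by omega, by omega⟩

/-- A double cone with a lower vertex other than that of a larger one can be enlarged towards it. -/
theorem exists_enlarge_lower (hT : T.IsTree) (hG : IsRegularBuildingGraph G τ q)
    (hdeg : ∀ z, (T.neighborSet z).encard = ((q + 1 : ℕ) : ℕ∞))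
    (h : IsConeDatum T o S p t) (h' : IsConeDatum T o S' p' t') (hS : S ⊆ S')
    (hp : p'.2 + T.dist p'.1 p.1 ≤ p.2) (hne : p ≠ p') :
    ∃ S₁ p₁, IsConeDatum T o S₁ p₁ t ∧ S₁ ⊆ S' ∧ p'.2 + T.dist p'.1 p₁.1 ≤ p₁.2 ∧
      doubleCone T o S p t ⊆ doubleCone T o S₁ p₁ t ∧
      (∃ a ∈ doubleCone T o S₁ p₁ t, a ∉ doubleCone T o S p t) ∧
      UniformExtension T G τ v₀ (doubleCone T o S p t) (doubleCone T o S₁ p₁ t) := by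
  have notMem : ∀ {a : W × ℤ}, a.2 < p.2 → a ∉ doubleCone T o S p t := by
    rintro a ha ⟨-, -, h3, -⟩
    omega
  by_cases hpp : p'.1 = p.1
  -- The target is straight below. A sideways step into `S` still stays in the upper cone of `p'`,
  -- because the heights differ by at least two; a vertical step is needed only if `S` is a single
  -- vertex.
  · have hlt : p'.2 + 2 ≤ p.2 := by
      have h1 := h.lower_even
      have h2 := h'.lower_even
      rw [hpp] at h2
      have : p'.2 ≠ p.2 := fun e => hne (Prod.ext hpp.symm e.symm)
      omega
    by_cases hc : ∃ c ∈ S, T.Adj p.1 c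
    · obtain ⟨c, hc, hpc⟩ := hc
      obtain ⟨k1, k2, k3⟩ := UniformExtension.strip (v₀ := v₀) hT hG hdeg h hc hpc
      refine ⟨S, _, k1, hS, ?_, k2,
        ⟨_, k1.lower_mem_doubleCone hT, notMem (by dsimp only; omega)⟩, k3⟩
      have : T.dist p.1 c = 1 := SimpleGraph.dist_eq_one_iff_adj.2 hpc
      rw [hpp]
      dsimp only
      omega
    · have hS1 : ∀ z ∈ S, z = p.1 := by
        intro z hz
        by_contra hzp
        obtain ⟨c, h1, h2⟩ := tree_exists_closer hT hzp
        exact hc ⟨c, h.convex z hz p.1 h.lower_mem c h1 (by omega), h1⟩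
      obtain ⟨k1, k2, k3⟩ := UniformExtension.vertical (v₀ := v₀) hG h hS1
      refine ⟨S, _, k1, hS, ?_, k2,
        ⟨_, k1.lower_mem_doubleCone hT, notMem (by dsimp only; omega)⟩, k3⟩
      rw [hpp, SimpleGraph.dist_self]
      dsimp only
      omega
  · obtain ⟨c, hpc, hd⟩ := tree_exists_closer hT hpp
    have hcS' : c ∈ S' := h'.convex _ h'.lower_mem _ (hS h.lower_mem) c hpc (by omega)
    by_cases hc : c ∈ S
    · obtain ⟨k1, k2, k3⟩ := UniformExtension.strip (v₀ := v₀) hT hG hdeg h hc hpc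
      exact ⟨S, _, k1, hS, by dsimp only; omega, k2,
        ⟨_, k1.lower_mem_doubleCone hT, notMem (by dsimp only; omega)⟩, k3⟩
    -- Either the fibre over `p.1` has two vertices and a fibre over `c` can be attached, or by
    -- parity it consists of `p` alone.
    · by_cases hk : p.2 + T.dist p.1 p.1 + 2 + T.dist t.1 p.1 ≤ t.2
      · obtain ⟨k1, k2, k3⟩ := UniformExtension.leaf (v₀ := v₀) hT hG hdeg h h.lower_mem hc hpc hk
        exact ⟨_, p, k1, Set.insert_subset hcS' hS, hp, k2,
          ⟨_, k1.mem_doubleCone hT (Set.mem_insert c S), fun e => hc e.1⟩, k3⟩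
      · have hk' : p.2 + T.dist t.1 p.1 = t.2 := by
          have h1 := h.nonempty _ h.lower_mem
          have h2 := h.lower_even
          have h3 := h.upper_even
          have h4 := tree_parity hT o t.1 p.1
          rw [SimpleGraph.dist_self] at hk h1
          omega
        obtain ⟨k1, k2, k3⟩ := UniformExtension.transverse (v₀ := v₀) hT hG h hc hpc hk'
        exact ⟨_, _, k1, Set.insert_subset hcS' hS, by dsimp only; omega, k2,
          ⟨_, k1.lower_mem_doubleCone hT, notMem (by dsimp only; omega)⟩, k3⟩

/-- The number of extensions of good maps between convex subsets of the wall-tree is uniform. -/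
theorem uniformExtension_doubleCone (hT : T.IsTree) (hG : IsRegularBuildingGraph G τ q)
    (hdeg : ∀ z, (T.neighborSet z).encard = ((q + 1 : ℕ) : ℕ∞))
    (h' : IsConeDatum T o S' p' t') (h : IsConeDatum T o S p t)
    (hsub : doubleCone T o S p t ⊆ doubleCone T o S' p' t') :
    UniformExtension T G τ v₀ (doubleCone T o S p t) (doubleCone T o S' p' t') := by
  have hS : S ⊆ S' := fun z hz => (hsub (h.mem_doubleCone hT hz)).1
  have hp : p'.2 + T.dist p'.1 p.1 ≤ p.2 := (hsub (h.lower_mem_doubleCone hT)).2.2.1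
  have ht : t.2 + T.dist t'.1 t.1 ≤ t'.2 := by
    have h1 := h.wallFlip.lower_mem_doubleCone hT
    rw [← preimage_wallFlip_doubleCone, Set.mem_preimage, wallFlip_wallFlip] at h1
    exact (hsub h1).2.2.2
  have hfin := h'.doubleCone_finite
  -- The inclusion has been replaced by conditions on the subtrees and the two extreme vertices,
  -- which the moves preserve.
  clear hsub
  induction n : (doubleCone T o S' p' t' \ doubleCone T o S p t).ncard using
    Nat.strong_induction_on generalizing S p t with
  | _ n ih =>
  have descend : ∀ {S₁ p₁ t₁}, IsConeDatum T o S₁ p₁ t₁ → S₁ ⊆ S' →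
      p'.2 + T.dist p'.1 p₁.1 ≤ p₁.2 → t₁.2 + T.dist t'.1 t₁.1 ≤ t'.2 →
      doubleCone T o S p t ⊆ doubleCone T o S₁ p₁ t₁ →
      (∃ a ∈ doubleCone T o S₁ p₁ t₁, a ∉ doubleCone T o S p t) →
      UniformExtension T G τ v₀ (doubleCone T o S p t) (doubleCone T o S₁ p₁ t₁) →
      UniformExtension T G τ v₀ (doubleCone T o S p t) (doubleCone T o S' p' t') := by
    rintro S₁ p₁ t₁ k1 k2 k3 k4 k5 ⟨a, ha, ha'⟩ k6
    have hmono := doubleCone_mono (o := o) hT k2 k3 k4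
    refine k6.trans k5 hmono (ih _ ?_ k1 k2 k3 k4 rfl)
    rw [← n]
    refine Set.ncard_lt_ncard ⟨Set.sdiff_subset_sdiff_right k5, fun e => ?_⟩
      (hfin.subset Set.sdiff_subset)
    exact (e ⟨hmono ha, ha'⟩).2 ha
  by_cases hpp : p = p'
  swap
  · obtain ⟨S₁, p₁, k1, k2, k3, k4, k5, k6⟩ :=
      exists_enlarge_lower (v₀ := v₀) hT hG hdeg h h' hS hp hpp
    exact descend k1 k2 k3 ht k4 k5 k6
  by_cases htt : t = t'
  swap
  · obtain ⟨S₁, t₁, k1, k2, k3, k4, ⟨a, ha, ha'⟩, k6⟩ :=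
      exists_enlarge_lower (v₀ := v₀) hT hG hdeg h.wallFlip h'.wallFlip hS
        (by simp only [wallFlip]; omega)
        (fun e => htt (by rw [← wallFlip_wallFlip t, e, wallFlip_wallFlip]))
    have e1 : wallFlip ⁻¹' doubleCone T o S₁ p (wallFlip t₁) =
        doubleCone T o S₁ t₁ (wallFlip p) := by
      rw [preimage_wallFlip_doubleCone, wallFlip_wallFlip]
    rw [← e1, ← preimage_wallFlip_doubleCone] at k4 k6
    rw [← e1] at ha
    rw [← preimage_wallFlip_doubleCone] at ha'
    have k1' := k1.wallFlip
    rw [wallFlip_wallFlip] at k1'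
    refine descend k1' k2 hp ?_ ?_ ⟨wallFlip a, ha, ha'⟩ (UniformExtension.of_wallFlip k6)
    · simp only [wallFlip] at k3 ⊢
      omega
    · intro x hx
      have := @k4 (wallFlip x) (by simpa [wallFlip_wallFlip] using hx)
      simpa [wallFlip_wallFlip] using this
  subst hpp htt
  by_cases hSS : S = S'
  · subst hSS
    exact UniformExtension.refl _
  have hne : (S' \ S).Nonempty := by
    rw [Set.sdiff_nonempty]
    exact fun e => hSS (hS.antisymm e)
  -- Now only whole fibres are missing. A missing one nearest to `p.1` is over a vertex adjacent to
  -- `S`.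
  obtain ⟨c, hc, hmin⟩ := Set.exists_min_image (S' \ S) (fun x => T.dist p.1 x)
    (h'.finite.subset Set.sdiff_subset) hne
  obtain ⟨z, hcz, hd⟩ := tree_exists_closer hT (x := p.1) (z := c) (by
    rintro rfl
    exact hc.2 h.lower_mem)
  have hzS : z ∈ S := by
    by_contra hz
    have := hmin z ⟨h'.convex _ (hS h.lower_mem) c hc.1 z hcz (by omega), hz⟩
    omega
  have hdt := h.convex.dist_eq_of_notMem hT h.upper_mem hzS hcz.symm hc.2
  have hn := h'.nonempty c hc.1
  obtain ⟨k1, k2, k3⟩ :=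
    UniformExtension.leaf (v₀ := v₀) hT hG hdeg h hzS hc.2 hcz.symm (by omega)
  exact descend k1 (Set.insert_subset hc.1 hS) hp ht k2
    ⟨_, k1.mem_doubleCone hT (Set.mem_insert c S), fun e => hc.2 e.1⟩ k3

end BuildingSymmetry

/-! ### Finite convex subsets of the wall-tree are double cones -/

namespace BuildingSymmetry

section Classification

variable {W : Type w} {T : SimpleGraph W} {o : W} {A : Set (W × ℤ)}

/-- The closure properties of finite convex sets of vertices of the wall-tree that determine their
shape. -/
structure IsWallConvex (T : SimpleGraph W) (o : W) (A : Set (W × ℤ)) : Prop where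
  finite : A.Finite
  nonempty : A.Nonempty
  even : ∀ a ∈ A, (a.2 - T.dist o a.1) % 2 = 0
  treeConvex : TreeConvex T (Prod.fst '' A)
  vertical : ∀ {z m n k}, (z, m) ∈ A → (z, n) ∈ A → m ≤ k → k ≤ n → (k - m) % 2 = 0 → (z, k) ∈ A
  up : ∀ {z z' m n}, T.Adj z z' → (z, m) ∈ A → (z', n) ∈ A → m < n → (z', m + 1) ∈ A
  down : ∀ {z z' m n}, T.Adj z z' → (z, m) ∈ A → (z', n) ∈ A → n < m → (z', m - 1) ∈ A
  join : ∀ {y b c}, b ∈ A → c ∈ A → b ≠ c → ¬ (wallGraph T).Adj b c → (wallGraph T).Adj y b →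
    (wallGraph T).Adj y c → y ∈ A

theorem IsWallConvex.wallFlip (hA : IsWallConvex T o A) : IsWallConvex T o (wallFlip ⁻¹' A) := by
  have hinv : Function.Involutive (BuildingSymmetry.wallFlip (W := W)) := wallFlip_wallFlip
  have himg : Prod.fst '' (BuildingSymmetry.wallFlip ⁻¹' A) = Prod.fst '' A := by
    ext z
    constructor
    · rintro ⟨a, ha, rfl⟩
      exact ⟨_, ha, rfl⟩
    · rintro ⟨a, ha, rfl⟩
      exact ⟨BuildingSymmetry.wallFlip a, by simpa [wallFlip_wallFlip] using ha, rfl⟩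
  refine ⟨hA.finite.preimage hinv.injective.injOn, ?_, ?_, himg ▸ hA.treeConvex, ?_, ?_, ?_, ?_⟩
  · obtain ⟨a, ha⟩ := hA.nonempty
    exact ⟨BuildingSymmetry.wallFlip a, by simpa [wallFlip_wallFlip] using ha⟩
  · intro a ha
    have := hA.even _ ha
    simp only [BuildingSymmetry.wallFlip] at this
    omega
  · intro z m n k hm hn h1 h2 h3
    exact hA.vertical (m := -n) (n := -m) hn hm (by omega) (by omega) (by
      have h4 := hA.even _ hm
      have h5 := hA.even _ hn
      simp only [BuildingSymmetry.wallFlip] at h4 h5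
      omega)
  · intro z z' m n hz hm hn h
    have := hA.down hz hm hn (by dsimp only; omega)
    simpa [BuildingSymmetry.wallFlip, sub_eq_add_neg, add_comm] using this
  · intro z z' m n hz hm hn h
    have := hA.up hz hm hn (by dsimp only; omega)
    simpa [BuildingSymmetry.wallFlip, sub_eq_add_neg, add_comm] using this
  · intro y b c hb hc hne hn hyb hyc
    exact hA.join hb hc (fun h => hne (hinv.injective h)) (fun h => hn (wallGraph_adj_wallFlip.1 h))
      (wallGraph_adj_wallFlip.2 hyb) (wallGraph_adj_wallFlip.2 hyc)

/-- The lower boundary of a convex set is that of an upper cone. -/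
theorem IsWallConvex.exists_lower (hT : T.IsTree) (hA : IsWallConvex T o A) :
    ∃ p ∈ A, ∀ z ∈ Prod.fst '' A, (z, p.2 + (T.dist p.1 z : ℤ)) ∈ A ∧
      ∀ n, (z, n) ∈ A → p.2 + (T.dist p.1 z : ℤ) ≤ n := by
  obtain ⟨p, hp, hmin⟩ := Set.exists_min_image A Prod.snd hA.finite hA.nonempty
  refine ⟨p, hp, ?_⟩
  have key : ∀ k z, T.dist p.1 z = k → z ∈ Prod.fst '' A → (z, p.2 + (k : ℤ)) ∈ A ∧
      ∀ n, (z, n) ∈ A → p.2 + (k : ℤ) ≤ n := by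
    intro k
    induction k using Nat.strong_induction_on with
    | _ k ih =>
    intro z hk hz
    have hpS : p.1 ∈ Prod.fst '' A := ⟨p, hp, rfl⟩
    rcases k with _ | k
    · obtain rfl := hT.connected.dist_eq_zero_iff.1 hk
      simp only [Nat.cast_zero, add_zero]
      exact ⟨hp, fun n hn => hmin _ hn⟩
    have hpz : p.1 ≠ z := by
      rintro rfl
      simp at hk
    obtain ⟨c, hzc, hc⟩ := tree_exists_closer hT hpz
    have hcS := hA.treeConvex _ hpS _ hz c hzc (by omega)
    obtain ⟨c1, c2⟩ := ih k (by omega) c (by omega) hcS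
    -- If the fibre over `z` went lower, the bound over `c` and parity would leave only the height
    -- `p.2 + k - 1`. For `k = 0` this is below the lowest vertex. Otherwise the vertex over `z` and
    -- the lowest one over `c'` have equal height, and their common neighbour over `c` lies below
    -- the bound there.
    have hlow : ∀ n, (z, n) ∈ A → p.2 + (k : ℤ) < n := by
      intro n hn
      by_contra hlt
      have e1 := hA.even _ hn
      have e2 := hA.even _ c1
      dsimp only at e1 e2
      have e3 := tree_dist_adj hT o hzc
      have h1 := c2 _ (hA.up hzc hn c1 (by omega))
      have hn' : n = p.2 + k - 1 := by omega
      rcases k with _ | k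
      · have := hmin _ hn
        dsimp only at this
        push_cast at hn'
        omega
      have hpc : p.1 ≠ c := by
        rintro rfl
        rw [SimpleGraph.dist_self] at hc
        omega
      obtain ⟨c', hcc', hc'⟩ := tree_exists_closer hT hpc
      have hcS' := hA.treeConvex _ hpS _ hcS c' hcc' (by omega)
      obtain ⟨d1, -⟩ := ih k (by omega) c' (by omega) hcS'
      have hj : (c, p.2 + (k : ℤ) - 1) ∈ A := by
        refine hA.join hn d1 ?_ ?_ (wallGraph_adj_transverse hzc.symm ?_)
          (wallGraph_adj_transverse hcc' ?_)
        · rw [Ne, Prod.mk.injEq]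
          rintro ⟨rfl, -⟩
          omega
        · intro h
          have := wallGraph_color h
          apply this
          dsimp only
          omega
        · omega
        · omega
      have := c2 _ hj
      push_cast at this
      omega
    obtain ⟨⟨z, n⟩, hn, rfl⟩ := hz
    have hup := hA.up hzc.symm c1 hn (hlow n hn)
    push_cast
    rw [← add_assoc]
    exact ⟨hup, fun m hm => by have := hlow m hm; omega⟩
  exact fun z hz => key _ z rfl hz

/-- Finite convex sets of vertices of the wall-tree are double cones. -/
theorem IsWallConvex.exists_eq_doubleCone (hT : T.IsTree) (hA : IsWallConvex T o A) :
    ∃ p t, IsConeDatum T o (Prod.fst '' A) p t ∧ A = doubleCone T o (Prod.fst '' A) p t := by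
  obtain ⟨p, hp, hlow⟩ := hA.exists_lower hT
  obtain ⟨t, ht, hupp⟩ := hA.wallFlip.exists_lower hT
  have hupp' : ∀ z ∈ Prod.fst '' A, (z, -t.2 - (T.dist t.1 z : ℤ)) ∈ A ∧
      ∀ n, (z, n) ∈ A → n ≤ -t.2 - (T.dist t.1 z : ℤ) := by
    rintro z ⟨a, ha, rfl⟩
    obtain ⟨h1, h2⟩ := hupp a.1 ⟨BuildingSymmetry.wallFlip a, by
      simpa [wallFlip_wallFlip] using ha, rfl⟩
    constructor
    · change (a.1, -(t.2 + (T.dist t.1 a.1 : ℤ))) ∈ A at h1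
      rwa [neg_add'] at h1
    · intro n hn
      have := h2 (-n) (by simpa [BuildingSymmetry.wallFlip] using hn)
      omega
  refine ⟨p, BuildingSymmetry.wallFlip t, ⟨hA.finite.image _, hA.treeConvex, ⟨p, hp, rfl⟩,
    ⟨_, ht, rfl⟩, hA.even _ hp, hA.even _ ht, ?_⟩, ?_⟩
  · intro z hz
    have := (hupp' z hz).2 _ (hlow z hz).1
    simp only [BuildingSymmetry.wallFlip]
    omega
  · ext ⟨z, n⟩
    constructor
    · intro h
      have hz : z ∈ Prod.fst '' A := ⟨_, h, rfl⟩
      refine ⟨hz, hA.even _ h, (hlow z hz).2 n h, ?_⟩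
      have := (hupp' z hz).2 n h
      simp only [BuildingSymmetry.wallFlip]
      omega
    · rintro ⟨hz, h1, h2, h3⟩
      simp only [BuildingSymmetry.wallFlip] at h1 h2 h3
      have e := hA.even _ (hlow z hz).1
      dsimp only at e
      exact hA.vertical (hlow z hz).1 (hupp' z hz).1 h2 (by omega) (by omega)

end Classification

section ModelWallTree

variable {W : Type w} {T : SimpleGraph W} {o : W}

theorem skeleton_modelWallTree_adj {a b : WallTreeVertex T o} :
    (skeleton (modelWallTree T o)).Adj a b ↔ (wallGraph T).Adj a.1 b.1 := by
  rw [modelWallTree, skeleton_flagComplex, SimpleGraph.fromRel_adj, wallGraph_adj]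
  constructor
  · rintro ⟨-, (⟨h1, h2⟩ | ⟨h1, h2⟩) | (⟨h1, h2⟩ | ⟨h1, h2⟩)⟩
    · exact Or.inl ⟨h1.symm, Or.inl h2⟩
    · exact Or.inr ⟨h1, Or.inl h2⟩
    · exact Or.inl ⟨h1, Or.inr h2⟩
    · exact Or.inr ⟨h1.symm, Or.inr h2⟩
  · intro h
    refine ⟨?_, ?_⟩
    · rintro rfl
      have := (wallGraph T).irrefl h
      exact this
    rcases h with ⟨h1, h2 | h2⟩ | ⟨h1, h2 | h2⟩
    · exact Or.inl (Or.inl ⟨h1.symm, h2⟩)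
    · exact Or.inr (Or.inl ⟨h1, h2⟩)
    · exact Or.inl (Or.inr ⟨h1, h2⟩)
    · exact Or.inr (Or.inr ⟨h1.symm, h2⟩)

theorem isFlag_modelWallTree : IsFlag (modelWallTree T o) := isFlag_flagComplex _

/-- Each edge changes height and base point by at most two in total. The bound is attained on
vertical walks and on those with one added transverse step, and so certifies them as geodesics. -/
theorem wallTree_le_two_mul_length (hT : T.IsTree) {a b : WallTreeVertex T o}
    (r : (skeleton (modelWallTree T o)).Walk a b) :
    |b.1.2 - a.1.2| + (T.dist a.1.1 b.1.1 : ℤ) ≤ 2 * r.length := by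
  induction r with
  | nil => simp
  | cons h r ih =>
    rename_i a b c
    rw [skeleton_modelWallTree_adj] at h
    rw [SimpleGraph.Walk.length_cons]
    have h1 := hT.connected.dist_triangle (u := a.1.1) (v := b.1.1) (w := c.1.1)
    have h2 := abs_sub_le c.1.2 b.1.2 a.1.2
    have h3 : |b.1.2 - a.1.2| + (T.dist a.1.1 b.1.1 : ℤ) ≤ 2 := by
      rcases h with ⟨e, h⟩ | ⟨e, h⟩
      · rw [e]
        simp only [SimpleGraph.dist_self, Nat.cast_zero, add_zero, abs_le]
        omega
      · rw [SimpleGraph.dist_eq_one_iff_adj.2 e]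
        have : |b.1.2 - a.1.2| ≤ 1 := by
          rw [abs_le]
          omega
        push_cast
        omega
    push_cast
    omega

theorem wallTree_exists_vertical_walk (k : ℕ) {a b : WallTreeVertex T o} (h1 : a.1.1 = b.1.1)
    (h2 : b.1.2 = a.1.2 + 2 * k) :
    ∃ r : (skeleton (modelWallTree T o)).Walk a b, r.length = k := by
  induction k generalizing a with
  | zero =>
    have : a = b := Subtype.ext (Prod.ext h1 (by push_cast at h2; omega))
    subst this
    exact ⟨.nil, rfl⟩
  | succ k ih =>
    have he := a.2
    let c : WallTreeVertex T o := ⟨(a.1.1, a.1.2 + 2), by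
      rw [Int.even_iff] at he ⊢
      dsimp only
      omega⟩
    obtain ⟨r, hr⟩ := ih (a := c) h1 (by
      change b.1.2 = a.1.2 + 2 + 2 * k
      push_cast at h2
      omega)
    have hac : (skeleton (modelWallTree T o)).Adj a c :=
      skeleton_modelWallTree_adj.2 (Or.inl ⟨rfl, Or.inl rfl⟩)
    refine ⟨.cons hac r, ?_⟩
    rw [SimpleGraph.Walk.length_cons, hr]

theorem GeodesicallyConvex.mem_of_walks {V : Type u} {G : SimpleGraph V} {S : Set V}
    (hS : GeodesicallyConvex G S) {a b c : V} (ha : a ∈ S) (hb : b ∈ S) (p : G.Walk a c)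
    (r : G.Walk c b) (h : ∀ t : G.Walk a b, p.length + r.length ≤ t.length) : c ∈ S := by
  refine hS a ha b hb (p.append r) ?_ c (by simp)
  obtain ⟨t, ht⟩ := (p.append r).reachable.exists_walk_length_eq_dist
  have := h t
  have := SimpleGraph.dist_le (p.append r)
  rw [SimpleGraph.Walk.length_append] at *
  omega

theorem tree_mem_support (hT : T.IsTree) {x z c : W} (h : T.Adj z c) (hd : T.dist x c < T.dist x z)
    (r : T.Walk z x) : c ∈ r.support := by
  classical
  obtain ⟨p, hp, hc, -⟩ := exists_walk_through hT h hd
  have : p = r.bypass := congrArg Subtype.val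
    ((hT.isAcyclic.subsingleton_path z x).elim ⟨p, hp⟩ ⟨r.bypass, r.bypass_isPath⟩)
  rw [this] at hc
  exact r.support_bypass_subset_support hc

theorem exists_walk_support_subset {Z : Type u} {H : SimpleGraph Z} {f : Z → W}
    (hf : ∀ a b, H.Adj a b → f a = f b ∨ T.Adj (f a) (f b)) {a b : Z} (r : H.Walk a b) :
    ∃ p : T.Walk (f a) (f b), ∀ c ∈ p.support, c ∈ Set.range f := by
  induction r with
  | nil => exact ⟨.nil, by simp⟩
  | cons h r ih =>
    rename_i a b c
    obtain ⟨p, hp⟩ := ih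
    rcases hf _ _ h with e | e
    · rw [e]
      exact ⟨p, hp⟩
    · refine ⟨.cons e p, ?_⟩
      intro d hd
      rw [SimpleGraph.Walk.support_cons, List.mem_cons] at hd
      rcases hd with rfl | hd
      · exact ⟨a, rfl⟩
      · exact hp d hd

/-- The set of vertices `(z, n)` in the image of a map to the wall-tree. -/
def wallImage {Z : Type u} (j : Z → WallTreeVertex T o) : Set (W × ℤ) := Set.range fun x => (j x).1

/-- Most closure properties place the vertex on an explicit geodesic. Convexity of the projection
follows from connectedness: a walk in `Y` projects to a walk in the tree, which has to cover the
tree geodesic between its ends. -/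
theorem isWallConvex_wallImage (hT : T.IsTree) {Z : Type u} [Finite Z]
    {Y : AbstractSimplicialComplex Z} (hY : (skeleton Y).Connected) {j : Z → WallTreeVertex T o}
    (hj : IsIsometry Y (modelWallTree T o) j) : IsWallConvex T o (wallImage j) := by
  have hmem : ∀ a : WallTreeVertex T o, a ∈ Set.range j → a.1 ∈ wallImage j := by
    rintro _ ⟨x, rfl⟩
    exact ⟨x, rfl⟩
  have lift : ∀ {a}, a ∈ wallImage j → ∃ h, (⟨a, h⟩ : WallTreeVertex T o) ∈ Set.range j := by
    rintro _ ⟨x, rfl⟩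
    exact ⟨(j x).2, x, rfl⟩
  refine ⟨Set.finite_range _, ?_, ?_, ?_, ?_, ?_, ?_, ?_⟩
  · obtain ⟨x⟩ := hY.nonempty
    exact ⟨_, x, rfl⟩
  · rintro _ ⟨x, rfl⟩
    exact Int.even_iff.1 (j x).2
  · rintro _ ⟨_, ⟨x, rfl⟩, rfl⟩ _ ⟨_, ⟨z, rfl⟩, rfl⟩ c hc hd
    obtain ⟨r⟩ := hY.preconnected z x
    obtain ⟨p, hp⟩ := exists_walk_support_subset (T := T) (f := fun x => (j x).1.1) (by
      intro a b hab
      rw [← hj.adj_iff, skeleton_modelWallTree_adj] at hab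
      rcases hab with h | h
      · exact Or.inl h.1
      · exact Or.inr h.1) r
    obtain ⟨y, rfl⟩ := hp c (tree_mem_support hT hc hd p)
    exact ⟨_, ⟨y, rfl⟩, rfl⟩
  · intro z m n k hm hn h1 h2 h3
    obtain ⟨em, hm⟩ := lift hm
    obtain ⟨en, hn⟩ := lift hn
    have ek : Even (k - (T.dist o z : ℤ)) := by
      rw [Int.even_iff] at em ⊢
      dsimp only at em
      omega
    rw [Int.even_iff] at em en
    dsimp only at em en
    obtain ⟨i, hi⟩ := Int.eq_ofNat_of_zero_le (show 0 ≤ (k - m) / 2 by omega)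
    obtain ⟨i', hi'⟩ := Int.eq_ofNat_of_zero_le (show 0 ≤ (n - k) / 2 by omega)
    obtain ⟨p, hp⟩ := wallTree_exists_vertical_walk i (a := ⟨(z, m), Int.even_iff.2 em⟩)
      (b := ⟨(z, k), ek⟩) rfl (by dsimp only; omega)
    obtain ⟨r, hr⟩ := wallTree_exists_vertical_walk i' (a := ⟨(z, k), ek⟩)
      (b := ⟨(z, n), Int.even_iff.2 en⟩) rfl (by dsimp only; omega)
    refine hmem _ (hj.convex.mem_of_walks hm hn p r fun t => ?_)
    have h := wallTree_le_two_mul_length hT t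
    have h' := le_abs_self (n - m)
    dsimp only at h
    omega
  · intro z z' m n hz hm hn h
    obtain ⟨em, hm⟩ := lift hm
    obtain ⟨en, hn⟩ := lift hn
    have hd := tree_dist_adj hT o hz
    rw [Int.even_iff] at em en
    dsimp only at em en
    have ek : Even (m + 1 - (T.dist o z' : ℤ)) := by
      rw [Int.even_iff]
      omega
    obtain ⟨i, hi⟩ := Int.eq_ofNat_of_zero_le (show 0 ≤ (n - (m + 1)) / 2 by omega)
    obtain ⟨r, hr⟩ := wallTree_exists_vertical_walk i (a := ⟨(z', m + 1), ek⟩)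
      (b := ⟨(z', n), Int.even_iff.2 en⟩) rfl (by dsimp only; omega)
    refine hmem _ (hj.convex.mem_of_walks hm hn
      (SimpleGraph.Adj.toWalk (skeleton_modelWallTree_adj.2 (Or.inr ⟨hz, Or.inl rfl⟩))) r
      fun t => ?_)
    have h := wallTree_le_two_mul_length hT t
    have h' := le_abs_self (n - m)
    dsimp only at h
    rw [SimpleGraph.dist_eq_one_iff_adj.2 hz] at h
    simp only [SimpleGraph.Walk.length_cons, SimpleGraph.Walk.length_nil]
    omega
  · intro z z' m n hz hm hn h
    obtain ⟨em, hm⟩ := lift hm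
    obtain ⟨en, hn⟩ := lift hn
    have hd := tree_dist_adj hT o hz
    rw [Int.even_iff] at em en
    dsimp only at em en
    have ek : Even (m - 1 - (T.dist o z' : ℤ)) := by
      rw [Int.even_iff]
      omega
    obtain ⟨i, hi⟩ := Int.eq_ofNat_of_zero_le (show 0 ≤ (m - 1 - n) / 2 by omega)
    obtain ⟨r, hr⟩ := wallTree_exists_vertical_walk i (b := ⟨(z', m - 1), ek⟩)
      (a := ⟨(z', n), Int.even_iff.2 en⟩) rfl (by dsimp only; omega)
    refine hmem _ (hj.convex.mem_of_walks hm hn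
      (SimpleGraph.Adj.toWalk (skeleton_modelWallTree_adj.2
        (Or.inr ⟨hz, Or.inr (by dsimp only; omega)⟩))) r.reverse fun t => ?_)
    have h := wallTree_le_two_mul_length hT t
    have h' := neg_abs_le (n - m)
    dsimp only at h
    rw [SimpleGraph.dist_eq_one_iff_adj.2 hz] at h
    simp only [SimpleGraph.Walk.length_cons, SimpleGraph.Walk.length_nil,
      SimpleGraph.Walk.length_reverse]
    omega
  · intro y b c hb hc hne hn hyb hyc
    obtain ⟨eb, hb⟩ := lift hb
    obtain ⟨ec, hc⟩ := lift hc
    have ey : Even (y.2 - (T.dist o y.1 : ℤ)) := by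
      rw [Int.even_iff] at eb ⊢
      rcases hyb with ⟨h1, h2⟩ | ⟨h1, h2⟩
      · rw [h1]
        omega
      · have := tree_dist_adj hT o h1
        omega
    refine hmem ⟨y, ey⟩ (hj.convex.mem_of_walks hb hc
      (SimpleGraph.Adj.toWalk (skeleton_modelWallTree_adj.2 hyb.symm))
      (SimpleGraph.Adj.toWalk (skeleton_modelWallTree_adj.2 hyc)) fun t => ?_)
    rcases t with _ | ⟨h, _ | ⟨h', t⟩⟩
    · exact absurd rfl hne
    · exact absurd (skeleton_modelWallTree_adj.1 h) hn
    · simp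

end ModelWallTree

end BuildingSymmetry

/-! ### Isometries as good maps, and the conclusion -/

namespace BuildingSymmetry

variable {V : Type v} {X : AbstractSimplicialComplex V} {τ : V → ZMod 3} {W : Type w}
  {T : SimpleGraph W} {o : W} {Z : Type u} {Y : AbstractSimplicialComplex Z}
  {j : Z → WallTreeVertex T o} {g : W × ℤ → V}

theorem IsIsometry.wallGraph_adj_iff (hj : IsIsometry Y (modelWallTree T o) j) {a b : Z} :
    (wallGraph T).Adj (j a).1 (j b).1 ↔ (skeleton Y).Adj a b := by
  rw [← skeleton_modelWallTree_adj, hj.adj_iff]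

/-- For the colours: vertices of equal colour in a link have a join in the link, which is the middle
of a geodesic of length two. Convexity puts this join in the image, in the building as in the
wall-tree, and adjacency to it and to `y` carries the equality of colours across. -/
theorem isGood_of_isIsometry (hG : IsBuildingGraph (skeleton X) τ)
    (hj : IsIsometry Y (modelWallTree T o) j) (hA : IsWallConvex T o (wallImage j))
    (hg : IsIsometry Y X fun x => g (j x).1) : IsGood T (skeleton X) τ (wallImage j) g := by
  have hadj : ∀ {a b : Z}, (skeleton X).Adj (g (j a).1) (g (j b).1) ↔ (skeleton Y).Adj a b :=
    hg.adj_iff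
  constructor
  · rintro _ _ ⟨a, rfl⟩ ⟨b, rfl⟩ h
    exact hadj.2 (hj.wallGraph_adj_iff.1 h)
  · rintro _ _ _ ⟨y, rfl⟩ ⟨b, rfl⟩ ⟨c, rfl⟩ hb hc
    dsimp only at hb hc ⊢
    by_cases hbc : b = c
    · simp [hbc]
    constructor
    · intro hτ
      obtain ⟨x, hxy, hxb, hxc⟩ := hG.exists_join (hadj.2 (hj.wallGraph_adj_iff.1 hb))
        (hadj.2 (hj.wallGraph_adj_iff.1 hc)) hτ
      obtain ⟨w, rfl⟩ : x ∈ Set.range fun x => g (j x).1 := by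
        refine hg.convex.mem_of_walks ⟨b, rfl⟩ ⟨c, rfl⟩ (SimpleGraph.Adj.toWalk hxb.symm)
          (SimpleGraph.Adj.toWalk hxc) fun t => ?_
        have hne : g (j b).1 ≠ g (j c).1 := fun h => hbc (hg.injective h)
        have h1 : t.length ≠ 0 := fun h => hne (SimpleGraph.Walk.eq_of_length_eq_zero h)
        have h2 : t.length ≠ 1 := fun h =>
          hG.not_adj_of_color_eq hτ (SimpleGraph.Walk.adj_of_length_eq_one h)
        simp only [SimpleGraph.Walk.length_cons, SimpleGraph.Walk.length_nil]
        omega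
      have k1 := wallGraph_color (hj.wallGraph_adj_iff.2 (hadj.1 hxy))
      have k2 := wallGraph_color (hj.wallGraph_adj_iff.2 (hadj.1 hxb))
      have k3 := wallGraph_color (hj.wallGraph_adj_iff.2 (hadj.1 hxc))
      have k4 := wallGraph_color hb
      have k5 := wallGraph_color hc
      omega
    · intro h3
      obtain ⟨x, hxy, hxb, hxc⟩ := wallGraph_exists_join hb hc
        (fun h => hbc (hj.injective (Subtype.ext h))) h3
      obtain ⟨w, rfl⟩ := hA.join ⟨b, rfl⟩ ⟨c, rfl⟩ (fun h => hbc (hj.injective (Subtype.ext h)))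
        (fun h => wallGraph_color h h3) hxb hxc
      rw [hj.wallGraph_adj_iff, ← hadj] at hxy hxb hxc hb hc
      exact hG.color_eq hxy hxb hb hxc hc
  · rintro _ _ _ ⟨y, rfl⟩ ⟨b, rfl⟩ ⟨c, rfl⟩ - - h
    rw [hg.injective h]
  · rintro _ _ _ ⟨y, rfl⟩ ⟨b, rfl⟩ ⟨c, rfl⟩ - - h
    exact hj.wallGraph_adj_iff.2 (hadj.1 h)

/-- The local hypothesis of `isometric_of_local` concerns a common neighbour of two non-adjacent
images in the link of the image of `y`. It is that image, or else a join of vertices of equal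
colour; being unique, this join is the image of the one in the wall-tree, which convexity puts in
the domain. -/
theorem isIsometry_of_isGood (hG : IsBuildingGraph (skeleton X) τ) (hX : IsFlag X)
    (hY : (skeleton Y).Connected) (hj : IsIsometry Y (modelWallTree T o) j)
    (hA : IsWallConvex T o (wallImage j)) (hg : IsGood T (skeleton X) τ (wallImage j) g) :
    IsIsometry Y X fun x => g (j x).1 := by
  have hm : ∀ x, (j x).1 ∈ wallImage j := fun x => ⟨x, rfl⟩
  have hadj : ∀ a b : Z, (skeleton Y).Adj a b → (skeleton X).Adj (g (j a).1) (g (j b).1) :=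
    fun a b h => hg.adj (hm a) (hm b) (hj.wallGraph_adj_iff.2 h)
  obtain ⟨hdist, hconv⟩ := hG.isometric_of_local hY (f := fun x => g (j x).1) hadj (by
    intro y b c hb hc hbc hn
    have hb' := hj.wallGraph_adj_iff.2 hb
    have hc' := hj.wallGraph_adj_iff.2 hc
    have hbc' : (j b).1 ≠ (j c).1 := fun h => hbc (hj.injective (Subtype.ext h))
    have hne : g (j b).1 ≠ g (j c).1 := fun h =>
      hbc' (hg.inj (hm y) (hm b) (hm c) hb' hc' h)
    have hna : ¬ (skeleton X).Adj (g (j b).1) (g (j c).1) := fun h =>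
      hn (hj.wallGraph_adj_iff.1 (hg.induced (hm y) (hm b) (hm c) hb' hc' h))
    refine ⟨hne, hna, fun x hxb hxc => ?_⟩
    rcases hG.eq_or_adj_of_common (hadj _ _ hb) (hadj _ _ hc) hxb hxc hne hna with h | h
    · exact ⟨y, hb, hc, h.symm⟩
    have hcol := hg.color (hm y) (hm b) (hm c) hb' hc'
    by_cases h3 : (3 : ℤ) ∣ (j b).1.2 - (j c).1.2
    · obtain ⟨x', hxy', hxb', hxc'⟩ := wallGraph_exists_join hb' hc' hbc' h3
      obtain ⟨w, rfl⟩ := hA.join ⟨b, rfl⟩ ⟨c, rfl⟩ hbc' (fun h => wallGraph_color h h3) hxb' hxc'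
      rw [hj.wallGraph_adj_iff] at hxy' hxb' hxc'
      exact ⟨w, hxb', hxc', hG.join_unique (hadj _ _ hb) hne (hcol.2 h3) (hadj _ _ hxy')
        (hadj _ _ hxb') (hadj _ _ hxc') h hxb hxc⟩
    · exact absurd (hG.color_eq_of_ne (hadj _ _ hb) (hadj _ _ hc) h.symm
        (fun e => h3 (hcol.1 e)) (hG.color hxb.symm)) (hG.color hxc.symm))
  refine isIsometry_of_isFlag (hj.isFlag isFlag_modelWallTree) hX ?_ ?_
  · intro a b
    rw [← (hG.connected.preconnected _ _).coe_dist_eq_edist,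
      ← (hY.preconnected _ _).coe_dist_eq_edist, hdist]
  · apply geodesicallyConvex_of_dist
    rintro _ ⟨a, rfl⟩ _ ⟨b, rfl⟩ c - - h
    exact hconv a b c h

theorem isSymmetricFor_isConvexInWallTree (hX : IsA2TildeBuilding X) {q : ℕ}
    (hq : ∃ e ∈ X.faces, e.card = 2 ∧ (trianglesOver X e).encard = ((q + 1 : ℕ) : ℕ∞))
    (hT : T.IsTree) (hdeg : ∀ z, (T.neighborSet z).encard = ((q + 1 : ℕ) : ℕ∞)) :
    IsSymmetricFor.{u} X (fun {_} Y => IsConvexInWallTree T o Y) := by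
  intro Z' Z _ _ Y' Y hY' hY _ hPY i hi
  obtain ⟨-, j, hj⟩ := hPY
  obtain ⟨τ, hG⟩ := hX.exists_isRegularBuildingGraph hq
  obtain ⟨v₀⟩ := hX.nonempty
  have hG' := hG.toIsBuildingGraph
  have hji : IsIsometry Y' (modelWallTree T o) (j ∘ i) := IsIsometry.comp isFlag_modelWallTree hj hi
  have hA := isWallConvex_wallImage hT hY hj
  have hA' := isWallConvex_wallImage hT hY' hji
  have hsub : wallImage (j ∘ i) ⊆ wallImage j := by
    rintro _ ⟨x, rfl⟩
    exact ⟨i x, rfl⟩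
  have hU : UniformExtension T (skeleton X) τ v₀ (wallImage (j ∘ i)) (wallImage j) := by
    obtain ⟨p, t, hd, e⟩ := hA.exists_eq_doubleCone hT
    obtain ⟨p', t', hd', e'⟩ := hA'.exists_eq_doubleCone hT
    rw [e, e'] at hsub ⊢
    exact uniformExtension_doubleCone hT hG hdeg hd hd' hsub
  obtain ⟨N, hN, hcount⟩ := hU
  refine ⟨N, hN, fun α hα => ?_⟩
  have hinj : Function.Injective fun x => (j x).1 := fun a b h => hj.injective (Subtype.ext h)
  have hinj' : Function.Injective fun x => ((j ∘ i) x).1 :=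
    fun a b h => hji.injective (Subtype.ext h)
  let g : W × ℤ → V := Function.extend (fun x => ((j ∘ i) x).1) α fun _ => v₀
  have hgα : ∀ x, g ((j ∘ i) x).1 = α x := fun x => hinj'.extend_apply α (fun _ => v₀) x
  have hg : IsGood T (skeleton X) τ (wallImage (j ∘ i)) g :=
    isGood_of_isIsometry hG' hji hA' (by simpa only [hgα] using hα)
  -- Maps on `Z` become maps on the wall-tree with value `v₀` outside the image of `j`, which is the
  -- normalization in `UniformExtension`; the two sets to be counted then correspond.
  let E : (Z → V) → W × ℤ → V := fun β => Function.extend (fun x => (j x).1) β fun _ => v₀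
  have hE : ∀ β x, E β (j x).1 = β x := fun β x => hinj.extend_apply β (fun _ => v₀) x
  have hEinj : Function.Injective E := fun β β' h => funext fun x => by rw [← hE β, h, hE]
  rw [← hcount g hg, ← hEinj.encard_image]
  congr 1
  ext h
  constructor
  · rintro ⟨β, ⟨h1, h2⟩, rfl⟩
    refine ⟨isGood_of_isIsometry hG' hj hA (by simpa only [hE] using h1), ?_, ?_⟩
    · rintro _ ⟨x, rfl⟩
      dsimp only
      rw [hgα, ← h2]
      exact hE β (i x)
    · intro x hx
      exact Function.extend_apply' _ _ _ hx
  · rintro ⟨h1, h2, h3⟩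
    refine ⟨fun x => h (j x).1, ⟨isIsometry_of_isGood hG' hX.isFlag hY hj hA h1, ?_⟩, ?_⟩
    · funext x
      rw [← hgα x]
      exact h2 ⟨x, rfl⟩
    · funext a
      by_cases ha : a ∈ wallImage j
      · obtain ⟨x, rfl⟩ := ha
        exact hE _ x
      · rw [h3 a ha]
        exact Function.extend_apply' _ _ _ ha

end BuildingSymmetry

theorem mainTheorem4 {V : Type v} (X : AbstractSimplicialComplex V)
    (hX : BuildingSymmetry.IsA2TildeBuilding X) (q : ℕ)
    (hq : ∃ e ∈ X.faces, e.card = 2 ∧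
      (BuildingSymmetry.trianglesOver X e).encard = ((q + 1 : ℕ) : ℕ∞))
    {W : Type w} (T : SimpleGraph W) (hT : T.IsTree)
    (hdeg : ∀ z, (T.neighborSet z).encard = ((q + 1 : ℕ) : ℕ∞)) (o : W) :
    BuildingSymmetry.IsSymmetricFor.{u} X
      (fun {_} Y => BuildingSymmetry.IsConvexInWallTree T o Y) := by
  exact BuildingSymmetry.isSymmetricFor_isConvexInWallTree hX hq hT hdeg
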